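/- Let $(\Sigma_1,g_1)$ and $(\Sigma_2,g_2)$ be Lorentzian surfaces, i.e. connected oriented smooth $2$-manifolds with smooth metrics of signature $(1,1)$, and let $\kappa_1,\kappa_2$ be their Gauss curvatures. Let $j_k$ be the paracomplex structure of $\Sigma_k$: $j_k^2=\mathrm{Id}$, $g_k(j_k\cdot,j_k\cdot)=-g_k$, and $j_ke_1=e_2$ for oriented orthonormal frames with $|e_1|^2=1=-|e_2|^2$. For $\epsilon=\pm1$ equip $\Sigma_1\times\Sigma_2$ with the para-Kähler structure $$G^{\epsilon}=g_1+\epsilon g_2,\qquad J=j_1\oplus j_2,\qquad \Omega^{\epsilon}=G^{\epsilon}(J\cdot,\cdot).$$ Let $\Phi:S\to\Sigma_1\times\Sigma_2$ be a smooth immersion of a smooth surface $S$. It is Lagrangian if $\Phi^*\Omega^\epsilon=0$, and $G^\epsilon$-minimal if $\Phi^*G^\epsilon$ is nondegenerate and the mean curvature vector of $\Phi$ with respect to $G^\epsilon$ vanishes. It is a product $\phi\times\psi$ of geodesics if around each point of $S$ there are coordinates $(s,t)$, with values in a product of open intervals, in which $\Phi(s,t)=(\phi(s),\psi(t))$ with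 geodesics $\phi$ of $(\Sigma_1,g_1)$ and $\psi$ of $(\Sigma_2,g_2)$. A $G^\epsilon$-minimal immersion is stable if the second variation of the volume $\int_S\sqrt{|\det\Phi^*G^\epsilon|}$ is semidefinite: the volume is twice continuously differentiable at $u=0$ along every smooth compactly supported normal variation $(\Phi_u)$ of $\Phi=\Phi_0$, and either its second derivative at $u=0$ is $\le 0$ for all these variations, or it is $\ge0$ for all of them. (i) If $\kappa_1\le 0$ and $\kappa_2\le0$ everywhere (resp. $\kappa_1\ge0$ and $\kappa_2\ge0$ everywhere), then every $G^+$-minimal $\Omega^+$-Lagrangian product $\phi\times\psi$ of spacelike (resp. timelike) geodesics is stable. (ii) If $\kappa_1\le0\le\kappa_2$ everywhere, then every $G^-$-minimal $\Omega^-$-Lagrangian product $\phi\times\psi$ of a spacelike geodesic $\phi$ and a timelike geodesic $\psi$ is stable. In particular, (i) and (ii) hold when moreover $\kappa_1,\kappa_2$ satisfy one of the following for the respective $\epsilon$: both metrics are non-flat almost everywhere and $\epsilon\kappa_1\kappa_2<0$ away from flat points, or exactly one of them is flat and the other is non-flat almost everywhere. -/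

import Mathlib

open Set Manifold
open scoped ContDiff Topology

noncomputable section

namespace ParaKahlerProduct

/-- The model plane of all surfaces. -/
abbrev Plane : Type := EuclideanSpace ℝ (Fin 2)

/-- The standard basis of the model plane. -/
def basisVec (i : Fin 2) : Plane := EuclideanSpace.single i 1

/-- The partial derivative `∂_i f` of a function on the model plane. -/
def pd (i : Fin 2) (f : Plane → ℝ) (y : Plane) : ℝ := fderiv ℝ f y (basisVec i)

section LorentzSurfaces

variable {M : Type*} [TopologicalSpace M] [ChartedSpace Plane M] [IsManifold (𝓡 2) ∞ M]

/-- A smooth Lorentzian (nondegenerate, indefinite) metric on a surface. -/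
structure LorentzMetric (M : Type*) [TopologicalSpace M] [ChartedSpace Plane M]
    [IsManifold (𝓡 2) ∞ M] where
  /-- the scalar product on the tangent planes -/
  inner (x : M) : TangentSpace (𝓡 2) x →L[ℝ] TangentSpace (𝓡 2) x →L[ℝ] ℝ
  symm (x : M) (v w : TangentSpace (𝓡 2) x) : inner x v w = inner x w v
  nondegenerate (x : M) (v : TangentSpace (𝓡 2) x) : (∀ w, inner x v w = 0) → v = 0
  indefinite (x : M) : (∃ v, 0 < inner x v v) ∧ (∃ v, inner x v v < 0)
  contMDiff : ContMDiff (𝓡 2) ((𝓡 2).prod 𝓘(ℝ, Plane →L[ℝ] Plane →L[ℝ] ℝ)) ∞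
    (fun x ↦ Bundle.TotalSpace.mk' (Plane →L[ℝ] Plane →L[ℝ] ℝ)
      (E := fun x : M ↦ TangentSpace (𝓡 2) x →L[ℝ] TangentSpace (𝓡 2) x →L[ℝ] ℝ) x (inner x))

/-- A smooth paracomplex structure `j` compatible with a Lorentzian metric `g`, that is `j² = Id`
and `g(j·, j·) = -g`. On a Lorentzian surface, such a `j` is the same thing as an orientation:
for every oriented orthonormal frame `(e₁, e₂)` with `|e₁|² = 1 = -|e₂|²` one has `j e₁ = e₂` and
`j e₂ = e₁`, and the opposite orientation corresponds to `-j`. -/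
structure ParaComplexStructure (g : LorentzMetric M) where
  /-- the endomorphism of the tangent planes -/
  toEnd (x : M) : TangentSpace (𝓡 2) x →L[ℝ] TangentSpace (𝓡 2) x
  sq (x : M) (v : TangentSpace (𝓡 2) x) : toEnd x (toEnd x v) = v
  anti_isometry (x : M) (v w : TangentSpace (𝓡 2) x) :
    g.inner x (toEnd x v) (toEnd x w) = - g.inner x v w
  contMDiff : ContMDiff (𝓡 2) ((𝓡 2).prod 𝓘(ℝ, Plane →L[ℝ] Plane)) ∞
    (fun x ↦ Bundle.TotalSpace.mk' (Plane →L[ℝ] Plane)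
      (E := fun x : M ↦ TangentSpace (𝓡 2) x →L[ℝ] TangentSpace (𝓡 2) x) x (toEnd x))

namespace LorentzMetric

variable (g : LorentzMetric M) (e : OpenPartialHomeomorph M Plane)

/-- The matrix `(g_ij)` of the metric in the chart `e`, as a function on the target of `e`. -/
def coord (y : Plane) : Matrix (Fin 2) (Fin 2) ℝ :=
  Matrix.of fun i j ↦ g.inner (e.symm y)
    (mfderiv (𝓡 2) (𝓡 2) e.symm y (basisVec i)) (mfderiv (𝓡 2) (𝓡 2) e.symm y (basisVec j))

/-- The Christoffel symbol `Γ^k_ij` of the Levi-Civita connection in the chart `e`. -/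
def christoffel (k i j : Fin 2) (y : Plane) : ℝ :=
  (1 / 2) * ∑ l, (g.coord e y)⁻¹ k l *
    (pd i (fun z ↦ g.coord e z j l) y + pd j (fun z ↦ g.coord e z i l) y
      - pd l (fun z ↦ g.coord e z i j) y)

/-- The component `R^l` of `R(∂_i, ∂_j) ∂_k` in the chart `e`, where
`R(X, Y) Z = ∇_X ∇_Y Z - ∇_Y ∇_X Z - ∇_[X,Y] Z`. -/
def riemann (l i j k : Fin 2) (y : Plane) : ℝ :=
  pd i (g.christoffel e l j k) y - pd j (g.christoffel e l i k) y
    + ∑ m, (g.christoffel e l i m y * g.christoffel e m j k y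
      - g.christoffel e l j m y * g.christoffel e m i k y)

/-- The Gauss curvature `g(R(X, Y) Y, X) / (g(X, X) g(Y, Y) - g(X, Y)²)` at `x`, computed with the
coordinate frame of the preferred chart at `x`. -/
def gaussCurvature (x : M) : ℝ :=
  let e := chartAt Plane x
  (∑ l, g.coord e (e x) 0 l * g.riemann e l 0 1 1 (e x)) / (g.coord e (e x)).det

/-- The velocity of a curve. -/
def velocity (γ : ℝ → M) (s : ℝ) : TangentSpace (𝓡 2) (γ s) :=
  mfderiv 𝓘(ℝ, ℝ) (𝓡 2) γ s (1 : ℝ)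

/-- `γ` is a (smooth, affinely parametrised) geodesic on the open set `I` of parameters. The
geodesic equation at the parameter `s` is written in the preferred chart at `γ s`. -/
def IsGeodesicOn (γ : ℝ → M) (I : Set ℝ) : Prop :=
  ContMDiffOn 𝓘(ℝ, ℝ) (𝓡 2) ∞ γ I ∧
  ∀ s ∈ I, ∀ k : Fin 2,
    let e := chartAt Plane (γ s)
    let c : Fin 2 → ℝ → ℝ := fun i r ↦ e (γ r) i
    deriv (deriv (c k)) s
      + ∑ i, ∑ j, g.christoffel e k i j (e (γ s)) * deriv (c i) s * deriv (c j) s = 0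

/-- `γ` is spacelike on `I`. -/
def IsSpacelikeOn (γ : ℝ → M) (I : Set ℝ) : Prop :=
  ∀ s ∈ I, 0 < g.inner (γ s) (velocity γ s) (velocity γ s)

/-- `γ` is timelike on `I`. -/
def IsTimelikeOn (γ : ℝ → M) (I : Set ℝ) : Prop :=
  ∀ s ∈ I, g.inner (γ s) (velocity γ s) (velocity γ s) < 0

/-- `γ` is a spacelike geodesic on `I`. -/
def IsSpacelikeGeodesicOn (γ : ℝ → M) (I : Set ℝ) : Prop :=
  g.IsGeodesicOn γ I ∧ g.IsSpacelikeOn γ I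

/-- `γ` is a timelike geodesic on `I`. -/
def IsTimelikeGeodesicOn (γ : ℝ → M) (I : Set ℝ) : Prop :=
  g.IsGeodesicOn γ I ∧ g.IsTimelikeOn γ I

/-- For a smooth map `f` from a surface `S` to `M`, the vector `∇_{∂_a} (df ∂_b)` at `f p`, where
`∂_0, ∂_1` is the coordinate frame of the preferred chart at `p` and `∇` is the Levi-Civita
connection of `g`. Its components in the preferred chart `e` at `f p` are
`∂_a ∂_b f^k + Γ^k_ij ∂_a f^i ∂_b f^j`. -/
def covHess {S : Type*} [TopologicalSpace S] [ChartedSpace Plane S]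
    (f : S → M) (p : S) (a b : Fin 2) : TangentSpace (𝓡 2) (f p) :=
  let c := chartAt Plane p
  let e := chartAt Plane (f p)
  let F : Fin 2 → Plane → ℝ := fun k z ↦ e (f (c.symm z)) k
  mfderiv (𝓡 2) (𝓡 2) e.symm (e (f p))
    (∑ k, (pd a (pd b (F k)) (c p)
      + ∑ i, ∑ j, g.christoffel e k i j (e (f p)) * pd a (F i) (c p) * pd b (F j) (c p))
        • basisVec k)

end LorentzMetric

end LorentzSurfaces

section Products

variable {M₁ : Type*} [TopologicalSpace M₁] [ChartedSpace Plane M₁] [IsManifold (𝓡 2) ∞ M₁]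
  {M₂ : Type*} [TopologicalSpace M₂] [ChartedSpace Plane M₂] [IsManifold (𝓡 2) ∞ M₂]
  {S : Type*} [TopologicalSpace S] [ChartedSpace Plane S]

/-- The splitting `T_(x,y) (M₁ × M₂) = T_x M₁ ⊕ T_y M₂`. -/
abbrev ProdTangent (q : M₁ × M₂) : Type :=
  TangentSpace (𝓡 2) q.1 × TangentSpace (𝓡 2) q.2

/-- The metric `G^ε = g₁ + ε g₂` on `M₁ × M₂`. -/
def prodMetric (g₁ : LorentzMetric M₁) (g₂ : LorentzMetric M₂) (ε : ℝ) (q : M₁ × M₂)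
    (X Y : ProdTangent q) : ℝ :=
  g₁.inner q.1 X.1 Y.1 + ε * g₂.inner q.2 X.2 Y.2

/-- The endomorphism `J = j₁ ⊕ j₂`. -/
def prodJ {g₁ : LorentzMetric M₁} {g₂ : LorentzMetric M₂}
    (j₁ : ParaComplexStructure g₁) (j₂ : ParaComplexStructure g₂) (q : M₁ × M₂)
    (X : ProdTangent q) : ProdTangent q :=
  (j₁.toEnd q.1 X.1, j₂.toEnd q.2 X.2)

/-- The symplectic form `Ω^ε = π₁^* ω₁ + ε π₂^* ω₂ = G^ε(J·, ·)`, where `ω_k = g_k(j_k·, ·)`. -/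
def prodOmega {g₁ : LorentzMetric M₁} {g₂ : LorentzMetric M₂}
    (j₁ : ParaComplexStructure g₁) (j₂ : ParaComplexStructure g₂) (ε : ℝ) (q : M₁ × M₂)
    (X Y : ProdTangent q) : ℝ :=
  prodMetric g₁ g₂ ε q (prodJ j₁ j₂ q X) Y

/-- The differential `dΦ = (dφ, dψ)` of a map `Φ = (φ, ψ) : S → M₁ × M₂`. -/
def dMap (Φ : S → M₁ × M₂) (p : S) (v : TangentSpace (𝓡 2) p) : ProdTangent (Φ p) :=
  (mfderiv (𝓡 2) (𝓡 2) (fun p ↦ (Φ p).1) p v, mfderiv (𝓡 2) (𝓡 2) (fun p ↦ (Φ p).2) p v)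

/-- `Φ : S → M₁ × M₂` is a smooth immersion. -/
def IsSmoothImmersion (Φ : S → M₁ × M₂) : Prop :=
  ContMDiff (𝓡 2) ((𝓡 2).prod (𝓡 2)) ∞ Φ ∧ ∀ p, Function.Injective (dMap Φ p)

/-- `Φ` is Lagrangian: `Φ^* Ω^ε = 0`. -/
def IsLagrangian {g₁ : LorentzMetric M₁} {g₂ : LorentzMetric M₂}
    (j₁ : ParaComplexStructure g₁) (j₂ : ParaComplexStructure g₂) (ε : ℝ)
    (Φ : S → M₁ × M₂) : Prop :=
  ∀ (p : S) (v w : TangentSpace (𝓡 2) p),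
    prodOmega j₁ j₂ ε (Φ p) (dMap Φ p v) (dMap Φ p w) = 0

/-- The matrix of the induced metric `Φ^* G^ε` in the chart `c` of `S`, as a function on the target
of `c`. -/
def inducedCoord (g₁ : LorentzMetric M₁) (g₂ : LorentzMetric M₂) (ε : ℝ) (Φ : S → M₁ × M₂)
    (c : OpenPartialHomeomorph S Plane) (y : Plane) : Matrix (Fin 2) (Fin 2) ℝ :=
  Matrix.of fun a b ↦ prodMetric g₁ g₂ ε (Φ (c.symm y))
    (dMap (fun z ↦ Φ (c.symm z)) y (basisVec a)) (dMap (fun z ↦ Φ (c.symm z)) y (basisVec b))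

/-- The vector `X` at `Φ p` is normal to `Φ`. -/
def IsNormalAt (g₁ : LorentzMetric M₁) (g₂ : LorentzMetric M₂) (ε : ℝ) (Φ : S → M₁ × M₂)
    (p : S) (X : ProdTangent (Φ p)) : Prop :=
  ∀ v : TangentSpace (𝓡 2) p, prodMetric g₁ g₂ ε (Φ p) X (dMap Φ p v) = 0

/-- `Φ` is `G^ε`-minimal: the induced metric `h` is nondegenerate and the mean curvature vector `H`
vanishes. Since `2 H` is the normal part of `∑ h^ab ∇_{∂_a} (dΦ ∂_b)`, where the Levi-Civita
connection of `G^ε` is the sum of those of `g₁` and `g₂`, the vanishing of `H` means that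
`G^ε(∑ h^ab ∇_{∂_a} (dΦ ∂_b), N) = 0` for all normal vectors `N`. -/
def IsMinimal (g₁ : LorentzMetric M₁) (g₂ : LorentzMetric M₂) (ε : ℝ) (Φ : S → M₁ × M₂) : Prop :=
  ∀ p : S,
    let h := inducedCoord g₁ g₂ ε Φ (chartAt Plane p) (chartAt Plane p p)
    h.det ≠ 0 ∧
    ∀ N : ProdTangent (Φ p), IsNormalAt g₁ g₂ ε Φ p N →
      ∑ a, ∑ b, h⁻¹ a b * prodMetric g₁ g₂ ε (Φ p)
        (g₁.covHess (fun p ↦ (Φ p).1) p a b, g₂.covHess (fun p ↦ (Φ p).2) p a b) N = 0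

/-- `Φ` is (locally) the product `φ × ψ` of a curve `φ` in `M₁` with property `P₁` and a curve `ψ`
in `M₂` with property `P₂`: around every point of `S` there is a chart `(s, t)` with values in
a product `I × J` of open intervals in which `Φ(s, t) = (φ(s), ψ(t))`. -/
def IsLocalProductOf [IsManifold (𝓡 2) ∞ S] (P₁ : (ℝ → M₁) → Set ℝ → Prop)
    (P₂ : (ℝ → M₂) → Set ℝ → Prop) (Φ : S → M₁ × M₂) : Prop :=
  ∀ p : S, ∃ c ∈ IsManifold.maximalAtlas (𝓡 2) ∞ S, p ∈ c.source ∧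
    ∃ I J : Set ℝ, IsOpen I ∧ I.OrdConnected ∧ IsOpen J ∧ J.OrdConnected ∧
      c.target = {y | y 0 ∈ I ∧ y 1 ∈ J} ∧
      ∃ (φ : ℝ → M₁) (ψ : ℝ → M₂), P₁ φ I ∧ P₂ ψ J ∧
        ∀ y ∈ c.target, Φ (c.symm y) = (φ (y 0), ψ (y 1))

/-- A nonempty second countable surface is covered by a sequence of preferred charts. -/
theorem exists_chartSeq (S : Type*) [TopologicalSpace S] [ChartedSpace Plane S]
    [SecondCountableTopology S] [Nonempty S] :
    ∃ x : ℕ → S, ⋃ n, (chartAt Plane (x n)).source = univ := by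
  obtain ⟨s, hs, hU⟩ := TopologicalSpace.countable_cover_nhds
    (f := fun x : S ↦ (chartAt Plane x).source) (fun x ↦ chart_source_mem_nhds Plane x)
  have hne : s.Nonempty := by
    rw [nonempty_iff_ne_empty]
    rintro rfl
    simp only [mem_empty_iff_false, iUnion_of_empty, iUnion_empty] at hU
    exact empty_ne_univ hU
  obtain ⟨x, rfl⟩ := hs.exists_eq_range hne
  exact ⟨x, by simpa using hU⟩

/-- A sequence of charts whose sources cover `S`. -/
def chartSeq (S : Type*) [TopologicalSpace S] [ChartedSpace Plane S]
    [SecondCountableTopology S] [Nonempty S] (n : ℕ) : OpenPartialHomeomorph S Plane :=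
  chartAt Plane ((exists_chartSeq S).choose n)

variable [SecondCountableTopology S] [Nonempty S]

/-- The volume `∫_K dV` of `K ⊆ S` with respect to `Φ^* G^ε`. The surface `S` is cut into the
disjoint pieces `U_n \ (U_0 ∪ … ∪ U_{n-1})`, where `U_0, U_1, …` are the domains of a sequence of
charts covering `S`, and the volume element on the `n`-th piece is `√|det h| dy` in the `n`-th
chart, where `h` is the matrix of `Φ^* G^ε` in that chart. -/
def volumeOn (g₁ : LorentzMetric M₁) (g₂ : LorentzMetric M₂) (ε : ℝ) (Φ : S → M₁ × M₂)
    (K : Set S) : ℝ :=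
  (∑' n, ∫⁻ y in (chartSeq S n).target ∩
      (chartSeq S n).symm ⁻¹' (K ∩ disjointed (fun m ↦ (chartSeq S m).source) n),
    ENNReal.ofReal (√|(inducedCoord g₁ g₂ ε Φ (chartSeq S n) y).det|)).toReal

/-- A smooth compactly supported normal variation `(Φ_u)`, `|u| < δ`, of `Φ = Φ_0`: outside of the
compact set `K` all `Φ_u` agree with `Φ`, and the velocity at `u = 0` is normal to `Φ`. -/
structure NormalVariation (g₁ : LorentzMetric M₁) (g₂ : LorentzMetric M₂) (ε : ℝ)
    (Φ : S → M₁ × M₂) where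
  /-- the range of the parameter -/
  δ : ℝ
  δ_pos : 0 < δ
  /-- the family of maps -/
  map : ℝ → S → M₁ × M₂
  smooth : ContMDiffOn (𝓘(ℝ, ℝ).prod (𝓡 2)) ((𝓡 2).prod (𝓡 2)) ∞
    (fun z : ℝ × S ↦ map z.1 z.2) (Ioo (-δ) δ ×ˢ univ)
  map_zero : map 0 = Φ
  /-- a compact set that contains the support -/
  K : Set S
  isCompact : IsCompact K
  eq_off (u : ℝ) (_ : u ∈ Ioo (-δ) δ) (p : S) (_ : p ∉ K) : map u p = Φ p
  normal (p : S) : IsNormalAt g₁ g₂ ε Φ p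
    (mfderiv 𝓘(ℝ, ℝ) (𝓡 2) (fun u ↦ (map u p).1) 0 (1 : ℝ),
      mfderiv 𝓘(ℝ, ℝ) (𝓡 2) (fun u ↦ (map u p).2) 0 (1 : ℝ))

/-- The volume of the variation, as a function of the parameter. It is taken over the compact set
`K` outside of which the variation is constant. -/
def NormalVariation.vol {g₁ : LorentzMetric M₁} {g₂ : LorentzMetric M₂} {ε : ℝ}
    {Φ : S → M₁ × M₂} (F : NormalVariation g₁ g₂ ε Φ) (u : ℝ) : ℝ :=
  volumeOn g₁ g₂ ε (F.map u) F.K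

/-- A `G^ε`-minimal surface is stable if the second variation of the volume is semidefinite, that is
if it has the same (weak) sign for all compactly supported normal variations. -/
def IsStable (g₁ : LorentzMetric M₁) (g₂ : LorentzMetric M₂) (ε : ℝ) (Φ : S → M₁ × M₂) : Prop :=
  (∀ F : NormalVariation g₁ g₂ ε Φ, ContDiffAt ℝ 2 F.vol 0 ∧ iteratedDeriv 2 F.vol 0 ≤ 0) ∨
  (∀ F : NormalVariation g₁ g₂ ε Φ, ContDiffAt ℝ 2 F.vol 0 ∧ 0 ≤ iteratedDeriv 2 F.vol 0)

end Products

end ParaKahlerProduct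

end

/-! Write φ and ψ for the two geodesics. In coordinates adapted to the product, the induced metric
is diagonal with locally constant entries g₁(φ', φ') and ε g₂(ψ', ψ'). In each of the three cases
both entries have one common sign s: s = 1 for two spacelike geodesics and for the mixed case with ε
= -1, s = -1 for two timelike ones. So the induced metric is definite, and it turns out that the
second variation of the volume is always ≤ 0.

Let V = (V₁, V₂) be the velocity of a normal variation at u = 0 and let θ = G^ε(∇_u ∂_u Φ, ·) be the
tangential part of its acceleration. For a coordinate field ∂_a, the quantity ½ ∂_u² G^ε(∂_a, ∂_a) -
∂_a θ(∂_a) is computed by commuting covariant derivatives (`second_variation_coordForm`). Each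
factor contributes a curvature term, a gradient term g_k(∇_a V_k, ∇_a V_k), and a term containing
∇_a ∂_a, which is zero because φ and ψ are geodesics. The curvature term is -κ_k · det g_k times a
square, and det g_k < 0, so the hypotheses on κ₁ and κ₂ fix its sign. For the gradient term,
normality splits: V_k is orthogonal to the geodesic in its own surface, and then so is ∇_a V_k. In a
Lorentzian plane, orthogonal vectors have squares of opposite weak sign. Hence both terms have the
sign opposite to s (`second_variation_pullForm_nonpos`, `second_variation_totalForm_nonpos`).

In the second derivative of √det, all other terms are negatives of squares. So the second variation
of the area density is at most the divergence of the vector field X dual to θ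
(`second_variation_density_le`). X vanishes where the variation is constant, hence its divergence
integrates to zero. This is carried out with a partition of unity (χ_i) subordinate to product
charts: ∫ χ_i · density ≤ -∫ dχ_i(X) by `integral_mul_secondDensity_le`, and the right sides add up
to zero in `integral_secondDensity_nonpos`.

It remains to see that the volume is C² at 0 and may be differentiated under the integral
(`contDiffAt_volumeOn_family`). The chartwise volume is a measure that every chart computes, and the
volume of Φ_u is the integral of the root of a smooth function of (u, p) against the measure of Φ_0.
-/

noncomputable section

namespace ParaKahlerProduct

/-! ### Directional derivatives and pulled-back forms in coordinates -/

section Calculus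

variable {E : Type*} [NormedAddCommGroup E] [NormedSpace ℝ E]

/-- The derivative of `f` in the constant direction `ξ`. -/
def dirDeriv (ξ : E) (f : E → ℝ) (q : E) : ℝ := fderiv ℝ f q ξ

variable {U : Set E} {f h k : E → ℝ} {ξ η α β : E} {q : E}

theorem diffAt_of_smoothOn (hU : IsOpen U) (hf : ContDiffOn ℝ ∞ f U) (hq : q ∈ U) :
    DifferentiableAt ℝ f q :=
  (hf.contDiffAt (hU.mem_nhds hq)).differentiableAt (by simp)

theorem smoothOn_dirDeriv (hU : IsOpen U) (hf : ContDiffOn ℝ ∞ f U) :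
    ContDiffOn ℝ ∞ (dirDeriv ξ f) U :=
  (hf.fderiv_of_isOpen hU (m := ∞) (by simp)).clm_apply contDiffOn_const

theorem dirDeriv_congr (hU : IsOpen U) (hfh : EqOn f h U) (hq : q ∈ U) :
    dirDeriv ξ f q = dirDeriv ξ h q := by
  have : f =ᶠ[𝓝 q] h := by filter_upwards [hU.mem_nhds hq] with r hr using hfh hr
  rw [dirDeriv, this.fderiv_eq, dirDeriv]

theorem dirDeriv_mul (hf : DifferentiableAt ℝ f q) (hh : DifferentiableAt ℝ h q) :
    dirDeriv ξ (fun r ↦ f r * h r) q = dirDeriv ξ f q * h q + f q * dirDeriv ξ h q := by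
  simp [dirDeriv, fderiv_fun_mul hf hh]; ring

theorem dirDeriv_add (hf : DifferentiableAt ℝ f q) (hh : DifferentiableAt ℝ h q) :
    dirDeriv ξ (fun r ↦ f r + h r) q = dirDeriv ξ f q + dirDeriv ξ h q := by
  simp [dirDeriv, fderiv_fun_add hf hh]

theorem dirDeriv_sub (hf : DifferentiableAt ℝ f q) (hh : DifferentiableAt ℝ h q) :
    dirDeriv ξ (fun r ↦ f r - h r) q = dirDeriv ξ f q - dirDeriv ξ h q := by
  simp [dirDeriv, fderiv_fun_sub hf hh]

theorem dirDeriv_const_mul (c : ℝ) (hf : DifferentiableAt ℝ f q) :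
    dirDeriv ξ (fun r ↦ c * f r) q = c * dirDeriv ξ f q := by
  simp [dirDeriv, fderiv_const_mul hf c]

theorem dirDeriv_sum {ι : Type*} (s : Finset ι) {F : ι → E → ℝ}
    (hf : ∀ i ∈ s, DifferentiableAt ℝ (F i) q) :
    dirDeriv ξ (fun r ↦ ∑ i ∈ s, F i r) q = ∑ i ∈ s, dirDeriv ξ (F i) q := by
  simp [dirDeriv, fderiv_fun_sum hf]

theorem dirDeriv_comm (hU : IsOpen U) (hf : ContDiffOn ℝ ∞ f U) (hq : q ∈ U) :
    dirDeriv ξ (dirDeriv η f) q = dirDeriv η (dirDeriv ξ f) q := by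
  have h1 : ContDiffAt ℝ ∞ f q := hf.contDiffAt (hU.mem_nhds hq)
  have h2 : DifferentiableAt ℝ (fderiv ℝ f) q :=
    (h1.fderiv_right (m := ∞) (by simp)).differentiableAt (by simp)
  have hs : IsSymmSndFDerivAt ℝ f q := h1.isSymmSndFDerivAt (by
    rw [minSmoothness_of_isRCLikeNormedField]
    exact WithTop.coe_le_coe.2 (show (2 : ℕ∞) ≤ ⊤ from le_top))
  have key : ∀ a b : E, dirDeriv a (dirDeriv b f) q = fderiv ℝ (fderiv ℝ f) q a b := by
    intro a b
    have : dirDeriv b f = fun r ↦ fderiv ℝ f r b := rfl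
    rw [this, dirDeriv, fderiv_clm_apply h2 (differentiableAt_const b)]
    simp
  rw [key, key, hs]

theorem dirDeriv_mul_mul (hf : DifferentiableAt ℝ f q) (hh : DifferentiableAt ℝ h q)
    (hk : DifferentiableAt ℝ k q) :
    dirDeriv ξ (fun r ↦ f r * h r * k r) q =
      dirDeriv ξ f q * h q * k q + f q * dirDeriv ξ h q * k q + f q * h q * dirDeriv ξ k q := by
  rw [dirDeriv_mul (hf.fun_mul hh) hk, dirDeriv_mul hf hh]; ring

theorem dirDeriv_dirDeriv_mul_mul (hU : IsOpen U) (hf : ContDiffOn ℝ ∞ f U)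
    (hh : ContDiffOn ℝ ∞ h U) (hk : ContDiffOn ℝ ∞ k U) (hq : q ∈ U) :
    dirDeriv α (dirDeriv β (fun r ↦ f r * h r * k r)) q =
      dirDeriv α (dirDeriv β f) q * h q * k q + dirDeriv β f q * dirDeriv α h q * k q
        + dirDeriv β f q * h q * dirDeriv α k q
      + (dirDeriv α f q * dirDeriv β h q * k q + f q * dirDeriv α (dirDeriv β h) q * k q
        + f q * dirDeriv β h q * dirDeriv α k q)
      + (dirDeriv α f q * h q * dirDeriv β k q + f q * dirDeriv α h q * dirDeriv β k q
        + f q * h q * dirDeriv α (dirDeriv β k) q) := by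
  have e : EqOn (dirDeriv β (fun r ↦ f r * h r * k r))
      (fun q ↦ dirDeriv β f q * h q * k q + f q * dirDeriv β h q * k q
        + f q * h q * dirDeriv β k q) U := fun r hr ↦
    dirDeriv_mul_mul (diffAt_of_smoothOn hU hf hr) (diffAt_of_smoothOn hU hh hr)
      (diffAt_of_smoothOn hU hk hr)
  rw [dirDeriv_congr hU e hq]
  have d1 := diffAt_of_smoothOn hU hf hq
  have d2 := diffAt_of_smoothOn hU hh hq
  have d3 := diffAt_of_smoothOn hU hk hq
  have d4 := diffAt_of_smoothOn hU (smoothOn_dirDeriv (ξ := β) hU hf) hq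
  have d5 := diffAt_of_smoothOn hU (smoothOn_dirDeriv (ξ := β) hU hh) hq
  have d6 := diffAt_of_smoothOn hU (smoothOn_dirDeriv (ξ := β) hU hk) hq
  rw [dirDeriv_add (((d4.fun_mul d2).fun_mul d3).fun_add ((d1.fun_mul d5).fun_mul d3))
    ((d1.fun_mul d2).fun_mul d6), dirDeriv_add ((d4.fun_mul d2).fun_mul d3)
    ((d1.fun_mul d5).fun_mul d3), dirDeriv_mul_mul d4 d2 d3, dirDeriv_mul_mul d1 d5 d3,
    dirDeriv_mul_mul d1 d2 d6]

theorem plane_sum_basis (v : Plane) : v = ∑ i, v i • basisVec i := by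
  ext j
  fin_cases j <;> simp [basisVec]

theorem smoothOn_coord {x : E → Plane} (hx : ContDiffOn ℝ ∞ x U) (i : Fin 2) :
    ContDiffOn ℝ ∞ (fun r ↦ x r i) U :=
  (contDiffOn_euclidean.1 hx) i

theorem fderiv_coord {x : E → Plane} (hx : DifferentiableAt ℝ x q) (i : Fin 2) :
    (fderiv ℝ x q ξ) i = dirDeriv ξ (fun r ↦ x r i) q := by
  have := ((EuclideanSpace.proj (𝕜 := ℝ) i).hasFDerivAt.comp q hx.hasFDerivAt).fderiv
  have e : (fun r ↦ x r i) = (EuclideanSpace.proj (𝕜 := ℝ) i : Plane →L[ℝ] ℝ) ∘ x := rfl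
  rw [dirDeriv, e, this]; rfl

/-- The chain rule in coordinates. -/
theorem dirDeriv_comp {x : E → Plane} {G : Plane → ℝ} (hx : DifferentiableAt ℝ x q)
    (hG : DifferentiableAt ℝ G (x q)) :
    dirDeriv ξ (fun r ↦ G (x r)) q = ∑ k, pd k G (x q) * dirDeriv ξ (fun r ↦ x r k) q := by
  have h1 : dirDeriv ξ (fun r ↦ G (x r)) q = fderiv ℝ G (x q) (fderiv ℝ x q ξ) := by
    rw [dirDeriv]
    exact DFunLike.congr_fun (fderiv_comp q hG hx) ξ
  rw [h1, plane_sum_basis (fderiv ℝ x q ξ), map_sum]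
  refine Finset.sum_congr rfl fun k _ ↦ ?_
  rw [map_smul, fderiv_coord hx, smul_eq_mul, mul_comm]; rfl

variable {x : E → Plane} {V : Set Plane}

theorem dirDeriv_dirDeriv_comp {G : Plane → ℝ} (hU : IsOpen U) (hV : IsOpen V)
    (hx : ContDiffOn ℝ ∞ x U) (hxV : MapsTo x U V) (hG : ContDiffOn ℝ ∞ G V) (hq : q ∈ U) :
    dirDeriv α (dirDeriv β (fun r ↦ G (x r))) q =
      ∑ k, ((∑ l, pd l (pd k G) (x q) * dirDeriv α (fun r ↦ x r l) q) *
          dirDeriv β (fun r ↦ x r k) q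
        + pd k G (x q) * dirDeriv α (dirDeriv β (fun r ↦ x r k)) q) := by
  have dx : ∀ r ∈ U, DifferentiableAt ℝ x r := fun r hr ↦
    (hx.contDiffAt (hU.mem_nhds hr)).differentiableAt (by simp)
  have e : EqOn (dirDeriv β (fun r ↦ G (x r)))
      (fun r ↦ ∑ k, pd k G (x r) * dirDeriv β (fun r ↦ x r k) r) U := fun r hr ↦
    dirDeriv_comp (dx r hr) (diffAt_of_smoothOn hV hG (hxV hr))
  have s1 : ∀ k, ContDiffOn ℝ ∞ (pd k G) V := fun k ↦ smoothOn_dirDeriv hV hG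
  have d1 : ∀ k, DifferentiableAt ℝ (fun r ↦ pd k G (x r)) q := fun k ↦
    (diffAt_of_smoothOn hV (s1 k) (hxV hq)).fun_comp' q (dx q hq)
  have d2 : ∀ k, DifferentiableAt ℝ (dirDeriv β (fun r ↦ x r k)) q := fun k ↦
    diffAt_of_smoothOn hU (smoothOn_dirDeriv hU (smoothOn_coord hx k)) hq
  rw [dirDeriv_congr hU e hq, dirDeriv_sum _ fun k _ ↦ (d1 k).fun_mul (d2 k)]
  refine Finset.sum_congr rfl fun k _ ↦ ?_
  rw [dirDeriv_mul (d1 k) (d2 k), dirDeriv_comp (dx q hq) (diffAt_of_smoothOn hV (s1 k) (hxV hq))]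

/-- The pullback by `x` of the bilinear form with matrix `G`, evaluated on `ξ` and `η`. -/
def coordForm (G : Fin 2 → Fin 2 → Plane → ℝ) (x : E → Plane) (ξ η : E) (q : E) : ℝ :=
  ∑ i, ∑ j, G i j (x q) * dirDeriv ξ (fun r ↦ x r i) q * dirDeriv η (fun r ↦ x r j) q

variable {G : Fin 2 → Fin 2 → Plane → ℝ}

theorem smoothOn_comp_coord {F : Plane → ℝ} (hx : ContDiffOn ℝ ∞ x U) (hxV : MapsTo x U V)
    (hF : ContDiffOn ℝ ∞ F V) : ContDiffOn ℝ ∞ (fun r ↦ F (x r)) U := hF.comp hx hxV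

theorem dirDeriv_coordForm (hU : IsOpen U) (hV : IsOpen V) (hx : ContDiffOn ℝ ∞ x U)
    (hxV : MapsTo x U V) (hG : ∀ i j, ContDiffOn ℝ ∞ (G i j) V) (hq : q ∈ U) :
    dirDeriv α (coordForm G x ξ η) q = ∑ i, ∑ j,
      ((∑ k, pd k (G i j) (x q) * dirDeriv α (fun r ↦ x r k) q) *
          dirDeriv ξ (fun r ↦ x r i) q * dirDeriv η (fun r ↦ x r j) q
        + G i j (x q) * dirDeriv α (dirDeriv ξ (fun r ↦ x r i)) q * dirDeriv η (fun r ↦ x r j) q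
        + G i j (x q) * dirDeriv ξ (fun r ↦ x r i) q *
          dirDeriv α (dirDeriv η (fun r ↦ x r j)) q) := by
  have dx : DifferentiableAt ℝ x q := (hx.contDiffAt (hU.mem_nhds hq)).differentiableAt (by simp)
  have d1 : ∀ i j, DifferentiableAt ℝ (fun r ↦ G i j (x r)) q := fun i j ↦
    diffAt_of_smoothOn hU (smoothOn_comp_coord hx hxV (hG i j)) hq
  have d2 : ∀ (ζ : E) k, DifferentiableAt ℝ (dirDeriv ζ (fun r ↦ x r k)) q := fun ζ k ↦
    diffAt_of_smoothOn hU (smoothOn_dirDeriv hU (smoothOn_coord hx k)) hq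
  have e : coordForm G x ξ η = fun q ↦ ∑ i, ∑ j, G i j (x q) *
    dirDeriv ξ (fun r ↦ x r i) q * dirDeriv η (fun r ↦ x r j) q := rfl
  rw [e, dirDeriv_sum _ fun i _ ↦ DifferentiableAt.fun_sum fun j _ ↦
    ((d1 i j).fun_mul (d2 ξ i)).fun_mul (d2 η j)]
  refine Finset.sum_congr rfl fun i _ ↦ ?_
  rw [dirDeriv_sum _ fun j _ ↦ ((d1 i j).fun_mul (d2 ξ i)).fun_mul (d2 η j)]
  refine Finset.sum_congr rfl fun j _ ↦ ?_
  rw [dirDeriv_mul_mul (d1 i j) (d2 ξ i) (d2 η j),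
    dirDeriv_comp dx (diffAt_of_smoothOn hV (hG i j) (hxV hq))]

/-- The full Leibniz and chain rule expansion. Derivatives of G and of x are kept as separate
quantities, so that what has to be proved about them becomes a polynomial identity between jets. -/
theorem dirDeriv_dirDeriv_coordForm (hU : IsOpen U) (hV : IsOpen V) (hx : ContDiffOn ℝ ∞ x U)
    (hxV : MapsTo x U V) (hG : ∀ i j, ContDiffOn ℝ ∞ (G i j) V) (hq : q ∈ U) :
    dirDeriv α (dirDeriv β (coordForm G x ξ η)) q = ∑ i, ∑ j,
      ((∑ k, ((∑ l, pd l (pd k (G i j)) (x q) * dirDeriv α (fun r ↦ x r l) q) *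
            dirDeriv β (fun r ↦ x r k) q
          + pd k (G i j) (x q) * dirDeriv α (dirDeriv β (fun r ↦ x r k)) q)) *
          dirDeriv ξ (fun r ↦ x r i) q * dirDeriv η (fun r ↦ x r j) q
        + (∑ k, pd k (G i j) (x q) * dirDeriv β (fun r ↦ x r k) q) *
          (dirDeriv α (dirDeriv ξ (fun r ↦ x r i)) q * dirDeriv η (fun r ↦ x r j) q
          + dirDeriv ξ (fun r ↦ x r i) q * dirDeriv α (dirDeriv η (fun r ↦ x r j)) q)
        + (∑ k, pd k (G i j) (x q) * dirDeriv α (fun r ↦ x r k) q) *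
          (dirDeriv β (dirDeriv ξ (fun r ↦ x r i)) q * dirDeriv η (fun r ↦ x r j) q
          + dirDeriv ξ (fun r ↦ x r i) q * dirDeriv β (dirDeriv η (fun r ↦ x r j)) q)
        + G i j (x q) *
          (dirDeriv α (dirDeriv β (dirDeriv ξ (fun r ↦ x r i))) q * dirDeriv η (fun r ↦ x r j) q
          + dirDeriv β (dirDeriv ξ (fun r ↦ x r i)) q * dirDeriv α (dirDeriv η (fun r ↦ x r j)) q
          + dirDeriv α (dirDeriv ξ (fun r ↦ x r i)) q * dirDeriv β (dirDeriv η (fun r ↦ x r j)) q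
          + dirDeriv ξ (fun r ↦ x r i) q *
            dirDeriv α (dirDeriv β (dirDeriv η (fun r ↦ x r j))) q)) := by
  have dx : DifferentiableAt ℝ x q := (hx.contDiffAt (hU.mem_nhds hq)).differentiableAt (by simp)
  have s1 : ∀ i j, ContDiffOn ℝ ∞ (fun r ↦ G i j (x r)) U := fun i j ↦
    smoothOn_comp_coord hx hxV (hG i j)
  have s2 : ∀ (ζ : E) k, ContDiffOn ℝ ∞ (dirDeriv ζ (fun r ↦ x r k)) U := fun ζ k ↦
    smoothOn_dirDeriv hU (smoothOn_coord hx k)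
  have s3 : ∀ i j, ContDiffOn ℝ ∞ (fun q ↦ G i j (x q) *
      dirDeriv ξ (fun r ↦ x r i) q * dirDeriv η (fun r ↦ x r j) q) U := fun i j ↦
    ((s1 i j).mul (s2 ξ i)).mul (s2 η j)
  have e : EqOn (dirDeriv β (coordForm G x ξ η)) (fun r ↦ ∑ i, ∑ j, dirDeriv β
      (fun q ↦ G i j (x q) * dirDeriv ξ (fun r ↦ x r i) q * dirDeriv η (fun r ↦ x r j) q) r) U := by
    intro r hr
    have e0 : coordForm G x ξ η = fun q ↦ ∑ i, ∑ j, G i j (x q) *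
      dirDeriv ξ (fun r ↦ x r i) q * dirDeriv η (fun r ↦ x r j) q := rfl
    rw [e0, dirDeriv_sum _ fun i _ ↦ DifferentiableAt.fun_sum fun j _ ↦
      diffAt_of_smoothOn hU (s3 i j) hr]
    refine Finset.sum_congr rfl fun i _ ↦ ?_
    rw [dirDeriv_sum _ fun j _ ↦ diffAt_of_smoothOn hU (s3 i j) hr]
  rw [dirDeriv_congr hU e hq, dirDeriv_sum _ fun i _ ↦ DifferentiableAt.fun_sum fun j _ ↦
      diffAt_of_smoothOn hU (smoothOn_dirDeriv hU (s3 i j)) hq]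
  refine Finset.sum_congr rfl fun i _ ↦ ?_
  rw [dirDeriv_sum _ fun j _ ↦ diffAt_of_smoothOn hU (smoothOn_dirDeriv hU (s3 i j)) hq]
  refine Finset.sum_congr rfl fun j _ ↦ ?_
  have dG := diffAt_of_smoothOn hV (hG i j) (hxV hq)
  rw [dirDeriv_dirDeriv_mul_mul hU (s1 i j) (s2 ξ i) (s2 η j) hq, dirDeriv_comp dx dG,
    dirDeriv_comp dx dG, dirDeriv_dirDeriv_comp hU hV hx hxV (hG i j) hq]
  ring

end Calculus

/-! ### Curvature and metric compatibility as polynomial identities -/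

section JetAlgebra

/-- The algebraic form, on the level of jets, of the commutation of covariant derivatives. -/
theorem jet_second_variation {g : Fin 2 → Fin 2 → ℝ} {dg Γ : Fin 2 → Fin 2 → Fin 2 → ℝ}
    {ddg dΓ : Fin 2 → Fin 2 → Fin 2 → Fin 2 → ℝ}
    (gs : ∀ i j, g i j = g j i) (dgs : ∀ k i j, dg k i j = dg k j i)
    (ddgs : ∀ l k i j, ddg l k i j = ddg l k j i) (ddgc : ∀ l k i j, ddg l k i j = ddg k l i j)
    (Γs : ∀ k i j, Γ k i j = Γ k j i)
    (low : ∀ l i j, ∑ m, g l m * Γ m i j = 1 / 2 * (dg i j l + dg j i l - dg l i j))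
    (dlow : ∀ a l i j, ∑ m, (dg a l m * Γ m i j + g l m * dΓ a m i j) =
      1 / 2 * (ddg a i j l + ddg a j i l - ddg a l i j))
    (p r pp pr rr ppr prr : Fin 2 → ℝ) :
    1 / 2 * (∑ i, ∑ j,
      ((∑ k, ((∑ l, ddg l k i j * p l) * p k + dg k i j * pp k)) * r i * r j
        + (∑ k, dg k i j * p k) * (pr i * r j + r i * pr j)
        + (∑ k, dg k i j * p k) * (pr i * r j + r i * pr j)
        + g i j * (ppr i * r j + pr i * pr j + pr i * pr j + r i * ppr j)))
    + 1 / 2 * (∑ i, ∑ j,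
      ((∑ k, ((∑ l, ddg l k i j * r l) * r k + dg k i j * rr k)) * p i * p j
        + (∑ k, dg k i j * r k) * (pr i * p j + p i * pr j)
        + (∑ k, dg k i j * r k) * (pr i * p j + p i * pr j)
        + g i j * (prr i * p j + pr i * pr j + pr i * pr j + p i * prr j)))
    - (∑ i, ∑ j,
      ((∑ k, ((∑ l, ddg l k i j * r l) * p k + dg k i j * pr k)) * p i * r j
        + (∑ k, dg k i j * p k) * (pr i * r j + p i * rr j)
        + (∑ k, dg k i j * r k) * (pp i * r j + p i * pr j)
        + g i j * (ppr i * r j + pp i * rr j + pr i * pr j + p i * prr j)))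
    = -(∑ l, g 0 l * (dΓ 0 l 1 1 - dΓ 1 l 0 1
          + ∑ m, (Γ l 0 m * Γ m 1 1 - Γ l 1 m * Γ m 0 1))) * (p 0 * r 1 - p 1 * r 0) ^ 2
      + ∑ i, ∑ j, g i j * (pr i + ∑ k, ∑ l, Γ i k l * p k * r l)
          * (pr j + ∑ k, ∑ l, Γ j k l * p k * r l)
      - ∑ i, ∑ j, g i j * (pp i + ∑ k, ∑ l, Γ i k l * p k * p l)
          * (rr j + ∑ k, ∑ l, Γ j k l * r k * r l) := by
  -- The letters p, r stand for the first derivatives of x in the two directions, and pp, pr, rr,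
  -- ppr, prr for the higher ones. Solving `low` for the derivatives of g gives metric
  -- compatibility, which serves to eliminate every first derivative of g.
  have compat : ∀ k i j, dg k i j = ∑ m, (g j m * Γ m k i + g i m * Γ m k j) := by
    intro k i j
    rw [Finset.sum_add_distrib, low, low, dgs k j i, dgs j k i]; ring
  have d1 := dlow 0 0 1 1
  have d2 := dlow 1 0 0 1
  have c000 := compat 0 0 0
  have c001 := compat 0 0 1
  have c011 := compat 0 1 1
  have c100 := compat 1 0 0
  have c101 := compat 1 0 1
  have c111 := compat 1 1 1
  have e10 : g 1 0 = g 0 1 := gs 1 0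
  have s0 : dg 0 1 0 = dg 0 0 1 := dgs _ _ _
  have s1 : dg 1 1 0 = dg 1 0 1 := dgs _ _ _
  have t1 : ∀ l k, ddg l k 1 0 = ddg l k 0 1 := fun l k ↦ ddgs l k 1 0
  have t2 : ∀ i j, ddg 1 0 i j = ddg 0 1 i j := fun i j ↦ ddgc 1 0 i j
  have t3 : ∀ k, Γ k 1 0 = Γ k 0 1 := fun k ↦ Γs k 1 0
  simp only [Fin.sum_univ_two, e10, s0, s1, t1, t2, t3] at c000 c001 c011 c100 c101 c111 d1 d2 ⊢
  rw [c000, c001] at d1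
  rw [c100, c101] at d2
  rw [c000, c001, c011, c100, c101, c111]
  -- The third order jets cancel. The second derivatives of g survive only in the antisymmetrised
  -- combination that, by the difference of the two differentiated Christoffel relations, equals the
  -- derivative part of the curvature; its weight is the squared area of p and r.
  linear_combination (p 0 * r 1 - p 1 * r 0) ^ 2 * (d1 - d2)

theorem jet_first_variation {g : Fin 2 → Fin 2 → ℝ} {dg Γ : Fin 2 → Fin 2 → Fin 2 → ℝ}
    (gs : ∀ i j, g i j = g j i) (dgs : ∀ k i j, dg k i j = dg k j i)
    (low : ∀ l i j, ∑ m, g l m * Γ m i j = 1 / 2 * (dg i j l + dg j i l - dg l i j))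
    (a p r ap ar : Fin 2 → ℝ) :
    ∑ i, ∑ j, ((∑ k, dg k i j * a k) * p i * r j + g i j * ap i * r j + g i j * p i * ar j) =
      ∑ i, ∑ j, g i j * (ap i + ∑ k, ∑ l, Γ i k l * a k * p l) * r j
      + ∑ i, ∑ j, g i j * p i * (ar j + ∑ k, ∑ l, Γ j k l * a k * r l) := by
  have compat : ∀ k i j, dg k i j = ∑ m, (g j m * Γ m k i + g i m * Γ m k j) := by
    intro k i j
    rw [Finset.sum_add_distrib, low, low, dgs k j i, dgs j k i]; ring
  simp only [compat, Fin.sum_univ_two, gs 1 0]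
  ring

/-- A Gram determinant is the determinant of the form times a squared area. Where det g < 0 this is
the reversed Cauchy–Schwarz inequality, and it is the only place from which Lorentzian signs are
drawn. -/
theorem lorentz_gram {g : Fin 2 → Fin 2 → ℝ} (gs : ∀ i j, g i j = g j i) (v w : Fin 2 → ℝ) :
    (∑ i, ∑ j, g i j * v i * v j) * (∑ i, ∑ j, g i j * w i * w j)
      - (∑ i, ∑ j, g i j * v i * w j) ^ 2 =
      (g 0 0 * g 1 1 - g 0 1 * g 1 0) * (v 0 * w 1 - v 1 * w 0) ^ 2 := by
  simp only [Fin.sum_univ_two, gs 1 0]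
  ring

end JetAlgebra

/-! ### Pulled-back metrics, Christoffel symbols and the second variation identity -/

section Pullback

variable {E : Type*} [NormedAddCommGroup E] [NormedSpace ℝ E]
variable {M : Type*} [TopologicalSpace M] [ChartedSpace Plane M] [IsManifold (𝓡 2) ∞ M]

/-- The pullback by `f` of the metric `g`, evaluated on the constant fields `ξ` and `η`. -/
def pullForm (g : LorentzMetric M) (f : E → M) (ξ η : E) (q : E) : ℝ :=
  g.inner (f q) (mfderiv 𝓘(ℝ, E) (𝓡 2) f q ξ) (mfderiv 𝓘(ℝ, E) (𝓡 2) f q η)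

variable {U : Set E} {f : E → M} {ξ η : E} {q : E}

/-- The tangent map of f composed with the smooth section q ↦ (q, ξ). This exhibits df ξ as a smooth
section along f, which can be paired with the metric. -/
theorem contMDiffOn_mfderiv_const (hU : IsOpen U) (hf : ContMDiffOn 𝓘(ℝ, E) (𝓡 2) ∞ f U) :
    ContMDiffOn 𝓘(ℝ, E) (𝓡 2).tangent ∞
      (fun q ↦ Bundle.TotalSpace.mk' Plane (E := (TangentSpace (𝓡 2) : M → Type _)) (f q)
        (mfderiv 𝓘(ℝ, E) (𝓡 2) f q ξ)) U := by
  have : IsManifold (𝓡 2) 1 M := IsManifold.of_le (n := ∞) (by simp)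
  have h1 := hf.contMDiffOn_tangentMapWithin (m := ∞) (by simp) hU.uniqueMDiffOn
  have h2 : ContMDiff 𝓘(ℝ, E) 𝓘(ℝ, E).tangent ∞
      (fun q : E ↦ (⟨q, ξ⟩ : TangentBundle 𝓘(ℝ, E) E)) :=
    contMDiff_vectorSpace_iff_contDiff.2 contDiff_const
  have h3 := h1.comp (h2.contMDiffOn (s := U)) (fun q hq ↦ hq)
  refine h3.congr fun q hq ↦ ?_
  simp only [Function.comp, tangentMapWithin, mfderivWithin_of_isOpen hU hq]

theorem smoothOn_pullForm (g : LorentzMetric M) (hU : IsOpen U)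
    (hf : ContMDiffOn 𝓘(ℝ, E) (𝓡 2) ∞ f U) : ContDiffOn ℝ ∞ (pullForm g f ξ η) U := by
  rw [← contMDiffOn_iff_contDiffOn]
  have : IsManifold (𝓡 2) 1 M := IsManifold.of_le (n := ∞) (by simp)
  intro q hq
  have : ContMDiffWithinAt 𝓘(ℝ, E) ((𝓡 2).prod 𝓘(ℝ)) ∞
      (fun m ↦ Bundle.TotalSpace.mk' ℝ (E := Bundle.Trivial M ℝ) (f m) (pullForm g f ξ η m)) U q := by
    apply ContMDiffWithinAt.clm_bundle_apply₂ (F₁ := Plane) (F₂ := Plane)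
    · exact ContMDiffAt.comp_contMDiffWithinAt q g.contMDiff.contMDiffAt (hf q hq)
    · exact contMDiffOn_mfderiv_const hU hf q hq
    · exact contMDiffOn_mfderiv_const hU hf q hq
  simp only [Bundle.contMDiffWithinAt_totalSpace] at this
  exact this.2

variable {e : OpenPartialHomeomorph M Plane}

omit [IsManifold (𝓡 2) ∞ M] in
theorem mdifferentiable_of_mem_maximalAtlas (he : e ∈ IsManifold.maximalAtlas (𝓡 2) ∞ M) :
    e.MDifferentiable (𝓡 2) (𝓡 2) :=
  ⟨(contMDiffOn_of_mem_maximalAtlas he).mdifferentiableOn (by simp),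
    (contMDiffOn_symm_of_mem_maximalAtlas he).mdifferentiableOn (by simp)⟩

variable (g : LorentzMetric M)

theorem smoothOn_metric_coord (he : e ∈ IsManifold.maximalAtlas (𝓡 2) ∞ M) (i j : Fin 2) :
    ContDiffOn ℝ ∞ (fun y ↦ g.coord e y i j) e.target :=
  smoothOn_pullForm g e.open_target (contMDiffOn_symm_of_mem_maximalAtlas he)

theorem metric_coord_symm (y : Plane) (i j : Fin 2) : g.coord e y i j = g.coord e y j i :=
  g.symm _ _ _

theorem metric_coord_apply (y : Plane) (v w : Plane) :
    g.inner (e.symm y) (mfderiv (𝓡 2) (𝓡 2) e.symm y v) (mfderiv (𝓡 2) (𝓡 2) e.symm y w) =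
      ∑ i, ∑ j, g.coord e y i j * v i * w j := by
  let A : Plane →L[ℝ] Plane := mfderiv (𝓡 2) (𝓡 2) e.symm y
  let B : Plane →L[ℝ] Plane →L[ℝ] ℝ := g.inner (e.symm y)
  have hA : ∀ v : Plane, A v = ∑ i, v i • A (basisVec i) := fun v ↦ by
    conv_lhs => rw [plane_sum_basis v]
    rw [map_sum]; simp only [map_smul]
  change B (A v) (A w) = ∑ i, ∑ j, B (A (basisVec i)) (A (basisVec j)) * v i * w j
  rw [hA v, hA w]
  simp only [Fin.sum_univ_two, map_add, map_smul, add_apply, smul_apply, smul_eq_mul]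
  ring

/-- Indefiniteness supplies a vector of positive and one of negative square. If the determinant were
nonnegative, the Gram identity would make the product of these squares nonnegative. -/
theorem metric_coord_det_neg (he : e ∈ IsManifold.maximalAtlas (𝓡 2) ∞ M) {y : Plane}
    (hy : y ∈ e.target) : (g.coord e y).det < 0 := by
  have hs : e.symm y ∈ e.source := e.map_target hy
  have hcomp := (mdifferentiable_of_mem_maximalAtlas he).symm_comp_deriv hs
  rw [e.right_inv hy] at hcomp
  have hsurj : ∀ v : TangentSpace (𝓡 2) (e.symm y),
      ∃ w : Plane, mfderiv (𝓡 2) (𝓡 2) e.symm y w = v := fun v ↦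
    ⟨mfderiv (𝓡 2) (𝓡 2) e (e.symm y) v, DFunLike.congr_fun hcomp v⟩
  obtain ⟨⟨v, hv⟩, w, hw⟩ := g.indefinite (e.symm y)
  obtain ⟨v, rfl⟩ := hsurj v
  obtain ⟨w, rfl⟩ := hsurj w
  rw [metric_coord_apply] at hv hw
  have key := lorentz_gram (metric_coord_symm g (e := e) y) v w
  rw [Matrix.det_fin_two]
  by_contra! h
  nlinarith [mul_pos_of_neg_of_neg (neg_neg_of_pos hv) hw, mul_nonneg h
    (sq_nonneg (v 0 * w 1 - v 1 * w 0)),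
    sq_nonneg (∑ i, ∑ j, g.coord e y i j * v i * w j)]

theorem smoothOn_metric_coord_inv (he : e ∈ IsManifold.maximalAtlas (𝓡 2) ∞ M) (i j : Fin 2) :
    ContDiffOn ℝ ∞ (fun y ↦ (g.coord e y)⁻¹ i j) e.target := by
  have hs := smoothOn_metric_coord g he
  have hd : ContDiffOn ℝ ∞ (fun y ↦ ((g.coord e y).det)⁻¹) e.target := by
    refine ContDiffOn.inv ?_ fun y hy ↦ (metric_coord_det_neg g he hy).ne
    simp only [Matrix.det_fin_two]
    exact ((hs 0 0).mul (hs 1 1)).sub ((hs 0 1).mul (hs 1 0))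
  have ha : ContDiffOn ℝ ∞ (fun y ↦ (g.coord e y).adjugate i j) e.target := by
    simp only [Matrix.adjugate_fin_two]
    fin_cases i <;> fin_cases j
    · exact hs 1 1
    · exact (hs 0 1).neg
    · exact (hs 1 0).neg
    · exact hs 0 0
  simp only [Matrix.inv_def, Matrix.smul_apply, Ring.inverse_eq_inv', smul_eq_mul]
  exact hd.mul ha

theorem smoothOn_christoffel (he : e ∈ IsManifold.maximalAtlas (𝓡 2) ∞ M) (k i j : Fin 2) :
    ContDiffOn ℝ ∞ (g.christoffel e k i j) e.target := by
  have hs : ∀ m i j, ContDiffOn ℝ ∞ (pd m fun y ↦ g.coord e y i j) e.target := fun m i j ↦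
    smoothOn_dirDeriv e.open_target (smoothOn_metric_coord g he i j)
  exact contDiffOn_const.mul (ContDiffOn.sum fun l _ ↦ (smoothOn_metric_coord_inv g he k l).mul
    (((hs i j l).add (hs j i l)).sub (hs l i j)))

theorem christoffel_symm (y : Plane) (k i j : Fin 2) :
    g.christoffel e k i j y = g.christoffel e k j i y := by
  have : ∀ l, (fun z ↦ g.coord e z i l) = fun z ↦ g.coord e z l i := fun l ↦
    funext fun z ↦ metric_coord_symm g z i l
  simp only [LorentzMetric.christoffel]
  congr 1
  refine Finset.sum_congr rfl fun l _ ↦ ?_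
  rw [show (fun z ↦ g.coord e z i j) = fun z ↦ g.coord e z j i from this j]
  ring

theorem sum_mul_half_sum {a : Fin 2 → ℝ} {B : Fin 2 → Fin 2 → ℝ} {l : Fin 2}
    (h : ∀ n, ∑ m, a m * B m n = if l = n then 1 else 0) (c : Fin 2 → ℝ) :
    ∑ m, a m * (1 / 2 * ∑ n, B m n * c n) = 1 / 2 * c l := by
  have h0 := h 0
  have h1 := h 1
  have : c l = (if l = 0 then 1 else 0) * c 0 + (if l = 1 then 1 else 0) * c 1 := by
    fin_cases l <;> simp
  rw [this]
  simp only [Fin.sum_univ_two] at h0 h1 ⊢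
  linear_combination 1 / 2 * c 0 * h0 + 1 / 2 * c 1 * h1

/-- Lowering the index cancels the inverse matrix. The jet identities use Christoffel symbols only
through this relation and its derivative, so the inverse metric never has to be differentiated
explicitly. -/
theorem sum_coord_mul_christoffel (he : e ∈ IsManifold.maximalAtlas (𝓡 2) ∞ M) {y : Plane}
    (hy : y ∈ e.target) (l i j : Fin 2) :
    ∑ m, g.coord e y l m * g.christoffel e m i j y =
      1 / 2 * (pd i (fun z ↦ g.coord e z j l) y + pd j (fun z ↦ g.coord e z i l) y
        - pd l (fun z ↦ g.coord e z i j) y) := by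
  have hA : g.coord e y * (g.coord e y)⁻¹ = 1 :=
    Matrix.mul_nonsing_inv _ (isUnit_iff_ne_zero.2 (metric_coord_det_neg g he hy).ne)
  have h : ∀ n, ∑ m, g.coord e y l m * (g.coord e y)⁻¹ m n = if l = n then 1 else 0 := fun n ↦ by
    rw [← Matrix.mul_apply, hA, Matrix.one_apply]
  exact sum_mul_half_sum h _

theorem sum_pd_coord_mul_christoffel (he : e ∈ IsManifold.maximalAtlas (𝓡 2) ∞ M) {y : Plane}
    (hy : y ∈ e.target) (a l i j : Fin 2) :
    ∑ m, (pd a (fun z ↦ g.coord e z l m) y * g.christoffel e m i j y +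
        g.coord e y l m * pd a (g.christoffel e m i j) y) =
      1 / 2 * (pd a (pd i fun z ↦ g.coord e z j l) y + pd a (pd j fun z ↦ g.coord e z i l) y
        - pd a (pd l fun z ↦ g.coord e z i j) y) := by
  have ho := e.open_target
  have hs := smoothOn_metric_coord g he
  have d1 : ∀ i j, DifferentiableAt ℝ (fun y ↦ g.coord e y i j) y := fun i j ↦
    diffAt_of_smoothOn ho (hs i j) hy
  have d2 : ∀ k i j, DifferentiableAt ℝ (g.christoffel e k i j) y := fun k i j ↦
    diffAt_of_smoothOn ho (smoothOn_christoffel g he k i j) hy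
  have d3 : ∀ m i j, DifferentiableAt ℝ (pd m fun y ↦ g.coord e y i j) y := fun m i j ↦
    diffAt_of_smoothOn ho (smoothOn_dirDeriv ho (hs i j)) hy
  have key := dirDeriv_congr (ξ := basisVec a) ho
    (fun z hz ↦ sum_coord_mul_christoffel g he hz l i j) hy
  rw [dirDeriv_sum _ fun m _ ↦ (d1 l m).fun_mul (d2 m i j),
    dirDeriv_const_mul _ (((d3 i j l).fun_add (d3 j i l)).fun_sub (d3 l i j)),
    dirDeriv_sub ((d3 i j l).fun_add (d3 j i l)) (d3 l i j),
    dirDeriv_add (d3 i j l) (d3 j i l)] at key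
  rw [show pd a = dirDeriv (basisVec a) from rfl, ← key]
  refine Finset.sum_congr rfl fun m _ ↦ ?_
  rw [dirDeriv_mul (d1 l m) (d2 m i j)]

/-- The components of the covariant derivative of `dx ξ` in the direction `α`. -/
def covComp (e : OpenPartialHomeomorph M Plane) (x : E → Plane) (α ξ : E) (k : Fin 2) (q : E) : ℝ :=
  dirDeriv α (dirDeriv ξ (fun r ↦ x r k)) q + ∑ i, ∑ j, g.christoffel e k i j (x q) *
    dirDeriv α (fun r ↦ x r i) q * dirDeriv ξ (fun r ↦ x r j) q

variable {x : E → Plane} {α : E}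

theorem dirDeriv_coordForm_metric (he : e ∈ IsManifold.maximalAtlas (𝓡 2) ∞ M) (hU : IsOpen U)
    (hx : ContDiffOn ℝ ∞ x U) (hxe : MapsTo x U e.target) (hq : q ∈ U) :
    dirDeriv α (coordForm (fun i j y ↦ g.coord e y i j) x ξ η) q =
      ∑ i, ∑ j, g.coord e (x q) i j * covComp g e x α ξ i q * dirDeriv η (fun r ↦ x r j) q
      + ∑ i, ∑ j, g.coord e (x q) i j * dirDeriv ξ (fun r ↦ x r i) q * covComp g e x α η j q := by
  rw [dirDeriv_coordForm hU e.open_target hx hxe (smoothOn_metric_coord g he) hq]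
  refine jet_first_variation (dg := fun k i j ↦ pd k (fun y ↦ g.coord e y i j) (x q))
    (Γ := fun k i j ↦ g.christoffel e k i j (x q)) (metric_coord_symm g (x q)) (fun k i j ↦ ?_)
    (sum_coord_mul_christoffel g he (hxe hq)) _ _ _ _ _
  rw [show (fun y ↦ g.coord e y i j) = fun y ↦ g.coord e y j i from
    funext fun y ↦ metric_coord_symm g y i j]

/-- The combination of second derivatives is the one that forms the leading part of the curvature of
a metric, which is why the third derivatives of x cancel. The right side is then the curvature of
the ambient metric together with the quadratic terms known from the Gauss equation. -/
theorem second_variation_coordForm (he : e ∈ IsManifold.maximalAtlas (𝓡 2) ∞ M) (hU : IsOpen U)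
    (hx : ContDiffOn ℝ ∞ x U) (hxe : MapsTo x U e.target) (hq : q ∈ U) :
    1 / 2 * dirDeriv ξ (dirDeriv ξ (coordForm (fun i j y ↦ g.coord e y i j) x η η)) q
      + 1 / 2 * dirDeriv η (dirDeriv η (coordForm (fun i j y ↦ g.coord e y i j) x ξ ξ)) q
      - dirDeriv η (dirDeriv ξ (coordForm (fun i j y ↦ g.coord e y i j) x ξ η)) q =
    -(∑ l, g.coord e (x q) 0 l * g.riemann e l 0 1 1 (x q)) *
        (dirDeriv ξ (fun r ↦ x r 0) q * dirDeriv η (fun r ↦ x r 1) q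
          - dirDeriv ξ (fun r ↦ x r 1) q * dirDeriv η (fun r ↦ x r 0) q) ^ 2
      + ∑ i, ∑ j, g.coord e (x q) i j * covComp g e x ξ η i q * covComp g e x ξ η j q
      - ∑ i, ∑ j, g.coord e (x q) i j * covComp g e x ξ ξ i q * covComp g e x η η j q := by
  have hG := smoothOn_metric_coord g he
  have hV := e.open_target
  simp only [dirDeriv_dirDeriv_coordForm hU hV hx hxe hG hq]
  have hsx : ∀ k, ContDiffOn ℝ ∞ (fun r ↦ x r k) U := smoothOn_coord hx
  -- Mixed derivatives are brought into one fixed order, so that each jet variable has a single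
  -- name.
  have c1 : ∀ k, dirDeriv η (dirDeriv ξ (fun r ↦ x r k)) q =
      dirDeriv ξ (dirDeriv η (fun r ↦ x r k)) q := fun k ↦ dirDeriv_comm hU (hsx k) hq
  have c2 : ∀ k, dirDeriv η (dirDeriv ξ (dirDeriv ξ (fun r ↦ x r k))) q =
      dirDeriv ξ (dirDeriv ξ (dirDeriv η (fun r ↦ x r k))) q := fun k ↦ by
    rw [dirDeriv_comm hU (smoothOn_dirDeriv hU (hsx k)) hq]
    exact dirDeriv_congr hU (fun r hr ↦ dirDeriv_comm hU (hsx k) hr) hq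
  have c3 : ∀ k, dirDeriv η (dirDeriv ξ (dirDeriv η (fun r ↦ x r k))) q =
      dirDeriv η (dirDeriv η (dirDeriv ξ (fun r ↦ x r k))) q := fun k ↦
    dirDeriv_congr hU (fun r hr ↦ dirDeriv_comm hU (hsx k) hr) hq
  simp only [c1, c2, c3]
  have sy : ∀ i j, (fun y ↦ g.coord e y i j) = fun y ↦ g.coord e y j i := fun i j ↦
    funext fun y ↦ metric_coord_symm g y i j
  exact jet_second_variation (g := fun i j ↦ g.coord e (x q) i j)
    (dg := fun k i j ↦ pd k (fun y ↦ g.coord e y i j) (x q))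
    (Γ := fun k i j ↦ g.christoffel e k i j (x q))
    (ddg := fun l k i j ↦ pd l (pd k fun y ↦ g.coord e y i j) (x q))
    (dΓ := fun a k i j ↦ pd a (g.christoffel e k i j) (x q))
    (metric_coord_symm g (x q)) (fun k i j ↦ by simp only [sy i j])
    (fun l k i j ↦ by simp only [sy i j]) (fun l k i j ↦ dirDeriv_comm hV (hG i j) (hxe hq))
    (christoffel_symm g (x q)) (sum_coord_mul_christoffel g he (hxe hq))
    (fun a l i j ↦ sum_pd_coord_mul_christoffel g he (hxe hq) a l i j) _ _ _ _ _ _ _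

end Pullback

/-! ### The sign of one factor's contribution -/

section Pullback

variable {E : Type*} [NormedAddCommGroup E] [NormedSpace ℝ E]
variable {M : Type*} [TopologicalSpace M] [ChartedSpace Plane M] [IsManifold (𝓡 2) ∞ M]
variable (g : LorentzMetric M) {U : Set E} {f : E → M} {ξ η α : E} {q : E}
  {e : OpenPartialHomeomorph M Plane}

omit [IsManifold (𝓡 2) ∞ M] in
theorem smoothOn_chart_comp (he : e ∈ IsManifold.maximalAtlas (𝓡 2) ∞ M)
    (hf : ContMDiffOn 𝓘(ℝ, E) (𝓡 2) ∞ f U) (hfe : MapsTo f U e.source) :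
    ContDiffOn ℝ ∞ (fun q ↦ e (f q)) U := by
  rw [← contMDiffOn_iff_contDiffOn]
  exact (contMDiffOn_of_mem_maximalAtlas he).comp hf hfe

omit [IsManifold (𝓡 2) ∞ M] in
theorem mfderiv_eq_of_chart (he : e ∈ IsManifold.maximalAtlas (𝓡 2) ∞ M) (hU : IsOpen U)
    (hf : ContMDiffOn 𝓘(ℝ, E) (𝓡 2) ∞ f U) (hfe : MapsTo f U e.source) (hq : q ∈ U) :
    (mfderiv 𝓘(ℝ, E) (𝓡 2) f q ξ : Plane) =
      mfderiv (𝓡 2) (𝓡 2) e.symm (e (f q)) (fderiv ℝ (fun q ↦ e (f q)) q ξ) := by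
  have hx : MDifferentiableAt 𝓘(ℝ, E) (𝓡 2) (fun q ↦ e (f q)) q :=
    (((smoothOn_chart_comp he hf hfe).contDiffAt (hU.mem_nhds hq)).differentiableAt
      (by simp)).mdifferentiableAt
  have hes : MDifferentiableAt (𝓡 2) (𝓡 2) e.symm (e (f q)) :=
    (mdifferentiable_of_mem_maximalAtlas he).mdifferentiableAt_symm (e.map_source (hfe hq))
  have hev : f =ᶠ[𝓝 q] e.symm ∘ fun q ↦ e (f q) := by
    filter_upwards [hU.mem_nhds hq] with r hr
    exact (e.left_inv (hfe hr)).symm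
  have h1 : mfderiv 𝓘(ℝ, E) (𝓡 2) f q = mfderiv 𝓘(ℝ, E) (𝓡 2) (e.symm ∘ fun q ↦ e (f q)) q :=
    hev.mfderiv_eq
  have h2 := mfderiv_comp q hes hx
  have h3 : mfderiv 𝓘(ℝ, E) (𝓡 2) (fun q ↦ e (f q)) q = fderiv ℝ (fun q ↦ e (f q)) q :=
    mfderiv_eq_fderiv
  let A : Plane →L[ℝ] Plane := mfderiv (𝓡 2) (𝓡 2) e.symm (e (f q))
  exact (DFunLike.congr_fun (h1.trans h2) ξ).trans (congrArg A (DFunLike.congr_fun h3 ξ))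

theorem pullForm_eq_coordForm (he : e ∈ IsManifold.maximalAtlas (𝓡 2) ∞ M) (hU : IsOpen U)
    (hf : ContMDiffOn 𝓘(ℝ, E) (𝓡 2) ∞ f U) (hfe : MapsTo f U e.source) (hq : q ∈ U) :
    pullForm g f ξ η q = coordForm (fun i j y ↦ g.coord e y i j) (fun q ↦ e (f q)) ξ η q := by
  have hx : DifferentiableAt ℝ (fun q ↦ e (f q)) q :=
    ((smoothOn_chart_comp he hf hfe).contDiffAt (hU.mem_nhds hq)).differentiableAt (by simp)
  let B : M → Plane →L[ℝ] Plane →L[ℝ] ℝ := g.inner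
  have h1 : pullForm g f ξ η q = B (f q) (mfderiv 𝓘(ℝ, E) (𝓡 2) f q ξ)
      (mfderiv 𝓘(ℝ, E) (𝓡 2) f q η) := rfl
  have h2 : pullForm g f ξ η q = B (e.symm (e (f q)))
      (mfderiv (𝓡 2) (𝓡 2) e.symm (e (f q)) (fderiv ℝ (fun q ↦ e (f q)) q ξ))
      (mfderiv (𝓡 2) (𝓡 2) e.symm (e (f q)) (fderiv ℝ (fun q ↦ e (f q)) q η)) := by
    rw [h1, e.left_inv (hfe hq)]
    exact congrArg₂ (fun v w ↦ B (f q) v w) (mfderiv_eq_of_chart he hU hf hfe hq)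
      (mfderiv_eq_of_chart he hU hf hfe hq)
  refine h2.trans ?_
  refine (metric_coord_apply g _ _ _).trans ?_
  simp only [coordForm]
  refine Finset.sum_congr rfl fun i _ ↦ Finset.sum_congr rfl fun j _ ↦ ?_
  rw [fderiv_coord hx, fderiv_coord hx]

/-- The contribution of one factor to the second variation has a sign. -/
theorem second_variation_pullForm_nonpos (hU : IsOpen U) (hf : ContMDiffOn 𝓘(ℝ, E) (𝓡 2) ∞ f U)
    (hq : q ∈ U) {u a b : E} {s : ℝ} (hκ : s * g.gaussCurvature (f q) ≤ 0)
    (haa : ∀ k, covComp g (chartAt Plane (f q)) (fun r ↦ chartAt Plane (f q) (f r)) a a k q = 0)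
    (hab : ∀ k, covComp g (chartAt Plane (f q)) (fun r ↦ chartAt Plane (f q) (f r)) a b k q = 0)
    (hperp : dirDeriv a (pullForm g f u b) q = 0) (hb : 0 < s * pullForm g f b b q) :
    s * (1 / 2 * dirDeriv u (dirDeriv u (pullForm g f a a)) q
      + 1 / 2 * dirDeriv a (dirDeriv a (pullForm g f u u)) q
      - dirDeriv a (dirDeriv u (pullForm g f u a)) q) ≤ 0 := by
  set e := chartAt Plane (f q) with hedef
  have he : e ∈ IsManifold.maximalAtlas (𝓡 2) ∞ M := IsManifold.chart_mem_maximalAtlas _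
  -- Everything is local at q, so f may be assumed to stay in the preferred chart at f q.
  set V := U ∩ f ⁻¹' e.source with hV
  have hVo : IsOpen V := hf.continuousOn.isOpen_inter_preimage hU e.open_source
  have hVq : q ∈ V := ⟨hq, mem_chart_source _ _⟩
  have hfV := hf.mono (inter_subset_left : V ⊆ U)
  have hfe : MapsTo f V e.source := fun r hr ↦ hr.2
  set x : E → Plane := fun r ↦ e (f r) with hxdef
  have hx : ContDiffOn ℝ ∞ x V := smoothOn_chart_comp he hfV hfe
  have hxe : MapsTo x V e.target := fun r hr ↦ e.map_source (hfe hr)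
  have eqf : ∀ ξ η, EqOn (pullForm g f ξ η)
      (coordForm (fun i j y ↦ g.coord e y i j) x ξ η) V := fun ξ η r hr ↦
    pullForm_eq_coordForm g he hVo hfV hfe hr
  have eqd : ∀ α ξ η, EqOn (dirDeriv α (pullForm g f ξ η))
      (dirDeriv α (coordForm (fun i j y ↦ g.coord e y i j) x ξ η)) V := fun α ξ η r hr ↦
    dirDeriv_congr hVo (eqf ξ η) hr
  rw [dirDeriv_congr hVo (eqd u a a) hVq, dirDeriv_congr hVo (eqd a u u) hVq,
    dirDeriv_congr hVo (eqd u u a) hVq, second_variation_coordForm g he hVo hx hxe hVq]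
  rw [eqd a u b hVq, dirDeriv_coordForm_metric g he hVo hx hxe hVq] at hperp
  rw [eqf b b hVq] at hb
  -- Torsion-freeness, ∇_u a = ∇_a u. The quadratic term becomes the square of ∇_a u, and, since ∇_a
  -- b = 0, `hperp` says that ∇_a u is orthogonal to b; the product with ∇_a a drops out.
  have cs : ∀ k, covComp g e x u a k q = covComp g e x a u k q := by
    intro k
    simp only [covComp]
    rw [dirDeriv_comm hVo (smoothOn_coord hx k) hVq]
    congr 1
    rw [Finset.sum_comm]
    refine Finset.sum_congr rfl fun i _ ↦ Finset.sum_congr rfl fun j _ ↦ ?_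
    rw [christoffel_symm]; ring
  simp only [haa, hab, cs, mul_zero, Finset.sum_const_zero, add_zero, sub_zero] at hperp ⊢
  have hdet := metric_coord_det_neg g he (hxe hVq)
  have hK : ∑ l, g.coord e (x q) 0 l * g.riemann e l 0 1 1 (x q) =
      g.gaussCurvature (f q) * (g.coord e (x q)).det :=
    (div_mul_cancel₀ _ hdet.ne).symm
  have gram := lorentz_gram (metric_coord_symm g (e := e) (x q)) (fun i ↦ covComp g e x a u i q)
    (fun j ↦ dirDeriv b (fun r ↦ x r j) q)
  rw [← Matrix.det_fin_two] at gram
  rw [hperp] at gram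
  rw [hK]
  simp only [coordForm] at hb
  generalize (∑ i, ∑ j, g.coord e (x q) i j * covComp g e x a u i q * covComp g e x a u j q) = N
    at gram ⊢
  generalize (∑ i, ∑ j, g.coord e (x q) i j * dirDeriv b (fun r ↦ x r i) q *
    dirDeriv b (fun r ↦ x r j) q) = B at gram hb
  generalize (g.coord e (x q)).det = D at *
  -- N and B are the squares of the orthogonal vectors ∇_a u and b in a plane of negative
  -- determinant. As s B > 0, this forces s N ≤ 0.
  have hNB : N * B ≤ 0 := by
    have := mul_nonneg (neg_nonneg.2 hdet.le) (sq_nonneg (covComp g e x a u 0 q *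
      dirDeriv b (fun r ↦ x r 1) q - covComp g e x a u 1 q * dirDeriv b (fun r ↦ x r 0) q))
    linarith
  have hN : s * N ≤ 0 := by
    by_contra! h
    nlinarith [mul_pos h hb, mul_nonneg (neg_nonneg.2 hNB) (sq_nonneg s)]
  have := mul_nonneg (mul_nonneg_of_nonpos_of_nonpos hκ hdet.le)
    (sq_nonneg (dirDeriv u (fun r ↦ x r 0) q * dirDeriv a (fun r ↦ x r 1) q -
      dirDeriv u (fun r ↦ x r 1) q * dirDeriv a (fun r ↦ x r 0) q))
  linarith

end Pullback

/-! ### Gram matrices under linear maps of the plane -/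

section GramMatrix

/-- The matrix of a bilinear form in the standard basis of the plane. -/
def gram (B : Plane →L[ℝ] Plane →L[ℝ] ℝ) : Matrix (Fin 2) (Fin 2) ℝ :=
  Matrix.of fun a b ↦ B (basisVec a) (basisVec b)

theorem bilin_plane_apply (B : Plane →L[ℝ] Plane →L[ℝ] ℝ) (v w : Plane) :
    B v w = ∑ i, ∑ j, B (basisVec i) (basisVec j) * v i * w j := by
  conv_lhs => rw [plane_sum_basis v, plane_sum_basis w]
  simp only [Fin.sum_univ_two, map_add, map_smul, add_apply, smul_apply, smul_eq_mul]
  ring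

theorem clm_plane_det (T : Plane →L[ℝ] Plane) :
    T.det = T (basisVec 0) 0 * T (basisVec 1) 1 - T (basisVec 1) 0 * T (basisVec 0) 1 := by
  let b := (EuclideanSpace.basisFun (Fin 2) ℝ).toBasis
  have h : T.det = (LinearMap.toMatrix b b (T : Plane →ₗ[ℝ] Plane)).det :=
    (LinearMap.det_toMatrix b _).symm
  rw [h, Matrix.det_fin_two]
  simp [LinearMap.toMatrix_apply, b, basisVec]

/-- The Gram matrix is multiplied by T on one side and by its transpose on the other, hence the
square of det T. This makes √|det| a density, and makes ratios of such determinants independent of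
the chart. -/
theorem det_gram_comp (B : Plane →L[ℝ] Plane →L[ℝ] ℝ) (T : Plane →L[ℝ] Plane) :
    (Matrix.of fun a b ↦ B (T (basisVec a)) (T (basisVec b))).det = T.det ^ 2 * (gram B).det := by
  have h : ∀ a b, B (T (basisVec a)) (T (basisVec b)) =
      ∑ i, ∑ j, B (basisVec i) (basisVec j) * T (basisVec a) i * T (basisVec b) j := fun a b ↦
    bilin_plane_apply B _ _
  simp only [Matrix.det_fin_two, Matrix.of_apply, h, gram, clm_plane_det, Fin.sum_univ_two]
  ring

end GramMatrix

/-! ### Families of maps read in a chart of the source -/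

section Family

variable {M : Type*} [TopologicalSpace M] [ChartedSpace Plane M]
  {S : Type*} [TopologicalSpace S] [ChartedSpace Plane S]

/-- A family of maps, read in a chart of the source. -/
def famChart (h : ℝ → S → M) (c : OpenPartialHomeomorph S Plane) (q : ℝ × Plane) : M :=
  h q.1 (c.symm q.2)

/-- A smooth family of maps, with parameters in `(-δ, δ)`. -/
def IsSmoothFamily (δ : ℝ) (h : ℝ → S → M) : Prop :=
  ContMDiffOn (𝓘(ℝ, ℝ).prod (𝓡 2)) (𝓡 2) ∞ (fun z : ℝ × S ↦ h z.1 z.2) (Ioo (-δ) δ ×ˢ univ)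

variable {δ : ℝ} {h : ℝ → S → M} {c : OpenPartialHomeomorph S Plane}

omit [ChartedSpace Plane S] in
theorem isOpen_famDomain (δ : ℝ) (c : OpenPartialHomeomorph S Plane) :
    IsOpen (Ioo (-δ) δ ×ˢ c.target) := isOpen_Ioo.prod c.open_target

theorem contMDiffOn_famChart (hc : c ∈ IsManifold.maximalAtlas (𝓡 2) ∞ S)
    (hh : IsSmoothFamily δ h) :
    ContMDiffOn 𝓘(ℝ, ℝ × Plane) (𝓡 2) ∞ (famChart h c) (Ioo (-δ) δ ×ˢ c.target) := by
  have h1 : ContMDiffOn 𝓘(ℝ, ℝ × Plane) (𝓘(ℝ, ℝ).prod (𝓡 2)) ∞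
      (fun q : ℝ × Plane ↦ (q.1, c.symm q.2)) (Ioo (-δ) δ ×ˢ c.target) := by
    refine ContMDiffOn.prodMk contDiff_fst.contMDiff.contMDiffOn ?_
    exact (contMDiffOn_symm_of_mem_maximalAtlas hc).comp contDiff_snd.contMDiff.contMDiffOn
      fun q hq ↦ hq.2
  exact ContMDiffOn.comp hh h1 fun q hq ↦ ⟨hq.1, mem_univ _⟩

theorem contMDiff_of_family (hh : IsSmoothFamily δ h) {u : ℝ} (hu : u ∈ Ioo (-δ) δ) :
    ContMDiff (𝓡 2) (𝓡 2) ∞ (h u) := by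
  rw [← contMDiffOn_univ]
  exact ContMDiffOn.comp (g := fun z : ℝ × S ↦ h z.1 z.2) hh
    (ContMDiff.prodMk contMDiff_const contMDiff_id).contMDiffOn fun p _ ↦ ⟨hu, mem_univ _⟩

theorem mfderiv_famChart_snd (hc : c ∈ IsManifold.maximalAtlas (𝓡 2) ∞ S)
    (hh : IsSmoothFamily δ h) {u : ℝ} (hu : u ∈ Ioo (-δ) δ) {y : Plane} (hy : y ∈ c.target)
    (w : Plane) :
    (mfderiv 𝓘(ℝ, ℝ × Plane) (𝓡 2) (famChart h c) (u, y) ((0, w) : ℝ × Plane) : Plane) =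
      mfderiv (𝓡 2) (𝓡 2) (h u) (c.symm y) (mfderiv (𝓡 2) (𝓡 2) c.symm y w) := by
  have hf : MDifferentiableAt 𝓘(ℝ, ℝ × Plane) (𝓡 2) (famChart h c) (u, y) :=
    ((contMDiffOn_famChart hc hh).contMDiffAt
      ((isOpen_famDomain δ c).mem_nhds ⟨hu, hy⟩)).mdifferentiableAt (by simp)
  have hi : HasFDerivAt (fun z : Plane ↦ (u, z)) (ContinuousLinearMap.inr ℝ ℝ Plane) y :=
    hasFDerivAt_prodMk_right u y
  have h1 := mfderiv_comp (I := 𝓡 2) (I' := 𝓘(ℝ, ℝ × Plane)) (I'' := 𝓡 2) y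
    (g := famChart h c) (f := fun z : Plane ↦ (u, z)) hf hi.differentiableAt.mdifferentiableAt
  have h2 := mfderiv_comp (I := 𝓡 2) (I' := 𝓡 2) (I'' := 𝓡 2) y (g := h u) (f := c.symm)
    ((contMDiff_of_family hh hu).mdifferentiableAt (by simp))
    ((mdifferentiable_of_mem_maximalAtlas hc).mdifferentiableAt_symm hy)
  have h3 : mfderiv (𝓡 2) 𝓘(ℝ, ℝ × Plane) (fun z : Plane ↦ (u, z)) y =
      ContinuousLinearMap.inr ℝ ℝ Plane := mfderiv_eq_fderiv.trans hi.fderiv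
  let A : ℝ × Plane →L[ℝ] Plane := mfderiv 𝓘(ℝ, ℝ × Plane) (𝓡 2) (famChart h c) (u, y)
  have h4 : A (0, w) = A (mfderiv (𝓡 2) 𝓘(ℝ, ℝ × Plane) (fun z : Plane ↦ (u, z)) y w) :=
    congrArg A (DFunLike.congr_fun h3 w).symm
  exact h4.trans ((DFunLike.congr_fun h1 w).symm.trans (DFunLike.congr_fun h2 w))

theorem mfderiv_famChart_fst (hc : c ∈ IsManifold.maximalAtlas (𝓡 2) ∞ S)
    (hh : IsSmoothFamily δ h) {u : ℝ} (hu : u ∈ Ioo (-δ) δ) {y : Plane} (hy : y ∈ c.target) :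
    (mfderiv 𝓘(ℝ, ℝ × Plane) (𝓡 2) (famChart h c) (u, y) ((1, 0) : ℝ × Plane) : Plane) =
      mfderiv 𝓘(ℝ, ℝ) (𝓡 2) (fun u ↦ h u (c.symm y)) u (1 : ℝ) := by
  have hf : MDifferentiableAt 𝓘(ℝ, ℝ × Plane) (𝓡 2) (famChart h c) (u, y) :=
    ((contMDiffOn_famChart hc hh).contMDiffAt
      ((isOpen_famDomain δ c).mem_nhds ⟨hu, hy⟩)).mdifferentiableAt (by simp)
  have hi : HasFDerivAt (fun t : ℝ ↦ (t, y)) (ContinuousLinearMap.inl ℝ ℝ Plane) u :=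
    hasFDerivAt_prodMk_left u y
  have h1 := mfderiv_comp (I := 𝓘(ℝ, ℝ)) (I' := 𝓘(ℝ, ℝ × Plane)) (I'' := 𝓡 2) u
    (g := famChart h c) (f := fun t : ℝ ↦ (t, y)) hf hi.differentiableAt.mdifferentiableAt
  have h3 : mfderiv 𝓘(ℝ, ℝ) 𝓘(ℝ, ℝ × Plane) (fun t : ℝ ↦ (t, y)) u =
      ContinuousLinearMap.inl ℝ ℝ Plane := mfderiv_eq_fderiv.trans hi.fderiv
  let A : ℝ × Plane →L[ℝ] Plane := mfderiv 𝓘(ℝ, ℝ × Plane) (𝓡 2) (famChart h c) (u, y)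
  have h4 : A (1, 0) = A (mfderiv 𝓘(ℝ, ℝ) 𝓘(ℝ, ℝ × Plane) (fun t : ℝ ↦ (t, y)) u (1 : ℝ)) :=
    congrArg A (DFunLike.congr_fun h3 (1 : ℝ)).symm
  exact h4.trans (DFunLike.congr_fun h1 (1 : ℝ)).symm

theorem mfderiv_chart_symm_det_ne_zero (hc : c ∈ IsManifold.maximalAtlas (𝓡 2) ∞ S) {y : Plane}
    (hy : y ∈ c.target) :
    (mfderiv (𝓡 2) (𝓡 2) c.symm y : Plane →L[ℝ] Plane).det ≠ 0 := by
  let T : Plane →L[ℝ] Plane := mfderiv (𝓡 2) (𝓡 2) c.symm y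
  let T' : Plane →L[ℝ] Plane := mfderiv (𝓡 2) (𝓡 2) c (c.symm y)
  have h : T'.comp T = ContinuousLinearMap.id ℝ Plane :=
    (mdifferentiable_of_mem_maximalAtlas hc).comp_symm_deriv hy
  have h2 : T'.det * T.det = 1 := by
    have := congrArg ContinuousLinearMap.det h
    have e1 : (T'.comp T).det = T'.det * T.det := LinearMap.det_comp _ _
    have e2 : (ContinuousLinearMap.id ℝ Plane).det = 1 := LinearMap.det_id
    rw [← e1, this, e2]
  intro h0
  change T.det = 0 at h0
  simp [h0] at h2

theorem mfderiv_chart_symm_surjective (hc : c ∈ IsManifold.maximalAtlas (𝓡 2) ∞ S) {y : Plane}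
    (hy : y ∈ c.target) (v : Plane) : ∃ w : Plane, (mfderiv (𝓡 2) (𝓡 2) c.symm y w : Plane) = v := by
  have hs : c.symm y ∈ c.source := c.map_target hy
  have hcomp := (mdifferentiable_of_mem_maximalAtlas hc).symm_comp_deriv hs
  rw [c.right_inv hy] at hcomp
  exact ⟨mfderiv (𝓡 2) (𝓡 2) c (c.symm y) v, DFunLike.congr_fun hcomp v⟩

end Family

/-! ### The pullback of the product metric, in charts and intrinsically -/

section Products

variable {M₁ : Type*} [TopologicalSpace M₁] [ChartedSpace Plane M₁] [IsManifold (𝓡 2) ∞ M₁]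
  {M₂ : Type*} [TopologicalSpace M₂] [ChartedSpace Plane M₂] [IsManifold (𝓡 2) ∞ M₂]
  {S : Type*} [TopologicalSpace S] [ChartedSpace Plane S]
  (g₁ : LorentzMetric M₁) (g₂ : LorentzMetric M₂) (ε : ℝ)

/-- The induced form `Φ^* G^ε` on the tangent plane at `p`. -/
def inducedForm (Φ : S → M₁ × M₂) (p : S) : Plane →L[ℝ] Plane →L[ℝ] ℝ :=
  let A₁ : Plane →L[ℝ] Plane := mfderiv (𝓡 2) (𝓡 2) (fun p ↦ (Φ p).1) p
  let A₂ : Plane →L[ℝ] Plane := mfderiv (𝓡 2) (𝓡 2) (fun p ↦ (Φ p).2) p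
  let B₁ : Plane →L[ℝ] Plane →L[ℝ] ℝ := g₁.inner (Φ p).1
  let B₂ : Plane →L[ℝ] Plane →L[ℝ] ℝ := g₂.inner (Φ p).2
  B₁.bilinearComp A₁ A₁ + ε • B₂.bilinearComp A₂ A₂

/-- The pullback of `G^ε` under a family of maps read in a chart. -/
def totalForm (Ψ : ℝ → S → M₁ × M₂) (c : OpenPartialHomeomorph S Plane) (ξ η : ℝ × Plane)
    (q : ℝ × Plane) : ℝ :=
  pullForm g₁ (famChart (fun u p ↦ (Ψ u p).1) c) ξ η q
    + ε * pullForm g₂ (famChart (fun u p ↦ (Ψ u p).2) c) ξ η q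

/-- The velocity of a family of maps, paired with the tangent vector `v` of the surface. -/
def velocityForm (Ψ : ℝ → S → M₁ × M₂) (u : ℝ) (p : S) (v : Plane) : ℝ :=
  prodMetric g₁ g₂ ε (Ψ u p)
    (mfderiv 𝓘(ℝ, ℝ) (𝓡 2) (fun u ↦ (Ψ u p).1) u (1 : ℝ),
      mfderiv 𝓘(ℝ, ℝ) (𝓡 2) (fun u ↦ (Ψ u p).2) u (1 : ℝ)) (dMap (Ψ u) p v)

/-- The square of the velocity of a family of maps. -/
def velocitySq (Ψ : ℝ → S → M₁ × M₂) (u : ℝ) (p : S) : ℝ :=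
  prodMetric g₁ g₂ ε (Ψ u p)
    (mfderiv 𝓘(ℝ, ℝ) (𝓡 2) (fun u ↦ (Ψ u p).1) u (1 : ℝ),
      mfderiv 𝓘(ℝ, ℝ) (𝓡 2) (fun u ↦ (Ψ u p).2) u (1 : ℝ))
    (mfderiv 𝓘(ℝ, ℝ) (𝓡 2) (fun u ↦ (Ψ u p).1) u (1 : ℝ),
      mfderiv 𝓘(ℝ, ℝ) (𝓡 2) (fun u ↦ (Ψ u p).2) u (1 : ℝ))

variable {δ : ℝ} {Ψ : ℝ → S → M₁ × M₂} {c : OpenPartialHomeomorph S Plane} {u : ℝ} {y : Plane}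

theorem inducedCoord_eq {Φ : S → M₁ × M₂} (hc : c ∈ IsManifold.maximalAtlas (𝓡 2) ∞ S)
    (h₁ : ContMDiff (𝓡 2) (𝓡 2) ∞ fun p ↦ (Φ p).1)
    (h₂ : ContMDiff (𝓡 2) (𝓡 2) ∞ fun p ↦ (Φ p).2) (hy : y ∈ c.target) :
    inducedCoord g₁ g₂ ε Φ c y = Matrix.of fun a b ↦ inducedForm g₁ g₂ ε Φ (c.symm y)
      ((mfderiv (𝓡 2) (𝓡 2) c.symm y : Plane →L[ℝ] Plane) (basisVec a))
      ((mfderiv (𝓡 2) (𝓡 2) c.symm y : Plane →L[ℝ] Plane) (basisVec b)) := by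
  have hs := (mdifferentiable_of_mem_maximalAtlas hc).mdifferentiableAt_symm hy
  have e₁ := mfderiv_comp (I := 𝓡 2) (I' := 𝓡 2) (I'' := 𝓡 2) y (g := fun p ↦ (Φ p).1)
    (f := c.symm) (h₁.mdifferentiableAt (by simp)) hs
  have e₂ := mfderiv_comp (I := 𝓡 2) (I' := 𝓡 2) (I'' := 𝓡 2) y (g := fun p ↦ (Φ p).2)
    (f := c.symm) (h₂.mdifferentiableAt (by simp)) hs
  let B₁ : Plane →L[ℝ] Plane →L[ℝ] ℝ := g₁.inner (Φ (c.symm y)).1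
  let B₂ : Plane →L[ℝ] Plane →L[ℝ] ℝ := g₂.inner (Φ (c.symm y)).2
  ext a b
  exact congrArg₂ (fun s t : ℝ ↦ s + ε * t)
    (congrArg₂ (fun v w ↦ B₁ v w) (DFunLike.congr_fun e₁ (basisVec a))
      (DFunLike.congr_fun e₁ (basisVec b)))
    (congrArg₂ (fun v w ↦ B₂ v w) (DFunLike.congr_fun e₂ (basisVec a))
      (DFunLike.congr_fun e₂ (basisVec b)))

/-- This and the next two lemmas are a dictionary between a family read in a chart, where partial
derivatives are taken, and quantities at a point of S that do not mention the chart. -/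
theorem totalForm_snd_snd (hc : c ∈ IsManifold.maximalAtlas (𝓡 2) ∞ S)
    (h₁ : IsSmoothFamily δ fun u p ↦ (Ψ u p).1) (h₂ : IsSmoothFamily δ fun u p ↦ (Ψ u p).2)
    (hu : u ∈ Ioo (-δ) δ) (hy : y ∈ c.target) (v w : Plane) :
    totalForm g₁ g₂ ε Ψ c (0, v) (0, w) (u, y) = inducedForm g₁ g₂ ε (Ψ u) (c.symm y)
      ((mfderiv (𝓡 2) (𝓡 2) c.symm y : Plane →L[ℝ] Plane) v)
      ((mfderiv (𝓡 2) (𝓡 2) c.symm y : Plane →L[ℝ] Plane) w) := by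
  let B₁ : Plane →L[ℝ] Plane →L[ℝ] ℝ := g₁.inner (Ψ u (c.symm y)).1
  let B₂ : Plane →L[ℝ] Plane →L[ℝ] ℝ := g₂.inner (Ψ u (c.symm y)).2
  exact congrArg₂ (fun s t : ℝ ↦ s + ε * t)
    (congrArg₂ (fun v w ↦ B₁ v w) (mfderiv_famChart_snd hc h₁ hu hy v)
      (mfderiv_famChart_snd hc h₁ hu hy w))
    (congrArg₂ (fun v w ↦ B₂ v w) (mfderiv_famChart_snd hc h₂ hu hy v)
      (mfderiv_famChart_snd hc h₂ hu hy w))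

theorem totalForm_fst_snd (hc : c ∈ IsManifold.maximalAtlas (𝓡 2) ∞ S)
    (h₁ : IsSmoothFamily δ fun u p ↦ (Ψ u p).1) (h₂ : IsSmoothFamily δ fun u p ↦ (Ψ u p).2)
    (hu : u ∈ Ioo (-δ) δ) (hy : y ∈ c.target) (w : Plane) :
    totalForm g₁ g₂ ε Ψ c (1, 0) (0, w) (u, y) = velocityForm g₁ g₂ ε Ψ u (c.symm y)
      ((mfderiv (𝓡 2) (𝓡 2) c.symm y : Plane →L[ℝ] Plane) w) := by
  let B₁ : Plane →L[ℝ] Plane →L[ℝ] ℝ := g₁.inner (Ψ u (c.symm y)).1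
  let B₂ : Plane →L[ℝ] Plane →L[ℝ] ℝ := g₂.inner (Ψ u (c.symm y)).2
  exact congrArg₂ (fun s t : ℝ ↦ s + ε * t)
    (congrArg₂ (fun v w ↦ B₁ v w) (mfderiv_famChart_fst hc h₁ hu hy)
      (mfderiv_famChart_snd hc h₁ hu hy w))
    (congrArg₂ (fun v w ↦ B₂ v w) (mfderiv_famChart_fst hc h₂ hu hy)
      (mfderiv_famChart_snd hc h₂ hu hy w))

theorem totalForm_fst_fst (hc : c ∈ IsManifold.maximalAtlas (𝓡 2) ∞ S)
    (h₁ : IsSmoothFamily δ fun u p ↦ (Ψ u p).1) (h₂ : IsSmoothFamily δ fun u p ↦ (Ψ u p).2)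
    (hu : u ∈ Ioo (-δ) δ) (hy : y ∈ c.target) :
    totalForm g₁ g₂ ε Ψ c (1, 0) (1, 0) (u, y) = velocitySq g₁ g₂ ε Ψ u (c.symm y) := by
  let B₁ : Plane →L[ℝ] Plane →L[ℝ] ℝ := g₁.inner (Ψ u (c.symm y)).1
  let B₂ : Plane →L[ℝ] Plane →L[ℝ] ℝ := g₂.inner (Ψ u (c.symm y)).2
  exact congrArg₂ (fun s t : ℝ ↦ s + ε * t)
    (congrArg₂ (fun v w ↦ B₁ v w) (mfderiv_famChart_fst hc h₁ hu hy)
      (mfderiv_famChart_fst hc h₁ hu hy))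
    (congrArg₂ (fun v w ↦ B₂ v w) (mfderiv_famChart_fst hc h₂ hu hy)
      (mfderiv_famChart_fst hc h₂ hu hy))

theorem smoothOn_totalForm (hc : c ∈ IsManifold.maximalAtlas (𝓡 2) ∞ S)
    (h₁ : IsSmoothFamily δ fun u p ↦ (Ψ u p).1) (h₂ : IsSmoothFamily δ fun u p ↦ (Ψ u p).2)
    (ξ η : ℝ × Plane) :
    ContDiffOn ℝ ∞ (totalForm g₁ g₂ ε Ψ c ξ η) (Ioo (-δ) δ ×ˢ c.target) :=
  (smoothOn_pullForm g₁ (isOpen_famDomain δ c) (contMDiffOn_famChart hc h₁)).add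
    (contDiffOn_const.mul
      (smoothOn_pullForm g₂ (isOpen_famDomain δ c) (contMDiffOn_famChart hc h₂)))

end Products

/-! ### Maps that are a geodesic in one coordinate -/

section GeodesicFactor

variable {M : Type*} [TopologicalSpace M] [ChartedSpace Plane M] [IsManifold (𝓡 2) ∞ M]
  {S : Type*} [TopologicalSpace S] [ChartedSpace Plane S]
  (g : LorentzMetric M)

/-- In the chart `c`, the map `f₀` is a geodesic `γ` in the `b`-th coordinate and does not depend on
the other one; the sign of `g(γ', γ')` is that of `s`. -/
def IsGeodesicFactor (s : ℝ) (f₀ : S → M) (c : OpenPartialHomeomorph S Plane) (b : Fin 2) : Prop :=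
  ∃ (K : Set ℝ) (γ : ℝ → M), IsOpen K ∧ g.IsGeodesicOn γ K ∧
    (∀ r ∈ K, 0 < s * g.inner (γ r) (LorentzMetric.velocity γ r) (LorentzMetric.velocity γ r)) ∧
    ∀ y ∈ c.target, y b ∈ K ∧ f₀ (c.symm y) = γ (y b)

/-- The family agrees with the geodesic on the slice u = 0 only, so nothing can be deduced except in
directions (0, v); there the chain rule for z ↦ z b applies. -/
theorem dirDeriv_snd_of_eq_comp_coord {F : ℝ × Plane → ℝ} {C : ℝ → ℝ} {b : Fin 2} {y v : Plane}
    (hF : DifferentiableAt ℝ F (0, y)) (hC : DifferentiableAt ℝ C (y b))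
    (hFC : ∀ᶠ z in 𝓝 y, F (0, z) = C (z b)) :
    dirDeriv (0, v) F (0, y) = v b * deriv C (y b) := by
  have h1 : HasFDerivAt (fun z : Plane ↦ F (0, z))
      ((fderiv ℝ F (0, y)).comp (ContinuousLinearMap.inr ℝ ℝ Plane)) y :=
    hF.hasFDerivAt.comp y (hasFDerivAt_prodMk_right 0 y)
  have h2 : HasFDerivAt (fun z : Plane ↦ C (z b))
      ((ContinuousLinearMap.toSpanSingleton ℝ (deriv C (y b))).comp
        (EuclideanSpace.proj (𝕜 := ℝ) b)) y :=
    HasFDerivAt.comp (g := C) y hC.hasDerivAt.hasFDerivAt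
      (EuclideanSpace.proj (𝕜 := ℝ) b : Plane →L[ℝ] ℝ).hasFDerivAt
  have h3 := (h2.congr_of_eventuallyEq hFC).unique h1
  have := DFunLike.congr_fun h3 v
  simpa [dirDeriv] using this.symm

variable {g} {δ s : ℝ} {h : ℝ → S → M} {c : OpenPartialHomeomorph S Plane} {b : Fin 2}

omit [ChartedSpace Plane S] in
theorem zero_mem_famDomain (hδ : 0 < δ) {y : Plane} (hy : y ∈ c.target) :
    ((0 : ℝ), y) ∈ Ioo (-δ) δ ×ˢ c.target := ⟨⟨by linarith, hδ⟩, hy⟩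

theorem mfderiv_famChart_geodesic (hc : c ∈ IsManifold.maximalAtlas (𝓡 2) ∞ S)
    (hδ : 0 < δ) (hh : IsSmoothFamily δ h) {K : Set ℝ} {γ : ℝ → M} (hK : IsOpen K)
    (hγ : g.IsGeodesicOn γ K) (hγc : ∀ y ∈ c.target, y b ∈ K ∧ h 0 (c.symm y) = γ (y b))
    {y : Plane} (hy : y ∈ c.target) (v : Plane) :
    (mfderiv 𝓘(ℝ, ℝ × Plane) (𝓡 2) (famChart h c) (0, y) ((0, v) : ℝ × Plane) : Plane) =
      v b • (LorentzMetric.velocity γ (y b) : Plane) := by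
  have h0 : (0 : ℝ) ∈ Ioo (-δ) δ := ⟨by linarith, hδ⟩
  have hγd : MDifferentiableAt 𝓘(ℝ, ℝ) (𝓡 2) γ (y b) :=
    (hγ.1.contMDiffAt (hK.mem_nhds (hγc y hy).1)).mdifferentiableAt (by simp)
  have h2 := mfderiv_comp (I := 𝓡 2) (I' := 𝓡 2) (I'' := 𝓡 2) y (g := h 0) (f := c.symm)
    ((contMDiff_of_family hh h0).mdifferentiableAt (by simp))
    ((mdifferentiable_of_mem_maximalAtlas hc).mdifferentiableAt_symm hy)
  have hp : HasFDerivAt (fun z : Plane ↦ z b) (EuclideanSpace.proj (𝕜 := ℝ) b : Plane →L[ℝ] ℝ) y :=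
    (EuclideanSpace.proj (𝕜 := ℝ) b : Plane →L[ℝ] ℝ).hasFDerivAt
  have h3 := mfderiv_comp (I := 𝓡 2) (I' := 𝓘(ℝ, ℝ)) (I'' := 𝓡 2) y (g := γ)
    (f := fun z : Plane ↦ z b) hγd hp.differentiableAt.mdifferentiableAt
  have h4 : mfderiv (𝓡 2) 𝓘(ℝ, ℝ) (fun z : Plane ↦ z b) y =
      (EuclideanSpace.proj (𝕜 := ℝ) b : Plane →L[ℝ] ℝ) := mfderiv_eq_fderiv.trans hp.fderiv
  have hev : h 0 ∘ c.symm =ᶠ[𝓝 y] γ ∘ fun z : Plane ↦ z b := by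
    filter_upwards [c.open_target.mem_nhds hy] with z hz using (hγc z hz).2
  let A : ℝ →L[ℝ] Plane := mfderiv 𝓘(ℝ, ℝ) (𝓡 2) γ (y b)
  have h5 : A (v b) = v b • A 1 := by
    rw [← map_smul, smul_eq_mul, mul_one]
  have h6 : A (mfderiv (𝓡 2) 𝓘(ℝ, ℝ) (fun z : Plane ↦ z b) y v) = A (v b) :=
    congrArg A (DFunLike.congr_fun h4 v)
  refine (mfderiv_famChart_snd hc hh h0 hy v).trans ?_
  exact (DFunLike.congr_fun h2 v).symm.trans ((DFunLike.congr_fun hev.mfderiv_eq v).trans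
    ((DFunLike.congr_fun h3 v).trans (h6.trans h5)))

theorem pullForm_eq_zero_of_geodesicFactor (hc : c ∈ IsManifold.maximalAtlas (𝓡 2) ∞ S)
    (hδ : 0 < δ) (hh : IsSmoothFamily δ h) (hf : IsGeodesicFactor g s (h 0) c b) {y : Plane}
    (hy : y ∈ c.target) {v : Plane} (hv : v b = 0) (ξ : ℝ × Plane) :
    pullForm g (famChart h c) ξ (0, v) (0, y) = 0 := by
  obtain ⟨K, γ, hK, hγ, -, hγc⟩ := hf
  have h1 := mfderiv_famChart_geodesic hc hδ hh hK hγ hγc hy v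
  rw [hv, zero_smul] at h1
  let B : Plane →L[ℝ] ℝ := (g.inner (famChart h c (0, y)) : Plane →L[ℝ] Plane →L[ℝ] ℝ)
    (mfderiv 𝓘(ℝ, ℝ × Plane) (𝓡 2) (famChart h c) (0, y) ξ)
  exact (congrArg B h1).trans (map_zero B)

theorem pullForm_pos_of_geodesicFactor (hc : c ∈ IsManifold.maximalAtlas (𝓡 2) ∞ S)
    (hδ : 0 < δ) (hh : IsSmoothFamily δ h) (hf : IsGeodesicFactor g s (h 0) c b) {y : Plane}
    (hy : y ∈ c.target) :
    0 < s * pullForm g (famChart h c) (0, basisVec b) (0, basisVec b) (0, y) := by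
  obtain ⟨K, γ, hK, hγ, hs, hγc⟩ := hf
  have h1 := mfderiv_famChart_geodesic hc hδ hh hK hγ hγc hy (basisVec b)
  have hb : basisVec b b = 1 := by simp [basisVec]
  rw [hb, one_smul] at h1
  let B : M → Plane →L[ℝ] Plane →L[ℝ] ℝ := g.inner
  have h2 : pullForm g (famChart h c) (0, basisVec b) (0, basisVec b) (0, y) =
      B (γ (y b)) (LorentzMetric.velocity γ (y b)) (LorentzMetric.velocity γ (y b)) := by
    rw [← (hγc y hy).2]
    exact congrArg₂ (fun v w ↦ B (h 0 (c.symm y)) v w) h1 h1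
  rw [h2]
  exact hs _ (hγc y hy).1

/-- For z ↦ γ(z b), the second covariant derivative in the directions v, w is v b · w b times the
acceleration of γ, and the geodesic equation makes it zero. The factor is thus totally geodesic as a
map of the slice. -/
theorem covComp_eq_zero_of_geodesicFactor (hc : c ∈ IsManifold.maximalAtlas (𝓡 2) ∞ S)
    (hδ : 0 < δ) (hh : IsSmoothFamily δ h) (hf : IsGeodesicFactor g s (h 0) c b) {y : Plane}
    (hy : y ∈ c.target) (v w : Plane) (k : Fin 2) :
    covComp g (chartAt Plane (famChart h c (0, y)))
      (fun r ↦ chartAt Plane (famChart h c (0, y)) (famChart h c r)) (0, v) (0, w) k (0, y) = 0 := by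
  obtain ⟨K, γ, hK, hγ, -, hγc⟩ := hf
  have e0 : famChart h c (0, y) = γ (y b) := (hγc y hy).2
  rw [e0]
  set e := chartAt Plane (γ (y b)) with hedef
  have he : e ∈ IsManifold.maximalAtlas (𝓡 2) ∞ M := IsManifold.chart_mem_maximalAtlas _
  have hfs := contMDiffOn_famChart hc hh
  set U := (Ioo (-δ) δ ×ˢ c.target) ∩ famChart h c ⁻¹' e.source with hU
  have hUo : IsOpen U := hfs.continuousOn.isOpen_inter_preimage (isOpen_famDomain δ c) e.open_source
  have hyU : ((0 : ℝ), y) ∈ U := ⟨zero_mem_famDomain hδ hy, by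
    rw [mem_preimage, e0]; exact mem_chart_source _ _⟩
  have hx : ContDiffOn ℝ ∞ (fun r ↦ e (famChart h c r)) U :=
    smoothOn_chart_comp he (hfs.mono inter_subset_left) fun r hr ↦ hr.2
  set L := K ∩ γ ⁻¹' e.source with hL
  have hLo : IsOpen L := hγ.1.continuousOn.isOpen_inter_preimage hK e.open_source
  have hC : ContDiffOn ℝ ∞ (fun r ↦ e (γ r)) L :=
    smoothOn_chart_comp he (hγ.1.mono inter_subset_left) fun r hr ↦ hr.2
  have hCk : ∀ k, ContDiffOn ℝ ∞ (fun r ↦ e (γ r) k) L := smoothOn_coord hC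
  have hCd : ∀ k, ContDiffOn ℝ ∞ (deriv fun r ↦ e (γ r) k) L := fun k ↦
    (hCk k).deriv_of_isOpen hLo (by simp)
  have hslice : IsOpen {z : Plane | ((0 : ℝ), z) ∈ U} := hUo.preimage (by fun_prop)
  have hzL : ∀ z : Plane, ((0 : ℝ), z) ∈ U → z b ∈ L := by
    rintro z ⟨⟨-, hz⟩, hz'⟩
    refine ⟨(hγc z hz).1, ?_⟩
    rw [mem_preimage, ← (hγc z hz).2]; exact hz'
  have first : ∀ (v : Plane) (k : Fin 2) (z : Plane), ((0 : ℝ), z) ∈ U →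
      dirDeriv (0, v) (fun r ↦ e (famChart h c r) k) (0, z) =
        v b * deriv (fun r ↦ e (γ r) k) (z b) := by
    intro v k z hz
    refine dirDeriv_snd_of_eq_comp_coord (diffAt_of_smoothOn hUo (smoothOn_coord hx k) hz)
      (diffAt_of_smoothOn hLo (hCk k) (hzL z hz)) ?_
    filter_upwards [hslice.mem_nhds hz] with z' hz'
    have : famChart h c (0, z') = γ (z' b) := (hγc z' hz'.1.2).2
    rw [this]
  have second : dirDeriv (0, v) (dirDeriv (0, w) (fun r ↦ e (famChart h c r) k)) (0, y) =
      v b * (w b * deriv (deriv fun r ↦ e (γ r) k) (y b)) := by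
    have hd := diffAt_of_smoothOn hLo (hCd k) (hzL y hyU)
    have := dirDeriv_snd_of_eq_comp_coord (v := v)
      (F := dirDeriv (0, w) (fun r ↦ e (famChart h c r) k))
      (C := fun t ↦ w b * deriv (fun r ↦ e (γ r) k) t)
      (diffAt_of_smoothOn hUo (smoothOn_dirDeriv hUo (smoothOn_coord hx k)) hyU)
      (hd.const_mul _) (by
        filter_upwards [hslice.mem_nhds hyU] with z hz using first w k z hz)
    rw [this, deriv_const_mul _ hd]
  have geo := hγ.2 (y b) (hγc y hy).1 k
  simp only [← hedef] at geo
  simp only [covComp, second, first _ _ y hyU, e0]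
  have hsum : ∑ i, ∑ j, g.christoffel e k i j (e (γ (y b))) *
      (v b * deriv (fun r ↦ e (γ r) i) (y b)) * (w b * deriv (fun r ↦ e (γ r) j) (y b)) =
      v b * w b * ∑ i, ∑ j, g.christoffel e k i j (e (γ (y b))) *
        deriv (fun r ↦ e (γ r) i) (y b) * deriv (fun r ↦ e (γ r) j) (y b) := by
    simp only [Finset.mul_sum]
    refine Finset.sum_congr rfl fun i _ ↦ Finset.sum_congr rfl fun j _ ↦ ?_
    ring
  rw [hsum]
  linear_combination v b * w b * geo

/-- Metric compatibility, with both covariant derivatives zero. The induced metric of a product of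
geodesics therefore has locally constant coefficients in the product chart. -/
theorem dirDeriv_pullForm_of_geodesicFactor (hc : c ∈ IsManifold.maximalAtlas (𝓡 2) ∞ S)
    (hδ : 0 < δ) (hh : IsSmoothFamily δ h) (hf : IsGeodesicFactor g s (h 0) c b) {y : Plane}
    (hy : y ∈ c.target) (v w w' : Plane) :
    dirDeriv (0, v) (pullForm g (famChart h c) (0, w) (0, w')) (0, y) = 0 := by
  have hcov := covComp_eq_zero_of_geodesicFactor hc hδ hh hf hy
  set e := chartAt Plane (famChart h c (0, y)) with hedef
  have he : e ∈ IsManifold.maximalAtlas (𝓡 2) ∞ M := IsManifold.chart_mem_maximalAtlas _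
  have hfs := contMDiffOn_famChart hc hh
  set U := (Ioo (-δ) δ ×ˢ c.target) ∩ famChart h c ⁻¹' e.source with hU
  have hUo : IsOpen U := hfs.continuousOn.isOpen_inter_preimage (isOpen_famDomain δ c) e.open_source
  have hyU : ((0 : ℝ), y) ∈ U := ⟨zero_mem_famDomain hδ hy, mem_chart_source _ _⟩
  have hx : ContDiffOn ℝ ∞ (fun r ↦ e (famChart h c r)) U :=
    smoothOn_chart_comp he (hfs.mono inter_subset_left) fun r hr ↦ hr.2
  rw [dirDeriv_congr hUo (fun r hr ↦ pullForm_eq_coordForm g he hUo (hfs.mono inter_subset_left)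
    (fun r hr ↦ hr.2) hr) hyU, dirDeriv_coordForm_metric g he hUo hx
    (fun r hr ↦ e.map_source hr.2) hyU]
  simp only [hcov, mul_zero, zero_mul, Finset.sum_const_zero, add_zero]

end GeodesicFactor

/-! ### Derivatives of functions of parameter and position -/

section Calculus

variable {E : Type*} [NormedAddCommGroup E] [NormedSpace ℝ E] {U : Set E} {f h : E → ℝ}
  {α β : E} {q : E}

theorem dirDeriv_dirDeriv_mul (hU : IsOpen U) (hf : ContDiffOn ℝ ∞ f U)
    (hh : ContDiffOn ℝ ∞ h U) (hq : q ∈ U) :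
    dirDeriv α (dirDeriv β (fun r ↦ f r * h r)) q =
      dirDeriv α (dirDeriv β f) q * h q + dirDeriv β f q * dirDeriv α h q
        + (dirDeriv α f q * dirDeriv β h q + f q * dirDeriv α (dirDeriv β h) q) := by
  rw [dirDeriv_congr hU (fun r hr ↦ dirDeriv_mul (diffAt_of_smoothOn hU hf hr)
    (diffAt_of_smoothOn hU hh hr)) hq]
  have d1 := diffAt_of_smoothOn hU hf hq
  have d2 := diffAt_of_smoothOn hU hh hq
  have d4 := diffAt_of_smoothOn hU (smoothOn_dirDeriv (ξ := β) hU hf) hq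
  have d5 := diffAt_of_smoothOn hU (smoothOn_dirDeriv (ξ := β) hU hh) hq
  rw [dirDeriv_add (d4.fun_mul d2) (d1.fun_mul d5), dirDeriv_mul d4 d2, dirDeriv_mul d1 d5]

theorem hasDerivAt_fst {F : ℝ × Plane → ℝ} {u : ℝ} {y : Plane} (hF : DifferentiableAt ℝ F (u, y)) :
    HasDerivAt (fun t ↦ F (t, y)) (dirDeriv (1, 0) F (u, y)) u := by
  have h1 : HasFDerivAt (fun t : ℝ ↦ F (t, y))
      ((fderiv ℝ F (u, y)).comp (ContinuousLinearMap.inl ℝ ℝ Plane)) u :=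
    hF.hasFDerivAt.comp u (hasFDerivAt_prodMk_left u y)
  have := h1.hasDerivAt
  simpa [dirDeriv] using this

theorem hasFDerivAt_snd {F : ℝ × Plane → ℝ} {u : ℝ} {y : Plane}
    (hF : DifferentiableAt ℝ F (u, y)) :
    HasFDerivAt (fun z ↦ F (u, z))
      ((fderiv ℝ F (u, y)).comp (ContinuousLinearMap.inr ℝ ℝ Plane)) y :=
  hF.hasFDerivAt.comp y (hasFDerivAt_prodMk_right u y)

theorem dirDeriv_snd {F : ℝ × Plane → ℝ} {u : ℝ} {y : Plane} (hF : DifferentiableAt ℝ F (u, y))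
    (v : Plane) : dirDeriv v (fun z ↦ F (u, z)) y = dirDeriv (0, v) F (u, y) := by
  rw [dirDeriv, (hasFDerivAt_snd hF).fderiv]; rfl

end Calculus

/-! ### The pointwise second variation inequality -/

section Pointwise

variable {M₁ : Type*} [TopologicalSpace M₁] [ChartedSpace Plane M₁] [IsManifold (𝓡 2) ∞ M₁]
  {M₂ : Type*} [TopologicalSpace M₂] [ChartedSpace Plane M₂] [IsManifold (𝓡 2) ∞ M₂]
  {S : Type*} [TopologicalSpace S] [ChartedSpace Plane S]
  (g₁ : LorentzMetric M₁) (g₂ : LorentzMetric M₂) (ε s : ℝ)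

/-- A chart in which `Φ` is a product of geodesics, such that the induced metric has sign `s`. -/
def IsProductChart (Φ : S → M₁ × M₂) (c : OpenPartialHomeomorph S Plane) : Prop :=
  c ∈ IsManifold.maximalAtlas (𝓡 2) ∞ S ∧ IsGeodesicFactor g₁ s (fun p ↦ (Φ p).1) c 0 ∧
    IsGeodesicFactor g₂ (s * ε) (fun p ↦ (Φ p).2) c 1

/-- A smooth family of maps whose velocity at `u = 0` is normal. -/
structure IsNormalFamily (δ : ℝ) (Ψ : ℝ → S → M₁ × M₂) : Prop where
  pos : 0 < δ
  smooth₁ : IsSmoothFamily δ fun u p ↦ (Ψ u p).1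
  smooth₂ : IsSmoothFamily δ fun u p ↦ (Ψ u p).2
  normal (p : S) (v : Plane) : velocityForm g₁ g₂ ε Ψ 0 p v = 0

/-- The component `θ(w)` of the acceleration one-form of a family, read in a chart. -/
def accelChart (Ψ : ℝ → S → M₁ × M₂) (c : OpenPartialHomeomorph S Plane) (w : Plane)
    (q : ℝ × Plane) : ℝ :=
  dirDeriv (1, 0) (totalForm g₁ g₂ ε Ψ c (1, 0) (0, w)) q
    - 1 / 2 * dirDeriv (0, w) (totalForm g₁ g₂ ε Ψ c (1, 0) (1, 0)) q

/-- The determinant of the induced metric of a family, read in a chart. -/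
def detChart (Ψ : ℝ → S → M₁ × M₂) (c : OpenPartialHomeomorph S Plane) (q : ℝ × Plane) : ℝ :=
  totalForm g₁ g₂ ε Ψ c (0, basisVec 0) (0, basisVec 0) q *
      totalForm g₁ g₂ ε Ψ c (0, basisVec 1) (0, basisVec 1) q
    - totalForm g₁ g₂ ε Ψ c (0, basisVec 0) (0, basisVec 1) q *
      totalForm g₁ g₂ ε Ψ c (0, basisVec 0) (0, basisVec 1) q

variable {g₁ g₂ ε s} {δ : ℝ} {Ψ : ℝ → S → M₁ × M₂} {c : OpenPartialHomeomorph S Plane} {y : Plane}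

theorem smoothOn_detChart (hc : c ∈ IsManifold.maximalAtlas (𝓡 2) ∞ S)
    (hΨ : IsNormalFamily g₁ g₂ ε δ Ψ) :
    ContDiffOn ℝ ∞ (detChart g₁ g₂ ε Ψ c) (Ioo (-δ) δ ×ˢ c.target) := by
  have hT := smoothOn_totalForm g₁ g₂ ε hc hΨ.smooth₁ hΨ.smooth₂
  exact ((hT _ _).mul (hT _ _)).sub ((hT _ _).mul (hT _ _))

theorem smoothOn_accelChart (hc : c ∈ IsManifold.maximalAtlas (𝓡 2) ∞ S)
    (hΨ : IsNormalFamily g₁ g₂ ε δ Ψ) (w : Plane) :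
    ContDiffOn ℝ ∞ (accelChart g₁ g₂ ε Ψ c w) (Ioo (-δ) δ ×ˢ c.target) := by
  have hT := smoothOn_totalForm g₁ g₂ ε hc hΨ.smooth₁ hΨ.smooth₂
  exact (smoothOn_dirDeriv (isOpen_famDomain δ c) (hT _ _)).sub
    (contDiffOn_const.mul (smoothOn_dirDeriv (isOpen_famDomain δ c) (hT _ _)))

section

variable (hc : IsProductChart g₁ g₂ ε s (Ψ 0) c) (hΨ : IsNormalFamily g₁ g₂ ε δ Ψ)
  (hy : y ∈ c.target)
include hc hΨ hy

theorem eps_ne_zero_of_productChart : ε ≠ 0 := by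
  rintro rfl
  have := pullForm_pos_of_geodesicFactor hc.1 hΨ.pos hΨ.smooth₂ hc.2.2 hy
  simp at this

/-- The diagonal entry at a comes only from the factor whose geodesic runs in coordinate a. The
signs s and s * ε in `IsProductChart` are chosen so that both entries have sign s. -/
theorem totalForm_diag_pos (a : Fin 2) :
    0 < s * totalForm g₁ g₂ ε Ψ c (0, basisVec a) (0, basisVec a) (0, y) := by
  have h1 := pullForm_pos_of_geodesicFactor hc.1 hΨ.pos hΨ.smooth₁ hc.2.1 hy
  have h2 := pullForm_pos_of_geodesicFactor hc.1 hΨ.pos hΨ.smooth₂ hc.2.2 hy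
  have z1 := pullForm_eq_zero_of_geodesicFactor hc.1 hΨ.pos hΨ.smooth₁ hc.2.1 hy
    (v := basisVec 1) (by simp [basisVec]) (0, basisVec 1)
  have z2 := pullForm_eq_zero_of_geodesicFactor hc.1 hΨ.pos hΨ.smooth₂ hc.2.2 hy
    (v := basisVec 0) (by simp [basisVec]) (0, basisVec 0)
  fin_cases a
  · change 0 < s * (_ + ε * _)
    simp only [Fin.zero_eta] at *
    rw [z2, mul_zero, add_zero]; exact h1
  · change 0 < s * (_ + ε * _)
    simp only [Fin.mk_one] at *
    rw [z1, zero_add, ← mul_assoc]; exact h2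

theorem totalForm_off_diag :
    totalForm g₁ g₂ ε Ψ c (0, basisVec 0) (0, basisVec 1) (0, y) = 0 := by
  have z1 := pullForm_eq_zero_of_geodesicFactor hc.1 hΨ.pos hΨ.smooth₁ hc.2.1 hy
    (v := basisVec 1) (by simp [basisVec]) (0, basisVec 0)
  have z2 := pullForm_eq_zero_of_geodesicFactor hc.1 hΨ.pos hΨ.smooth₂ hc.2.2 hy
    (v := basisVec 0) (by simp [basisVec]) (0, basisVec 1)
  have z3 : pullForm g₂ (famChart (fun u p ↦ (Ψ u p).2) c) (0, basisVec 0) (0, basisVec 1) (0, y)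
      = 0 := (g₂.symm _ _ _).trans z2
  rw [totalForm, z1, z3, mul_zero, add_zero]

theorem dirDeriv_totalForm_eq_zero (v w w' : Plane) :
    dirDeriv (0, v) (totalForm g₁ g₂ ε Ψ c (0, w) (0, w')) (0, y) = 0 := by
  have hq := zero_mem_famDomain hΨ.pos hy
  have s1 := smoothOn_pullForm g₁ (ξ := (0, w)) (η := (0, w')) (isOpen_famDomain δ c)
    (contMDiffOn_famChart hc.1 hΨ.smooth₁)
  have s2 := smoothOn_pullForm g₂ (ξ := (0, w)) (η := (0, w')) (isOpen_famDomain δ c)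
    (contMDiffOn_famChart hc.1 hΨ.smooth₂)
  have d1 := diffAt_of_smoothOn (isOpen_famDomain δ c) s1 hq
  have d2 := diffAt_of_smoothOn (isOpen_famDomain δ c) s2 hq
  have e : totalForm g₁ g₂ ε Ψ c (0, w) (0, w') = fun q ↦
    pullForm g₁ (famChart (fun u p ↦ (Ψ u p).1) c) (0, w) (0, w') q
    + ε * pullForm g₂ (famChart (fun u p ↦ (Ψ u p).2) c) (0, w) (0, w') q := rfl
  rw [e, dirDeriv_add d1 (d2.const_mul ε), dirDeriv_const_mul _ d2,
    dirDeriv_pullForm_of_geodesicFactor hc.1 hΨ.pos hΨ.smooth₁ hc.2.1 hy,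
    dirDeriv_pullForm_of_geodesicFactor hc.1 hΨ.pos hΨ.smooth₂ hc.2.2 hy, mul_zero, add_zero]

/-- The second factor does not move in coordinate 0, so only g₁ contributes to the pairing of the
velocity with ∂_0. Normality to the surface thus splits into normality to each geodesic. -/
theorem pullForm_normal₁ : pullForm g₁ (famChart (fun u p ↦ (Ψ u p).1) c) (1, 0)
    (0, basisVec 0) (0, y) = 0 := by
  have h : totalForm g₁ g₂ ε Ψ c (1, 0) (0, basisVec 0) (0, y) = 0 :=
    (totalForm_fst_snd g₁ g₂ ε hc.1 hΨ.smooth₁ hΨ.smooth₂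
      (zero_mem_famDomain hΨ.pos hy).1 hy (basisVec 0)).trans (hΨ.normal _ _)
  rw [totalForm, pullForm_eq_zero_of_geodesicFactor hc.1 hΨ.pos hΨ.smooth₂ hc.2.2 hy
    (by simp [basisVec]), mul_zero, add_zero] at h
  exact h

theorem pullForm_normal₂ : pullForm g₂ (famChart (fun u p ↦ (Ψ u p).2) c) (1, 0)
    (0, basisVec 1) (0, y) = 0 := by
  have h : totalForm g₁ g₂ ε Ψ c (1, 0) (0, basisVec 1) (0, y) = 0 :=
    (totalForm_fst_snd g₁ g₂ ε hc.1 hΨ.smooth₁ hΨ.smooth₂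
      (zero_mem_famDomain hΨ.pos hy).1 hy (basisVec 1)).trans (hΨ.normal _ _)
  rw [totalForm, pullForm_eq_zero_of_geodesicFactor hc.1 hΨ.pos hΨ.smooth₁ hc.2.1 hy
    (by simp [basisVec]), zero_add] at h
  exact (mul_eq_zero.1 h).resolve_left (eps_ne_zero_of_productChart hc hΨ hy)

/-- Subtracting the derivative of θ supplies exactly the terms that complete ½ ∂_u² G(∂_a, ∂_a) to
the expression in `second_variation_pullForm_nonpos`. That lemma applies to each factor, with weight
s for g₁ and s * ε for g₂. -/
theorem second_variation_totalForm_nonpos (hκ₁ : ∀ x, s * g₁.gaussCurvature x ≤ 0)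
    (hκ₂ : ∀ x, s * ε * g₂.gaussCurvature x ≤ 0) (a : Fin 2) :
    s * (1 / 2 * dirDeriv (1, 0) (dirDeriv (1, 0)
        (totalForm g₁ g₂ ε Ψ c (0, basisVec a) (0, basisVec a))) (0, y)
      - dirDeriv (0, basisVec a) (accelChart g₁ g₂ ε Ψ c (basisVec a)) (0, y)) ≤ 0 := by
  have ho := isOpen_famDomain δ c
  have hq := zero_mem_famDomain hΨ.pos hy
  have f1 := contMDiffOn_famChart hc.1 hΨ.smooth₁
  have f2 := contMDiffOn_famChart hc.1 hΨ.smooth₂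
  -- Orthogonality to the geodesic holds along the entire slice u = 0, so it may be differentiated
  -- in tangential directions.
  have p1 : dirDeriv (0, basisVec a) (pullForm g₁ (famChart (fun u p ↦ (Ψ u p).1) c) (1, 0)
      (0, basisVec 0)) (0, y) = 0 := by
    rw [← dirDeriv_snd (diffAt_of_smoothOn ho (smoothOn_pullForm g₁ ho f1) hq),
      dirDeriv_congr c.open_target (h := fun _ ↦ 0)
        (fun z hz ↦ pullForm_normal₁ hc hΨ hz) hy]
    simp [dirDeriv]
  have p2 : dirDeriv (0, basisVec a) (pullForm g₂ (famChart (fun u p ↦ (Ψ u p).2) c) (1, 0)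
      (0, basisVec 1)) (0, y) = 0 := by
    rw [← dirDeriv_snd (diffAt_of_smoothOn ho (smoothOn_pullForm g₂ ho f2) hq),
      dirDeriv_congr c.open_target (h := fun _ ↦ 0)
        (fun z hz ↦ pullForm_normal₂ hc hΨ hz) hy]
    simp [dirDeriv]
  have c1 := covComp_eq_zero_of_geodesicFactor hc.1 hΨ.pos hΨ.smooth₁ hc.2.1 hy
  have c2 := covComp_eq_zero_of_geodesicFactor hc.1 hΨ.pos hΨ.smooth₂ hc.2.2 hy
  have n1 := second_variation_pullForm_nonpos g₁ ho f1 hq (hκ₁ _) (c1 _ _) (c1 _ _) p1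
    (pullForm_pos_of_geodesicFactor hc.1 hΨ.pos hΨ.smooth₁ hc.2.1 hy)
  have n2 := second_variation_pullForm_nonpos g₂ ho f2 hq (hκ₂ _) (c2 _ _) (c2 _ _) p2
    (pullForm_pos_of_geodesicFactor hc.1 hΨ.pos hΨ.smooth₂ hc.2.2 hy)
  have S1 : ∀ ξ η, ContDiffOn ℝ ∞ (pullForm g₁ (famChart (fun u p ↦ (Ψ u p).1) c) ξ η)
    (Ioo (-δ) δ ×ˢ c.target) := fun ξ η ↦ smoothOn_pullForm g₁ ho f1
  have S2 : ∀ ξ η, ContDiffOn ℝ ∞ (pullForm g₂ (famChart (fun u p ↦ (Ψ u p).2) c) ξ η)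
    (Ioo (-δ) δ ×ˢ c.target) := fun ξ η ↦ smoothOn_pullForm g₂ ho f2
  have T := smoothOn_totalForm g₁ g₂ ε hc.1 hΨ.smooth₁ hΨ.smooth₂
  have first : ∀ α ξ η, EqOn (dirDeriv α (totalForm g₁ g₂ ε Ψ c ξ η)) (fun q ↦
      dirDeriv α (pullForm g₁ (famChart (fun u p ↦ (Ψ u p).1) c) ξ η) q
      + ε * dirDeriv α (pullForm g₂ (famChart (fun u p ↦ (Ψ u p).2) c) ξ η) q)
      (Ioo (-δ) δ ×ˢ c.target) := by
    intro α ξ η r hr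
    have d1 := diffAt_of_smoothOn ho (S1 ξ η) hr
    have d2 := diffAt_of_smoothOn ho (S2 ξ η) hr
    have e : totalForm g₁ g₂ ε Ψ c ξ η = fun q ↦
      pullForm g₁ (famChart (fun u p ↦ (Ψ u p).1) c) ξ η q
      + ε * pullForm g₂ (famChart (fun u p ↦ (Ψ u p).2) c) ξ η q := rfl
    rw [e, dirDeriv_add d1 (d2.const_mul ε), dirDeriv_const_mul _ d2]
  have second : ∀ α β ξ η, dirDeriv β (dirDeriv α (totalForm g₁ g₂ ε Ψ c ξ η)) (0, y) =
      dirDeriv β (dirDeriv α (pullForm g₁ (famChart (fun u p ↦ (Ψ u p).1) c) ξ η)) (0, y)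
      + ε * dirDeriv β (dirDeriv α (pullForm g₂ (famChart (fun u p ↦ (Ψ u p).2) c) ξ η))
        (0, y) := by
    intro α β ξ η
    have d1 := diffAt_of_smoothOn ho (smoothOn_dirDeriv (ξ := α) ho (S1 ξ η)) hq
    have d2 := diffAt_of_smoothOn ho (smoothOn_dirDeriv (ξ := α) ho (S2 ξ η)) hq
    rw [dirDeriv_congr ho (first α ξ η) hq, dirDeriv_add d1 (d2.const_mul ε),
      dirDeriv_const_mul _ d2]
  have acc : dirDeriv (0, basisVec a) (accelChart g₁ g₂ ε Ψ c (basisVec a)) (0, y) =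
      dirDeriv (0, basisVec a) (dirDeriv (1, 0)
        (totalForm g₁ g₂ ε Ψ c (1, 0) (0, basisVec a))) (0, y)
      - 1 / 2 * dirDeriv (0, basisVec a) (dirDeriv (0, basisVec a)
        (totalForm g₁ g₂ ε Ψ c (1, 0) (1, 0))) (0, y) := by
    have d1 := diffAt_of_smoothOn ho (smoothOn_dirDeriv (ξ := (1, 0)) ho
      (T (1, 0) (0, basisVec a))) hq
    have d2 := diffAt_of_smoothOn ho (smoothOn_dirDeriv (ξ := (0, basisVec a)) ho
      (T (1, 0) (1, 0))) hq
    have e : accelChart g₁ g₂ ε Ψ c (basisVec a) = fun q ↦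
      dirDeriv (1, 0) (totalForm g₁ g₂ ε Ψ c (1, 0) (0, basisVec a)) q
      - 1 / 2 * dirDeriv (0, basisVec a) (totalForm g₁ g₂ ε Ψ c (1, 0) (1, 0)) q := rfl
    rw [e, dirDeriv_sub d1 (d2.const_mul _), dirDeriv_const_mul _ d2]
  rw [acc, second, second, second]
  linarith

/-- The second variation of the area density is at most the divergence of the acceleration. -/
theorem second_variation_density_le (hκ₁ : ∀ x, s * g₁.gaussCurvature x ≤ 0)
    (hκ₂ : ∀ x, s * ε * g₂.gaussCurvature x ≤ 0) :
    dirDeriv (1, 0) (dirDeriv (1, 0) (detChart g₁ g₂ ε Ψ c)) (0, y) /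
        detChart g₁ g₂ ε Ψ c (0, y) / 2
      - (dirDeriv (1, 0) (detChart g₁ g₂ ε Ψ c) (0, y) / detChart g₁ g₂ ε Ψ c (0, y)) ^ 2 / 4 ≤
    ∑ a, dirDeriv (0, basisVec a) (accelChart g₁ g₂ ε Ψ c (basisVec a)) (0, y) /
      totalForm g₁ g₂ ε Ψ c (0, basisVec a) (0, basisVec a) (0, y) := by
  have ho := isOpen_famDomain δ c
  have hq := zero_mem_famDomain hΨ.pos hy
  have hT := smoothOn_totalForm g₁ g₂ ε hc.1 hΨ.smooth₁ hΨ.smooth₂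
  have n0 := second_variation_totalForm_nonpos hc hΨ hy hκ₁ hκ₂ 0
  have n1 := second_variation_totalForm_nonpos hc hΨ hy hκ₁ hκ₂ 1
  have p0 := totalForm_diag_pos hc hΨ hy 0
  have p1 := totalForm_diag_pos hc hΨ hy 1
  have m0 := totalForm_off_diag hc hΨ hy
  set A := totalForm g₁ g₂ ε Ψ c (0, basisVec 0) (0, basisVec 0)
  set B := totalForm g₁ g₂ ε Ψ c (0, basisVec 1) (0, basisVec 1)
  set m := totalForm g₁ g₂ ε Ψ c (0, basisVec 0) (0, basisVec 1)
  have sA : ContDiffOn ℝ ∞ A (Ioo (-δ) δ ×ˢ c.target) := hT _ _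
  have sB : ContDiffOn ℝ ∞ B (Ioo (-δ) δ ×ˢ c.target) := hT _ _
  have sm : ContDiffOn ℝ ∞ m (Ioo (-δ) δ ×ˢ c.target) := hT _ _
  have eD : detChart g₁ g₂ ε Ψ c = fun q ↦ A q * B q - m q * m q := rfl
  have sAB := sA.mul sB
  have smm := sm.mul sm
  have d1 : dirDeriv (1, 0) (detChart g₁ g₂ ε Ψ c) (0, y) =
      dirDeriv (1, 0) A (0, y) * B (0, y) + A (0, y) * dirDeriv (1, 0) B (0, y) := by
    rw [eD, dirDeriv_sub (diffAt_of_smoothOn ho sAB hq) (diffAt_of_smoothOn ho smm hq),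
      dirDeriv_mul (diffAt_of_smoothOn ho sA hq) (diffAt_of_smoothOn ho sB hq),
      dirDeriv_mul (diffAt_of_smoothOn ho sm hq) (diffAt_of_smoothOn ho sm hq), m0]
    ring
  have d2 : dirDeriv (1, 0) (dirDeriv (1, 0) (detChart g₁ g₂ ε Ψ c)) (0, y) =
      dirDeriv (1, 0) (dirDeriv (1, 0) A) (0, y) * B (0, y)
      + 2 * (dirDeriv (1, 0) A (0, y) * dirDeriv (1, 0) B (0, y))
      + A (0, y) * dirDeriv (1, 0) (dirDeriv (1, 0) B) (0, y)
      - 2 * dirDeriv (1, 0) m (0, y) ^ 2 := by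
    rw [eD, dirDeriv_congr ho (fun r hr ↦ dirDeriv_sub (diffAt_of_smoothOn ho sAB hr)
        (diffAt_of_smoothOn ho smm hr)) hq,
      dirDeriv_sub (diffAt_of_smoothOn ho (smoothOn_dirDeriv ho sAB) hq)
        (diffAt_of_smoothOn ho (smoothOn_dirDeriv ho smm) hq),
      dirDeriv_dirDeriv_mul ho sA sB hq, dirDeriv_dirDeriv_mul ho sm sm hq, m0]
    ring
  have d0 : detChart g₁ g₂ ε Ψ c (0, y) = A (0, y) * B (0, y) := by
    rw [eD]; simp only [m0]; ring
  rw [d0, d1, d2, Fin.sum_univ_two]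
  generalize dirDeriv (0, basisVec 0) (accelChart g₁ g₂ ε Ψ c (basisVec 0)) (0, y) = t0 at *
  generalize dirDeriv (0, basisVec 1) (accelChart g₁ g₂ ε Ψ c (basisVec 1)) (0, y) = t1 at *
  change _ ≤ t0 / A (0, y) + t1 / B (0, y)
  generalize dirDeriv (1, 0) (dirDeriv (1, 0) A) (0, y) = A2 at *
  generalize dirDeriv (1, 0) (dirDeriv (1, 0) B) (0, y) = B2 at *
  generalize dirDeriv (1, 0) A (0, y) = A1 at *
  generalize dirDeriv (1, 0) B (0, y) = B1 at *
  generalize dirDeriv (1, 0) m (0, y) = m1 at *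
  generalize A (0, y) = A0 at *
  generalize B (0, y) = B0 at *
  have hA : A0 ≠ 0 := fun h ↦ by simp [h] at p0
  have hB : B0 ≠ 0 := fun h ↦ by simp [h] at p1
  have hs : s ≠ 0 := fun h ↦ by simp [h] at p0
  have hAB : 0 < A0 * B0 := by
    have h1 : 0 < (s * A0) * (s * B0) := mul_pos p0 p1
    have h2 : (s * A0) * (s * B0) = s ^ 2 * (A0 * B0) := by ring
    rw [h2] at h1
    exact (pos_iff_pos_of_mul_pos h1).1 (by positivity)
  have q0 : (1 / 2 * A2 - t0) / A0 ≤ 0 := by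
    rw [← mul_div_mul_left _ _ hs]
    exact div_nonpos_of_nonpos_of_nonneg n0 p0.le
  have q1 : (1 / 2 * B2 - t1) / B0 ≤ 0 := by
    rw [← mul_div_mul_left _ _ hs]
    exact div_nonpos_of_nonpos_of_nonneg n1 p1.le
  -- The cross term A1 B1 of the second derivative and the squared logarithmic derivative combine to
  -- minus a square. The off-diagonal term is also minus a square, divided by A0 B0 > 0.
  have key : (A2 * B0 + 2 * (A1 * B1) + A0 * B2 - 2 * m1 ^ 2) / (A0 * B0) / 2
      - ((A1 * B0 + A0 * B1) / (A0 * B0)) ^ 2 / 4 =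
      (1 / 2 * A2 - t0) / A0 + (1 / 2 * B2 - t1) / B0 + (t0 / A0 + t1 / B0)
      - m1 ^ 2 / (A0 * B0) - (A1 / A0 - B1 / B0) ^ 2 / 4 := by
    field_simp
    ring
  rw [key]
  have r1 : 0 ≤ m1 ^ 2 / (A0 * B0) := by positivity
  have r2 : 0 ≤ (A1 / A0 - B1 / B0) ^ 2 / 4 := by positivity
  linarith

end

end Pointwise

/-! ### The area measure and its independence of charts -/

section AreaMeasure

open MeasureTheory

variable {M₁ : Type*} [TopologicalSpace M₁] [ChartedSpace Plane M₁] [IsManifold (𝓡 2) ∞ M₁]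
  {M₂ : Type*} [TopologicalSpace M₂] [ChartedSpace Plane M₂] [IsManifold (𝓡 2) ∞ M₂]
  {S : Type*} [TopologicalSpace S] [ChartedSpace Plane S]
  (g₁ : LorentzMetric M₁) (g₂ : LorentzMetric M₂) (ε : ℝ)

/-- The density of the area element in a chart. -/
def areaDensity (Φ : S → M₁ × M₂) (c : OpenPartialHomeomorph S Plane) (y : Plane) : ENNReal :=
  ENNReal.ofReal (√|(inducedCoord g₁ g₂ ε Φ c y).det|)

variable {Φ : S → M₁ × M₂} {c : OpenPartialHomeomorph S Plane}

theorem smoothOn_inducedCoord (hc : c ∈ IsManifold.maximalAtlas (𝓡 2) ∞ S)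
    (h₁ : ContMDiff (𝓡 2) (𝓡 2) ∞ fun p ↦ (Φ p).1)
    (h₂ : ContMDiff (𝓡 2) (𝓡 2) ∞ fun p ↦ (Φ p).2) (a b : Fin 2) :
    ContDiffOn ℝ ∞ (fun y ↦ inducedCoord g₁ g₂ ε Φ c y a b) c.target := by
  have hs := contMDiffOn_symm_of_mem_maximalAtlas hc
  exact (smoothOn_pullForm g₁ c.open_target (ξ := basisVec a) (η := basisVec b)
    (h₁.comp_contMDiffOn hs)).add (contDiffOn_const.mul
      (smoothOn_pullForm g₂ c.open_target (ξ := basisVec a) (η := basisVec b)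
        (h₂.comp_contMDiffOn hs)))

theorem det_inducedCoord_eq {y : Plane} (hc : c ∈ IsManifold.maximalAtlas (𝓡 2) ∞ S)
    (h₁ : ContMDiff (𝓡 2) (𝓡 2) ∞ fun p ↦ (Φ p).1)
    (h₂ : ContMDiff (𝓡 2) (𝓡 2) ∞ fun p ↦ (Φ p).2) (hy : y ∈ c.target) :
    (inducedCoord g₁ g₂ ε Φ c y).det =
      (mfderiv (𝓡 2) (𝓡 2) c.symm y : Plane →L[ℝ] Plane).det ^ 2 *
        (gram (inducedForm g₁ g₂ ε Φ (c.symm y))).det :=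
  (congrArg Matrix.det (inducedCoord_eq g₁ g₂ ε hc h₁ h₂ hy)).trans (det_gram_comp _ _)

theorem continuousOn_sqrt_det (hc : c ∈ IsManifold.maximalAtlas (𝓡 2) ∞ S)
    (h₁ : ContMDiff (𝓡 2) (𝓡 2) ∞ fun p ↦ (Φ p).1)
    (h₂ : ContMDiff (𝓡 2) (𝓡 2) ∞ fun p ↦ (Φ p).2) :
    ContinuousOn (fun y ↦ √|(inducedCoord g₁ g₂ ε Φ c y).det|) c.target := by
  have h : ∀ a b, ContinuousOn (fun y ↦ inducedCoord g₁ g₂ ε Φ c y a b) c.target := fun a b ↦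
    (smoothOn_inducedCoord g₁ g₂ ε hc h₁ h₂ a b).continuousOn
  simp only [Matrix.det_fin_two]
  exact (((h 0 0).mul (h 1 1)).sub ((h 0 1).mul (h 1 0))).abs.sqrt

theorem continuousOn_areaDensity (hc : c ∈ IsManifold.maximalAtlas (𝓡 2) ∞ S)
    (h₁ : ContMDiff (𝓡 2) (𝓡 2) ∞ fun p ↦ (Φ p).1)
    (h₂ : ContMDiff (𝓡 2) (𝓡 2) ∞ fun p ↦ (Φ p).2) :
    ContinuousOn (areaDensity g₁ g₂ ε Φ c) c.target :=
  ENNReal.continuous_ofReal.comp_continuousOn (continuousOn_sqrt_det g₁ g₂ ε hc h₁ h₂)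

theorem mfderiv_symm_comp {c' : OpenPartialHomeomorph S Plane}
    (hc : c ∈ IsManifold.maximalAtlas (𝓡 2) ∞ S) (hc' : c' ∈ IsManifold.maximalAtlas (𝓡 2) ∞ S)
    {y : Plane} (hy : y ∈ c.target) (hy' : c.symm y ∈ c'.source) :
    DifferentiableAt ℝ (fun z ↦ c' (c.symm z)) y ∧
    (mfderiv (𝓡 2) (𝓡 2) c.symm y : Plane →L[ℝ] Plane) =
      (mfderiv (𝓡 2) (𝓡 2) c'.symm (c' (c.symm y)) : Plane →L[ℝ] Plane).comp
        (fderiv ℝ (fun z ↦ c' (c.symm z)) y) := by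
  have hU : IsOpen (c.target ∩ c.symm ⁻¹' c'.source) :=
    c.continuousOn_symm.isOpen_inter_preimage c.open_target c'.open_source
  have hs := (contMDiffOn_symm_of_mem_maximalAtlas hc).mono
    (inter_subset_left : c.target ∩ c.symm ⁻¹' c'.source ⊆ _)
  refine ⟨((smoothOn_chart_comp hc' hs fun z hz ↦ hz.2).contDiffAt
    (hU.mem_nhds ⟨hy, hy'⟩)).differentiableAt (by simp), ?_⟩
  ext1 ξ
  exact mfderiv_eq_of_chart hc' hU hs (fun z hz ↦ hz.2) ⟨hy, hy'⟩

theorem areaDensity_comp {c' : OpenPartialHomeomorph S Plane}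
    (hc : c ∈ IsManifold.maximalAtlas (𝓡 2) ∞ S) (hc' : c' ∈ IsManifold.maximalAtlas (𝓡 2) ∞ S)
    (h₁ : ContMDiff (𝓡 2) (𝓡 2) ∞ fun p ↦ (Φ p).1)
    (h₂ : ContMDiff (𝓡 2) (𝓡 2) ∞ fun p ↦ (Φ p).2)
    {y : Plane} (hy : y ∈ c.target) (hy' : c.symm y ∈ c'.source) :
    areaDensity g₁ g₂ ε Φ c y = ENNReal.ofReal |(fderiv ℝ (fun z ↦ c' (c.symm z)) y).det| *
      areaDensity g₁ g₂ ε Φ c' (c' (c.symm y)) := by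
  have hT := (mfderiv_symm_comp hc hc' hy hy').2
  have hdet : (mfderiv (𝓡 2) (𝓡 2) c.symm y : Plane →L[ℝ] Plane).det =
      (mfderiv (𝓡 2) (𝓡 2) c'.symm (c' (c.symm y)) : Plane →L[ℝ] Plane).det *
        (fderiv ℝ (fun z ↦ c' (c.symm z)) y).det := by
    rw [hT]; exact LinearMap.det_comp _ _
  rw [areaDensity, areaDensity, ← ENNReal.ofReal_mul (abs_nonneg _),
    det_inducedCoord_eq g₁ g₂ ε hc h₁ h₂ hy,
    det_inducedCoord_eq g₁ g₂ ε hc' h₁ h₂ (c'.map_source hy'), hdet, c'.left_inv hy']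
  congr 1
  rw [abs_mul, abs_mul, Real.sqrt_mul (abs_nonneg _), Real.sqrt_mul (abs_nonneg _), abs_pow,
    abs_pow, Real.sqrt_sq (abs_nonneg _), Real.sqrt_sq (abs_nonneg _), abs_mul]
  ring

variable [MeasurableSpace S] [BorelSpace S]

omit [ChartedSpace Plane S] in
theorem measurableSet_chart_preimage (c : OpenPartialHomeomorph S Plane) {A : Set S}
    (hA : MeasurableSet A) : MeasurableSet (c.target ∩ c.symm ⁻¹' A) := by
  have h := (c.continuousOn_symm.domRestrict).measurable hA
  have := c.open_target.measurableSet.subtype_image h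
  convert this using 1
  ext y
  simp [and_comm]

omit [ChartedSpace Plane S] in
theorem aemeasurable_chart_symm (c : OpenPartialHomeomorph S Plane) (ρ : Plane → ENNReal)
    {T : Set Plane} (hT : T ⊆ c.target) :
    AEMeasurable c.symm ((volume.restrict T).withDensity ρ) := by
  have h1 : AEMeasurable c.symm (volume.restrict c.target) :=
    c.continuousOn_symm.aemeasurable c.open_target.measurableSet
  exact (h1.mono_measure (Measure.restrict_mono hT le_rfl)).mono_ac
    (withDensity_absolutelyContinuous _ _)

omit [ChartedSpace Plane S] in
theorem map_chart_symm_apply (c : OpenPartialHomeomorph S Plane) (ρ : Plane → ENNReal)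
    {P A : Set S} (hP : MeasurableSet P) (hA : MeasurableSet A) :
    (((volume.restrict (c.target ∩ c.symm ⁻¹' P)).withDensity ρ).map c.symm) A =
      ∫⁻ y in c.target ∩ c.symm ⁻¹' (A ∩ P), ρ y := by
  rw [Measure.map_apply_of_aemeasurable (aemeasurable_chart_symm c ρ inter_subset_left) hA,
    withDensity_apply', Measure.restrict_restrict' (measurableSet_chart_preimage c hP)]
  congr 2
  ext y
  simp only [mem_inter_iff, mem_preimage]
  tauto

variable [SecondCountableTopology S] [Nonempty S]

/-- The pieces of the surface that are used in the definition of the volume. -/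
def chartPiece (S : Type*) [TopologicalSpace S] [ChartedSpace Plane S]
    [SecondCountableTopology S] [Nonempty S] (n : ℕ) : Set S :=
  disjointed (fun m ↦ (chartSeq S m).source) n

omit [MeasurableSpace S] [BorelSpace S] in
theorem iUnion_chartPiece : ⋃ n, chartPiece S n = univ :=
  (iUnion_disjointed (f := fun m ↦ (chartSeq S m).source)).trans
    (exists_chartSeq S).choose_spec

omit [MeasurableSpace S] [BorelSpace S] in
theorem chartPiece_subset (n : ℕ) : chartPiece S n ⊆ (chartSeq S n).source :=
  disjointed_subset _ _

theorem measurableSet_chartPiece (n : ℕ) : MeasurableSet (chartPiece S n) :=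
  MeasurableSet.disjointed (fun m ↦ (chartSeq S m).open_source.measurableSet) n

omit [MeasurableSpace S] [BorelSpace S] in
theorem chartSeq_mem_maximalAtlas [IsManifold (𝓡 2) ∞ S] (n : ℕ) :
    chartSeq S n ∈ IsManifold.maximalAtlas (𝓡 2) ∞ S := IsManifold.chart_mem_maximalAtlas _

/-- The area measure of `Φ^* G^ε`. -/
def areaMeasure (Φ : S → M₁ × M₂) : Measure S :=
  Measure.sum fun n ↦ ((volume.restrict ((chartSeq S n).target ∩
    (chartSeq S n).symm ⁻¹' chartPiece S n)).withDensity
      (areaDensity g₁ g₂ ε Φ (chartSeq S n))).map (chartSeq S n).symm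

theorem areaMeasure_apply {A : Set S} (hA : MeasurableSet A) :
    areaMeasure g₁ g₂ ε Φ A = ∑' n, ∫⁻ y in (chartSeq S n).target ∩
      (chartSeq S n).symm ⁻¹' (A ∩ chartPiece S n), areaDensity g₁ g₂ ε Φ (chartSeq S n) y := by
  rw [areaMeasure, Measure.sum_apply _ hA]
  exact tsum_congr fun n ↦ map_chart_symm_apply _ _ (measurableSet_chartPiece n) hA

theorem volumeOn_eq {A : Set S} (hA : MeasurableSet A) :
    volumeOn g₁ g₂ ε Φ A = (areaMeasure g₁ g₂ ε Φ A).toReal := by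
  rw [areaMeasure_apply g₁ g₂ ε hA]; rfl

variable [IsManifold (𝓡 2) ∞ S]

/-- On each piece, change variables by the transition map; the density picks up exactly the absolute
Jacobian. The cut into pieces that defines the volume is thus immaterial, and product charts may be
used for computing. -/
theorem areaMeasure_apply_of_subset (hc : c ∈ IsManifold.maximalAtlas (𝓡 2) ∞ S)
    (h₁ : ContMDiff (𝓡 2) (𝓡 2) ∞ fun p ↦ (Φ p).1)
    (h₂ : ContMDiff (𝓡 2) (𝓡 2) ∞ fun p ↦ (Φ p).2) {A : Set S} (hA : MeasurableSet A)
    (hAc : A ⊆ c.source) :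
    areaMeasure g₁ g₂ ε Φ A = ∫⁻ y in c.target ∩ c.symm ⁻¹' A, areaDensity g₁ g₂ ε Φ c y := by
  rw [areaMeasure_apply g₁ g₂ ε hA]
  have hB : ∀ n, MeasurableSet (c.target ∩ c.symm ⁻¹' (A ∩ chartPiece S n)) := fun n ↦
    measurableSet_chart_preimage c (hA.inter (measurableSet_chartPiece n))
  have hun : c.target ∩ c.symm ⁻¹' A = ⋃ n, c.target ∩ c.symm ⁻¹' (A ∩ chartPiece S n) := by
    rw [← inter_iUnion, ← preimage_iUnion, ← inter_iUnion, iUnion_chartPiece, inter_univ]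
  have hdis : Pairwise (Function.onFun Disjoint
      fun n ↦ c.target ∩ c.symm ⁻¹' (A ∩ chartPiece S n)) := by
    intro n m hnm
    refine disjoint_left.2 fun y hy hy' ↦ ?_
    exact disjoint_left.1 (disjoint_disjointed (fun m ↦ (chartSeq S m).source) hnm)
      hy.2.2 hy'.2.2
  rw [hun, lintegral_iUnion hB hdis]
  refine tsum_congr fun n ↦ ?_
  set e := chartSeq S n
  have he : e ∈ IsManifold.maximalAtlas (𝓡 2) ∞ S := chartSeq_mem_maximalAtlas n
  have himg : e.target ∩ e.symm ⁻¹' (A ∩ chartPiece S n) =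
      (fun z ↦ e (c.symm z)) '' (c.target ∩ c.symm ⁻¹' (A ∩ chartPiece S n)) := by
    ext z
    constructor
    · rintro ⟨hz, hzA, hzP⟩
      refine ⟨c (e.symm z), ⟨c.map_source (hAc hzA), ?_⟩, ?_⟩
      · rw [mem_preimage, c.left_inv (hAc hzA)]; exact ⟨hzA, hzP⟩
      · simp only [c.left_inv (hAc hzA), e.right_inv hz]
    · rintro ⟨y, ⟨hy, hyA, hyP⟩, rfl⟩
      have hye : c.symm y ∈ e.source := chartPiece_subset n hyP
      refine ⟨e.map_source hye, ?_⟩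
      rw [mem_preimage, e.left_inv hye]; exact ⟨hyA, hyP⟩
  have hinj : InjOn (fun z ↦ e (c.symm z)) (c.target ∩ c.symm ⁻¹' (A ∩ chartPiece S n)) := by
    rintro y ⟨hy, hyA, hyP⟩ y' ⟨hy', hyA', hyP'⟩ h
    exact c.symm.injOn hy hy' (e.injOn (chartPiece_subset n hyP) (chartPiece_subset n hyP') h)
  rw [himg, lintegral_image_eq_lintegral_abs_det_fderiv_mul volume (hB n)
    (fun y hy ↦ (mfderiv_symm_comp hc he hy.1
      (chartPiece_subset n hy.2.2)).1.hasFDerivAt.hasFDerivWithinAt) hinj]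
  refine setLIntegral_congr_fun (hB n) fun y hy ↦ ?_
  exact (areaDensity_comp g₁ g₂ ε hc he h₁ h₂ hy.1 (chartPiece_subset n hy.2.2)).symm

theorem areaMeasure_restrict (hc : c ∈ IsManifold.maximalAtlas (𝓡 2) ∞ S)
    (h₁ : ContMDiff (𝓡 2) (𝓡 2) ∞ fun p ↦ (Φ p).1)
    (h₂ : ContMDiff (𝓡 2) (𝓡 2) ∞ fun p ↦ (Φ p).2) :
    (areaMeasure g₁ g₂ ε Φ).restrict c.source =
      ((volume.restrict c.target).withDensity (areaDensity g₁ g₂ ε Φ c)).map c.symm := by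
  ext A hA
  have hs := c.open_source.measurableSet
  rw [Measure.restrict_apply hA, areaMeasure_apply_of_subset g₁ g₂ ε hc h₁ h₂ (hA.inter hs)
    inter_subset_right, ← map_chart_symm_apply c _ hs hA]
  congr 3
  rw [inter_eq_left.2]
  exact fun y hy ↦ c.map_target hy

/-- The density is continuous in a chart, hence bounded on a small ball around each point. -/
theorem isLocallyFiniteMeasure_areaMeasure (h₁ : ContMDiff (𝓡 2) (𝓡 2) ∞ fun p ↦ (Φ p).1)
    (h₂ : ContMDiff (𝓡 2) (𝓡 2) ∞ fun p ↦ (Φ p).2) :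
    IsLocallyFiniteMeasure (areaMeasure g₁ g₂ ε Φ) := by
  refine ⟨fun p ↦ ?_⟩
  set c := chartAt Plane p
  have hc : c ∈ IsManifold.maximalAtlas (𝓡 2) ∞ S := IsManifold.chart_mem_maximalAtlas _
  have hp : p ∈ c.source := mem_chart_source _ _
  have hcont := (continuousOn_sqrt_det g₁ g₂ ε hc h₁ h₂).continuousAt
    (c.open_target.mem_nhds (c.map_source hp))
  obtain ⟨C, hC⟩ : ∃ C : ℝ, √|(inducedCoord g₁ g₂ ε Φ c (c p)).det| < C := exists_gt _
  obtain ⟨r, hr, hrC⟩ := Metric.eventually_nhds_iff_ball.1 (hcont.eventually_lt_const hC)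
  have hopen : IsOpen (c.source ∩ c ⁻¹' Metric.ball (c p) r) :=
    c.continuousOn.isOpen_inter_preimage c.open_source Metric.isOpen_ball
  refine ⟨_, hopen.mem_nhds ⟨hp, Metric.mem_ball_self hr⟩, ?_⟩
  rw [areaMeasure_apply_of_subset g₁ g₂ ε hc h₁ h₂ hopen.measurableSet inter_subset_left]
  have hsub : c.target ∩ c.symm ⁻¹' (c.source ∩ c ⁻¹' Metric.ball (c p) r) ⊆
      Metric.ball (c p) r := by
    rintro y ⟨hy, -, hy'⟩
    rwa [mem_preimage, c.right_inv hy] at hy'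
  calc _ ≤ ∫⁻ y in c.target ∩ c.symm ⁻¹' (c.source ∩ c ⁻¹' Metric.ball (c p) r),
        ENNReal.ofReal C := by
        refine setLIntegral_mono' (measurableSet_chart_preimage c hopen.measurableSet) ?_
        exact fun y hy ↦ ENNReal.ofReal_le_ofReal (hrC y (hsub hy)).le
    _ < ⊤ := by
        rw [setLIntegral_const]
        exact ENNReal.mul_lt_top ENNReal.ofReal_lt_top
          ((measure_mono hsub).trans_lt measure_ball_lt_top)

theorem integral_areaMeasure (hc : c ∈ IsManifold.maximalAtlas (𝓡 2) ∞ S)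
    (h₁ : ContMDiff (𝓡 2) (𝓡 2) ∞ fun p ↦ (Φ p).1)
    (h₂ : ContMDiff (𝓡 2) (𝓡 2) ∞ fun p ↦ (Φ p).2) {f : S → ℝ} (hf : Continuous f)
    (hfc : ∀ p ∉ c.source, f p = 0) :
    ∫ p, f p ∂(areaMeasure g₁ g₂ ε Φ) =
      ∫ y in c.target, √|(inducedCoord g₁ g₂ ε Φ c y).det| * f (c.symm y) := by
  rw [← setIntegral_eq_integral_of_forall_compl_eq_zero hfc, areaMeasure_restrict g₁ g₂ ε hc h₁ h₂,
    integral_map (aemeasurable_chart_symm c _ le_rfl) hf.aestronglyMeasurable,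
    integral_withDensity_eq_integral_toReal_smul₀
      ((continuousOn_areaDensity g₁ g₂ ε hc h₁ h₂).aemeasurable c.open_target.measurableSet)
      (ae_of_all _ fun y ↦ ENNReal.ofReal_lt_top)]
  refine integral_congr_ae (ae_of_all _ fun y ↦ ?_)
  simp only [areaDensity, smul_eq_mul]
  rw [ENNReal.toReal_ofReal (Real.sqrt_nonneg _)]

/-- This refers the members of a family to one fixed measure, so that the dependence on the
parameter sits in the integrand alone. -/
theorem areaMeasure_eq_withDensity (h₁ : ContMDiff (𝓡 2) (𝓡 2) ∞ fun p ↦ (Φ p).1)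
    (h₂ : ContMDiff (𝓡 2) (𝓡 2) ∞ fun p ↦ (Φ p).2) {Φ' : S → M₁ × M₂} {f : S → ℝ}
    (hf : Continuous f)
    (hd : ∀ n, ∀ y ∈ (chartSeq S n).target, √|(inducedCoord g₁ g₂ ε Φ' (chartSeq S n) y).det| =
      √|(inducedCoord g₁ g₂ ε Φ (chartSeq S n) y).det| * f ((chartSeq S n).symm y))
    {A : Set S} (hA : MeasurableSet A) :
    areaMeasure g₁ g₂ ε Φ' A =
      ∫⁻ p in A, ENNReal.ofReal (f p) ∂(areaMeasure g₁ g₂ ε Φ) := by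
  have hfm : Measurable fun p ↦ ENNReal.ofReal (f p) := hf.measurable.ennreal_ofReal
  rw [areaMeasure_apply g₁ g₂ ε hA, ← withDensity_apply _ hA, areaMeasure, withDensity_sum,
    Measure.sum_apply _ hA]
  refine tsum_congr fun n ↦ ?_
  set e := chartSeq S n
  have he : e ∈ IsManifold.maximalAtlas (𝓡 2) ∞ S := chartSeq_mem_maximalAtlas n
  have hsub : e.target ∩ e.symm ⁻¹' chartPiece S n ⊆ e.target := inter_subset_left
  have hTm := measurableSet_chart_preimage e (measurableSet_chartPiece n)
  have hsymm := aemeasurable_chart_symm e (areaDensity g₁ g₂ ε Φ e) hsub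
  have hρ : AEMeasurable (areaDensity g₁ g₂ ε Φ e)
      (volume.restrict (e.target ∩ e.symm ⁻¹' chartPiece S n)) :=
    ((continuousOn_areaDensity g₁ g₂ ε he h₁ h₂).aemeasurable
      e.open_target.measurableSet).mono_measure (Measure.restrict_mono hsub le_rfl)
  rw [withDensity_apply _ hA, ← lintegral_indicator hA,
    lintegral_map' (hfm.indicator hA).aemeasurable hsymm,
    lintegral_withDensity_eq_lintegral_mul_non_measurable₀ _ hρ
      (ae_of_all _ fun y ↦ ENNReal.ofReal_lt_top)]
  have hset : e.target ∩ e.symm ⁻¹' (A ∩ chartPiece S n) =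
      (e.target ∩ e.symm ⁻¹' A) ∩ (e.target ∩ e.symm ⁻¹' chartPiece S n) := by
    ext y; simp only [mem_inter_iff, mem_preimage]; tauto
  rw [hset, ← Measure.restrict_restrict (measurableSet_chart_preimage e hA),
    ← lintegral_indicator (measurableSet_chart_preimage e hA)]
  refine setLIntegral_congr_fun hTm fun y hy ↦ ?_
  simp only [Pi.mul_apply]
  by_cases hyA : e.symm y ∈ A
  · rw [indicator_of_mem (show y ∈ e.target ∩ e.symm ⁻¹' A from ⟨hy.1, hyA⟩), indicator_of_mem hyA,
      areaDensity, areaDensity, hd n y hy.1, ENNReal.ofReal_mul (Real.sqrt_nonneg _)]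
  · rw [indicator_of_notMem (fun h ↦ hyA h.2), indicator_of_notMem hyA, mul_zero]

end AreaMeasure

/-! ### Differentiation under the integral over a compact set -/

section ParametricIntegral

open MeasureTheory

variable {X : Type*} [TopologicalSpace X] [MeasurableSpace X] [OpensMeasurableSpace X]
  {μ : Measure X} {K : Set X} {δ : ℝ} {f f₁ f₂ : ℝ → X → ℝ}

omit [MeasurableSpace X] [OpensMeasurableSpace X] in
theorem exists_bound_near (hK : IsCompact K)
    (hf : ContinuousOn (fun z : ℝ × X ↦ f z.1 z.2) (Ioo (-δ) δ ×ˢ K)) {u : ℝ}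
    (hu : u ∈ Ioo (-δ) δ) : ∃ r > 0, Metric.ball u r ⊆ Ioo (-δ) δ ∧
      ∃ C, ∀ t ∈ Metric.ball u r, ∀ x ∈ K, ‖f t x‖ ≤ C := by
  obtain ⟨r, hr, hrs⟩ := Metric.nhds_basis_closedBall.mem_iff.1 (isOpen_Ioo.mem_nhds hu)
  obtain ⟨C, hC⟩ := ((isCompact_closedBall u r).prod hK).exists_bound_of_continuousOn
    (hf.mono (prod_mono hrs le_rfl))
  exact ⟨r, hr, Metric.ball_subset_closedBall.trans hrs, C, fun t ht x hx ↦
    hC (t, x) ⟨Metric.ball_subset_closedBall ht, hx⟩⟩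

theorem aestronglyMeasurable_slice (hKm : MeasurableSet K)
    (hf : ContinuousOn (fun z : ℝ × X ↦ f z.1 z.2) (Ioo (-δ) δ ×ˢ K)) {u : ℝ}
    (hu : u ∈ Ioo (-δ) δ) : AEStronglyMeasurable (f u) (μ.restrict K) := by
  have : ContinuousOn (f u) K :=
    hf.comp (f := fun x ↦ (u, x)) (by fun_prop) fun x hx ↦ ⟨hu, hx⟩
  exact this.aestronglyMeasurable hKm

theorem hasDerivAt_setIntegral (hK : IsCompact K) (hKm : MeasurableSet K) (hμ : μ K ≠ ⊤)
    (hf : ContinuousOn (fun z : ℝ × X ↦ f z.1 z.2) (Ioo (-δ) δ ×ˢ K))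
    (hf₁ : ContinuousOn (fun z : ℝ × X ↦ f₁ z.1 z.2) (Ioo (-δ) δ ×ˢ K))
    (hd : ∀ u ∈ Ioo (-δ) δ, ∀ x ∈ K, HasDerivAt (fun t ↦ f t x) (f₁ u x) u) {u : ℝ}
    (hu : u ∈ Ioo (-δ) δ) :
    HasDerivAt (fun t ↦ ∫ x in K, f t x ∂μ) (∫ x in K, f₁ u x ∂μ) u := by
  obtain ⟨r, hr, hrs, C, hC⟩ := exists_bound_near hK hf₁ hu
  obtain ⟨r', hr', hrs', C', hC'⟩ := exists_bound_near hK hf hu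
  have hfin : IsFiniteMeasure (μ.restrict K) := ⟨by simpa using hμ.lt_top⟩
  refine (hasDerivAt_integral_of_dominated_loc_of_deriv_le (bound := fun _ ↦ C)
    (Metric.ball_mem_nhds u hr) ?_ ?_ ?_ ?_ (integrable_const C) ?_).2
  · filter_upwards [isOpen_Ioo.mem_nhds hu] with t ht using aestronglyMeasurable_slice hKm hf ht
  · exact Integrable.of_bound (aestronglyMeasurable_slice hKm hf hu) C'
      ((ae_restrict_iff' hKm).2 (ae_of_all _ fun x hx ↦ hC' u (Metric.mem_ball_self hr') x hx))
  · exact aestronglyMeasurable_slice hKm hf₁ hu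
  · exact (ae_restrict_iff' hKm).2 (ae_of_all _ fun x hx t ht ↦ hC t ht x hx)
  · exact (ae_restrict_iff' hKm).2 (ae_of_all _ fun x hx t ht ↦ hd t (hrs ht) x hx)

theorem continuousOn_setIntegral (hK : IsCompact K) (hKm : MeasurableSet K) (hμ : μ K ≠ ⊤)
    (hf : ContinuousOn (fun z : ℝ × X ↦ f z.1 z.2) (Ioo (-δ) δ ×ˢ K)) :
    ContinuousOn (fun t ↦ ∫ x in K, f t x ∂μ) (Ioo (-δ) δ) := by
  intro u hu
  obtain ⟨r, hr, hrs, C, hC⟩ := exists_bound_near hK hf hu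
  have hfin : IsFiniteMeasure (μ.restrict K) := ⟨by simpa using hμ.lt_top⟩
  refine (continuousAt_of_dominated (bound := fun _ ↦ C) ?_ ?_ (integrable_const C)
    ?_).continuousWithinAt
  · filter_upwards [isOpen_Ioo.mem_nhds hu] with t ht using aestronglyMeasurable_slice hKm hf ht
  · filter_upwards [Metric.ball_mem_nhds u hr] with t ht
    exact (ae_restrict_iff' hKm).2 (ae_of_all _ fun x hx ↦ hC t ht x hx)
  · refine (ae_restrict_iff' hKm).2 (ae_of_all _ fun x hx ↦ ?_)
    have : ContinuousOn (fun t ↦ f t x) (Ioo (-δ) δ) :=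
      hf.comp (f := fun t ↦ (t, x)) (by fun_prop) fun t ht ↦ ⟨ht, hx⟩
    exact this.continuousAt (isOpen_Ioo.mem_nhds hu)

/-- Differentiation under the integral sign, twice. -/
theorem contDiffAt_two_setIntegral (hδ : 0 < δ) (hK : IsCompact K) (hKm : MeasurableSet K)
    (hμ : μ K ≠ ⊤) (hf : ContinuousOn (fun z : ℝ × X ↦ f z.1 z.2) (Ioo (-δ) δ ×ˢ K))
    (hf₁ : ContinuousOn (fun z : ℝ × X ↦ f₁ z.1 z.2) (Ioo (-δ) δ ×ˢ K))
    (hf₂ : ContinuousOn (fun z : ℝ × X ↦ f₂ z.1 z.2) (Ioo (-δ) δ ×ˢ K))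
    (hd : ∀ u ∈ Ioo (-δ) δ, ∀ x ∈ K, HasDerivAt (fun t ↦ f t x) (f₁ u x) u)
    (hd₁ : ∀ u ∈ Ioo (-δ) δ, ∀ x ∈ K, HasDerivAt (fun t ↦ f₁ t x) (f₂ u x) u) :
    ContDiffAt ℝ 2 (fun t ↦ ∫ x in K, f t x ∂μ) 0 ∧
      iteratedDeriv 2 (fun t ↦ ∫ x in K, f t x ∂μ) 0 = ∫ x in K, f₂ 0 x ∂μ := by
  have h0 : (0 : ℝ) ∈ Ioo (-δ) δ := ⟨by linarith, hδ⟩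
  have D := fun u hu ↦ hasDerivAt_setIntegral (u := u) hK hKm hμ hf hf₁ hd hu
  have D₁ := fun u hu ↦ hasDerivAt_setIntegral (u := u) hK hKm hμ hf₁ hf₂ hd₁ hu
  have e : EqOn (deriv fun t ↦ ∫ x in K, f t x ∂μ) (fun t ↦ ∫ x in K, f₁ t x ∂μ) (Ioo (-δ) δ) :=
    fun u hu ↦ (D u hu).deriv
  have e₁ : EqOn (deriv fun t ↦ ∫ x in K, f₁ t x ∂μ) (fun t ↦ ∫ x in K, f₂ t x ∂μ) (Ioo (-δ) δ) :=
    fun u hu ↦ (D₁ u hu).deriv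
  constructor
  · have c1 : ContDiffOn ℝ 1 (fun t ↦ ∫ x in K, f₁ t x ∂μ) (Ioo (-δ) δ) := by
      rw [show (1 : WithTop ℕ∞) = 0 + 1 by norm_num, contDiffOn_succ_iff_deriv_of_isOpen isOpen_Ioo]
      refine ⟨fun u hu ↦ (D₁ u hu).differentiableAt.differentiableWithinAt, by simp, ?_⟩
      rw [contDiffOn_zero]
      exact (continuousOn_setIntegral hK hKm hμ hf₂).congr e₁
    have c2 : ContDiffOn ℝ 2 (fun t ↦ ∫ x in K, f t x ∂μ) (Ioo (-δ) δ) := by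
      rw [show (2 : WithTop ℕ∞) = 1 + 1 by norm_num, contDiffOn_succ_iff_deriv_of_isOpen isOpen_Ioo]
      exact ⟨fun u hu ↦ (D u hu).differentiableAt.differentiableWithinAt, by simp, c1.congr e⟩
    exact c2.contDiffAt (isOpen_Ioo.mem_nhds h0)
  · rw [iteratedDeriv_succ, iteratedDeriv_one]
    have : deriv (fun t ↦ ∫ x in K, f t x ∂μ) =ᶠ[𝓝 0] fun t ↦ ∫ x in K, f₁ t x ∂μ := by
      filter_upwards [isOpen_Ioo.mem_nhds h0] with t ht using e ht
    rw [this.deriv_eq]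
    exact e₁ h0

end ParametricIntegral

/-! ### Families of functions that are smooth in charts -/

section ChartSmooth

variable {S : Type*} [TopologicalSpace S] [ChartedSpace Plane S]

/-- A family of functions on the surface that is smooth in all charts. -/
def IsChartSmooth (δ : ℝ) (F : ℝ → S → ℝ) : Prop :=
  ∀ c ∈ IsManifold.maximalAtlas (𝓡 2) ∞ S,
    ContDiffOn ℝ ∞ (fun q : ℝ × Plane ↦ F q.1 (c.symm q.2)) (Ioo (-δ) δ ×ˢ c.target)

variable {δ : ℝ} {F : ℝ → S → ℝ} {c : OpenPartialHomeomorph S Plane}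

theorem IsChartSmooth.hasDerivAt_chart (hF : IsChartSmooth δ F)
    (hc : c ∈ IsManifold.maximalAtlas (𝓡 2) ∞ S) {u : ℝ} (hu : u ∈ Ioo (-δ) δ) {y : Plane}
    (hy : y ∈ c.target) :
    HasDerivAt (fun t ↦ F t (c.symm y))
      (dirDeriv (1, 0) (fun q : ℝ × Plane ↦ F q.1 (c.symm q.2)) (u, y)) u :=
  hasDerivAt_fst (F := fun q : ℝ × Plane ↦ F q.1 (c.symm q.2))
    (diffAt_of_smoothOn (isOpen_famDomain δ c) (hF c hc) ⟨hu, hy⟩)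

theorem IsChartSmooth.deriv (hF : IsChartSmooth δ F) :
    IsChartSmooth δ fun u p ↦ deriv (fun t ↦ F t p) u := fun c hc ↦
  (smoothOn_dirDeriv (isOpen_famDomain δ c) (hF c hc)).congr fun _ hq ↦
    (hF.hasDerivAt_chart hc hq.1 hq.2).deriv

variable [IsManifold (𝓡 2) ∞ S]

theorem IsChartSmooth.hasDerivAt (hF : IsChartSmooth δ F) {u : ℝ} (hu : u ∈ Ioo (-δ) δ) (p : S) :
    HasDerivAt (fun t ↦ F t p) (_root_.deriv (fun t ↦ F t p) u) u := by
  have h := hF.hasDerivAt_chart (IsManifold.chart_mem_maximalAtlas p) hu (mem_chart_target Plane p)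
  rw [(chartAt Plane p).left_inv (mem_chart_source _ p)] at h
  exact h.differentiableAt.hasDerivAt

theorem IsChartSmooth.continuousOn (hF : IsChartSmooth δ F) :
    ContinuousOn (fun z : ℝ × S ↦ F z.1 z.2) (Ioo (-δ) δ ×ˢ univ) := by
  rintro ⟨u, p⟩ ⟨hu, -⟩
  set c := chartAt Plane p
  have hc : c ∈ IsManifold.maximalAtlas (𝓡 2) ∞ S := IsManifold.chart_mem_maximalAtlas _
  have hp : p ∈ c.source := mem_chart_source _ _
  have h1 : ContinuousAt (fun q : ℝ × Plane ↦ F q.1 (c.symm q.2)) (u, c p) :=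
    (hF c hc).continuousOn.continuousAt
      ((isOpen_famDomain δ c).mem_nhds ⟨hu, c.map_source hp⟩)
  have h2 : ContinuousAt (fun z : ℝ × S ↦ (z.1, c z.2)) (u, p) :=
    continuousAt_fst.prodMk ((c.continuousAt hp).comp continuousAt_snd)
  have h3 := ContinuousAt.comp (f := fun z : ℝ × S ↦ (z.1, c z.2)) (x := (u, p)) h1 h2
  refine (h3.congr ?_).continuousWithinAt
  have : ∀ᶠ z : ℝ × S in 𝓝 (u, p), z.2 ∈ c.source :=
    continuousAt_snd.eventually_mem (c.open_source.mem_nhds hp)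
  filter_upwards [this] with z hz
  simp only [Function.comp, c.left_inv hz]

theorem IsChartSmooth.continuous_slice (hF : IsChartSmooth δ F) {u : ℝ} (hu : u ∈ Ioo (-δ) δ) :
    Continuous (F u) := by
  rw [← continuousOn_univ]
  exact hF.continuousOn.comp (f := fun p ↦ (u, p)) (by fun_prop) fun p _ ↦ ⟨hu, mem_univ _⟩

end ChartSmooth

/-! ### The area density relative to parameter zero -/

section AreaRatio

variable {M₁ : Type*} [TopologicalSpace M₁] [ChartedSpace Plane M₁] [IsManifold (𝓡 2) ∞ M₁]
  {M₂ : Type*} [TopologicalSpace M₂] [ChartedSpace Plane M₂] [IsManifold (𝓡 2) ∞ M₂]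
  {S : Type*} [TopologicalSpace S] [ChartedSpace Plane S]
  (g₁ : LorentzMetric M₁) (g₂ : LorentzMetric M₂) (ε : ℝ)

/-- The determinant of the induced metric of a family, relative to the parameter `0`. -/
def areaRatio (Ψ : ℝ → S → M₁ × M₂) (u : ℝ) (p : S) : ℝ :=
  (gram (inducedForm g₁ g₂ ε (Ψ u) p)).det / (gram (inducedForm g₁ g₂ ε (Ψ 0) p)).det

/-- Every point lies in the domain of a product chart. -/
def HasProductCharts (s : ℝ) (Φ : S → M₁ × M₂) : Prop :=
  ∀ p : S, ∃ c : OpenPartialHomeomorph S Plane, IsProductChart g₁ g₂ ε s Φ c ∧ p ∈ c.source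

variable {g₁ g₂ ε} {δ s : ℝ} {Ψ : ℝ → S → M₁ × M₂} {c : OpenPartialHomeomorph S Plane} {u : ℝ}
  {y : Plane}

omit [ChartedSpace Plane S] in
theorem totalForm_symm (ξ η q : ℝ × Plane) :
    totalForm g₁ g₂ ε Ψ c ξ η q = totalForm g₁ g₂ ε Ψ c η ξ q :=
  congrArg₂ (fun a b : ℝ ↦ a + ε * b) (g₁.symm _ _ _) (g₂.symm _ _ _)

/-- The Jacobian of the chart at a point is the same for all parameters, so it cancels when two
determinants of the family are divided. -/
theorem detChart_eq (hΨ : IsNormalFamily g₁ g₂ ε δ Ψ)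
    (hc : c ∈ IsManifold.maximalAtlas (𝓡 2) ∞ S) (hu : u ∈ Ioo (-δ) δ) (hy : y ∈ c.target) :
    detChart g₁ g₂ ε Ψ c (u, y) = (mfderiv (𝓡 2) (𝓡 2) c.symm y : Plane →L[ℝ] Plane).det ^ 2 *
      (gram (inducedForm g₁ g₂ ε (Ψ u) (c.symm y))).det := by
  let T : Plane →L[ℝ] Plane := mfderiv (𝓡 2) (𝓡 2) c.symm y
  refine Eq.trans ?_ (det_gram_comp (inducedForm g₁ g₂ ε (Ψ u) (c.symm y)) T)
  rw [Matrix.det_fin_two]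
  simp only [Matrix.of_apply]
  have h := totalForm_snd_snd g₁ g₂ ε hc hΨ.smooth₁ hΨ.smooth₂ hu hy
  have e : detChart g₁ g₂ ε Ψ c (u, y) =
      totalForm g₁ g₂ ε Ψ c (0, basisVec 0) (0, basisVec 0) (u, y) *
        totalForm g₁ g₂ ε Ψ c (0, basisVec 1) (0, basisVec 1) (u, y)
      - totalForm g₁ g₂ ε Ψ c (0, basisVec 0) (0, basisVec 1) (u, y) *
        totalForm g₁ g₂ ε Ψ c (0, basisVec 1) (0, basisVec 0) (u, y) := by
    rw [totalForm_symm (0, basisVec 1) (0, basisVec 0)]; rfl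
  rw [e]
  exact congrArg₂ (fun a b : ℝ ↦ a - b) (congrArg₂ (fun a b : ℝ ↦ a * b) (h _ _) (h _ _))
    (congrArg₂ (fun a b : ℝ ↦ a * b) (h _ _) (h _ _))

theorem detChart_zero_pos (hΨ : IsNormalFamily g₁ g₂ ε δ Ψ)
    (hc : IsProductChart g₁ g₂ ε s (Ψ 0) c) (hy : y ∈ c.target) :
    0 < detChart g₁ g₂ ε Ψ c (0, y) := by
  have p0 := totalForm_diag_pos hc hΨ hy 0
  have p1 := totalForm_diag_pos hc hΨ hy 1
  rw [detChart, totalForm_off_diag hc hΨ hy, mul_zero, sub_zero]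
  have h1 := mul_pos p0 p1
  rw [mul_mul_mul_comm] at h1
  exact (pos_iff_pos_of_mul_pos h1).1 (lt_of_le_of_ne (mul_self_nonneg s)
    fun h ↦ by rw [← h, zero_mul] at h1; exact lt_irrefl _ h1)

/-- The sign is known in product charts, and passing from a chart to the tangent plane divides by a
nonzero square. -/
theorem gram_det_pos (hΨ : IsNormalFamily g₁ g₂ ε δ Ψ)
    (hP : HasProductCharts g₁ g₂ ε s (Ψ 0)) (p : S) :
    0 < (gram (inducedForm g₁ g₂ ε (Ψ 0) p)).det := by
  obtain ⟨c, hc, hp⟩ := hP p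
  have h := detChart_zero_pos hΨ hc (c.map_source hp)
  have h0 : (0 : ℝ) ∈ Ioo (-δ) δ := ⟨by linarith [hΨ.pos], hΨ.pos⟩
  rw [detChart_eq hΨ hc.1 h0 (c.map_source hp), c.left_inv hp] at h
  exact (pos_iff_pos_of_mul_pos h).1 (by
    have := mfderiv_chart_symm_det_ne_zero hc.1 (c.map_source hp)
    positivity)

theorem areaRatio_chart (hΨ : IsNormalFamily g₁ g₂ ε δ Ψ)
    (hc : c ∈ IsManifold.maximalAtlas (𝓡 2) ∞ S) (hu : u ∈ Ioo (-δ) δ) (hy : y ∈ c.target) :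
    areaRatio g₁ g₂ ε Ψ u (c.symm y) =
      detChart g₁ g₂ ε Ψ c (u, y) / detChart g₁ g₂ ε Ψ c (0, y) := by
  have h0 : (0 : ℝ) ∈ Ioo (-δ) δ := ⟨by linarith [hΨ.pos], hΨ.pos⟩
  rw [detChart_eq hΨ hc hu hy, detChart_eq hΨ hc h0 hy, mul_div_mul_left, areaRatio]
  exact pow_ne_zero _ (mfderiv_chart_symm_det_ne_zero hc hy)

theorem detChart_zero_ne (hΨ : IsNormalFamily g₁ g₂ ε δ Ψ)
    (hP : HasProductCharts g₁ g₂ ε s (Ψ 0)) (hc : c ∈ IsManifold.maximalAtlas (𝓡 2) ∞ S)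
    (hy : y ∈ c.target) : detChart g₁ g₂ ε Ψ c (0, y) ≠ 0 := by
  have h0 : (0 : ℝ) ∈ Ioo (-δ) δ := ⟨by linarith [hΨ.pos], hΨ.pos⟩
  rw [detChart_eq hΨ hc h0 hy]
  exact mul_ne_zero (pow_ne_zero _ (mfderiv_chart_symm_det_ne_zero hc hy))
    (gram_det_pos hΨ hP _).ne'

theorem isChartSmooth_areaRatio (hΨ : IsNormalFamily g₁ g₂ ε δ Ψ)
    (hP : HasProductCharts g₁ g₂ ε s (Ψ 0)) : IsChartSmooth δ (areaRatio g₁ g₂ ε Ψ) := by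
  intro c hc
  have h1 := smoothOn_detChart hc hΨ
  have h2 : ContDiffOn ℝ ∞ (fun q : ℝ × Plane ↦ detChart g₁ g₂ ε Ψ c (0, q.2))
      (Ioo (-δ) δ ×ˢ c.target) :=
    h1.comp (f := fun q : ℝ × Plane ↦ ((0 : ℝ), q.2)) (by fun_prop) fun _ hq ↦
      zero_mem_famDomain hΨ.pos hq.2
  refine (h1.div h2 fun q hq ↦ detChart_zero_ne hΨ hP hc hq.2).congr fun q hq ↦ ?_
  exact areaRatio_chart hΨ hc hq.1 hq.2

theorem areaRatio_zero (hΨ : IsNormalFamily g₁ g₂ ε δ Ψ)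
    (hP : HasProductCharts g₁ g₂ ε s (Ψ 0)) (p : S) : areaRatio g₁ g₂ ε Ψ 0 p = 1 :=
  div_self (gram_det_pos hΨ hP p).ne'

variable (g₁ g₂ ε) in
/-- The second variation of the area density, relative to the area density. -/
def secondDensity (Ψ : ℝ → S → M₁ × M₂) (p : S) : ℝ :=
  deriv (fun u ↦ deriv (fun t ↦ areaRatio g₁ g₂ ε Ψ t p) u) 0 / 2
    - deriv (fun t ↦ areaRatio g₁ g₂ ε Ψ t p) 0 ^ 2 / 4

theorem secondDensity_chart (hΨ : IsNormalFamily g₁ g₂ ε δ Ψ)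
    (hc : c ∈ IsManifold.maximalAtlas (𝓡 2) ∞ S) (hy : y ∈ c.target) :
    secondDensity g₁ g₂ ε Ψ (c.symm y) =
      dirDeriv (1, 0) (dirDeriv (1, 0) (detChart g₁ g₂ ε Ψ c)) (0, y) /
        detChart g₁ g₂ ε Ψ c (0, y) / 2
      - (dirDeriv (1, 0) (detChart g₁ g₂ ε Ψ c) (0, y) / detChart g₁ g₂ ε Ψ c (0, y)) ^ 2 / 4 := by
  have h0 : (0 : ℝ) ∈ Ioo (-δ) δ := ⟨by linarith [hΨ.pos], hΨ.pos⟩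
  have ho := isOpen_famDomain δ c
  have hs := smoothOn_detChart hc hΨ
  have e1 : ∀ u ∈ Ioo (-δ) δ, deriv (fun t ↦ areaRatio g₁ g₂ ε Ψ t (c.symm y)) u =
      dirDeriv (1, 0) (detChart g₁ g₂ ε Ψ c) (u, y) / detChart g₁ g₂ ε Ψ c (0, y) := by
    intro u hu
    have h1 := (hasDerivAt_fst (diffAt_of_smoothOn ho hs ⟨hu, hy⟩)).div_const
      (detChart g₁ g₂ ε Ψ c (0, y))
    refine (h1.congr_of_eventuallyEq ?_).deriv
    filter_upwards [isOpen_Ioo.mem_nhds hu] with t ht using areaRatio_chart hΨ hc ht hy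
  have e2 : deriv (fun u ↦ deriv (fun t ↦ areaRatio g₁ g₂ ε Ψ t (c.symm y)) u) 0 =
      dirDeriv (1, 0) (dirDeriv (1, 0) (detChart g₁ g₂ ε Ψ c)) (0, y) /
        detChart g₁ g₂ ε Ψ c (0, y) := by
    have h1 := (hasDerivAt_fst (diffAt_of_smoothOn ho
      (smoothOn_dirDeriv (ξ := (1, 0)) ho hs) ⟨h0, hy⟩)).div_const (detChart g₁ g₂ ε Ψ c (0, y))
    refine (h1.congr_of_eventuallyEq ?_).deriv
    filter_upwards [isOpen_Ioo.mem_nhds h0] with t ht using e1 t ht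
  rw [secondDensity, e1 0 h0, e2]

theorem continuous_secondDensity [IsManifold (𝓡 2) ∞ S] (hΨ : IsNormalFamily g₁ g₂ ε δ Ψ)
    (hP : HasProductCharts g₁ g₂ ε s (Ψ 0)) : Continuous (secondDensity g₁ g₂ ε Ψ) := by
  have h0 : (0 : ℝ) ∈ Ioo (-δ) δ := ⟨by linarith [hΨ.pos], hΨ.pos⟩
  have h := isChartSmooth_areaRatio hΨ hP
  exact ((h.deriv.deriv.continuous_slice h0).div_const 2).sub
    (((h.deriv.continuous_slice h0).pow 2).div_const 4)

/-- The family is constant outside of a set. -/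
def IsConstOff (δ : ℝ) (Ψ : ℝ → S → M₁ × M₂) (K : Set S) : Prop :=
  ∀ u ∈ Ioo (-δ) δ, ∀ p ∉ K, Ψ u p = Ψ 0 p

variable {K : Set S}

theorem inducedForm_of_constOff (hK : IsClosed K) (hΨK : IsConstOff δ Ψ K) (hu : u ∈ Ioo (-δ) δ)
    {p : S} (hp : p ∉ K) : inducedForm g₁ g₂ ε (Ψ u) p = inducedForm g₁ g₂ ε (Ψ 0) p := by
  have hev : ∀ᶠ p' in 𝓝 p, Ψ u p' = Ψ 0 p' := by
    filter_upwards [hK.isOpen_compl.mem_nhds hp] with p' hp' using hΨK u hu p' hp'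
  have e1 : (fun p ↦ (Ψ u p).1) =ᶠ[𝓝 p] fun p ↦ (Ψ 0 p).1 := hev.mono fun p' h ↦ by simp only [h]
  have e2 : (fun p ↦ (Ψ u p).2) =ᶠ[𝓝 p] fun p ↦ (Ψ 0 p).2 := hev.mono fun p' h ↦ by simp only [h]
  let B : M₁ × M₂ → (Plane →L[ℝ] Plane) → (Plane →L[ℝ] Plane) → Plane →L[ℝ] Plane →L[ℝ] ℝ :=
    fun q A₁ A₂ ↦ ContinuousLinearMap.bilinearComp
      (g₁.inner q.1 : Plane →L[ℝ] Plane →L[ℝ] ℝ) A₁ A₁ +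
      ε • ContinuousLinearMap.bilinearComp (g₂.inner q.2 : Plane →L[ℝ] Plane →L[ℝ] ℝ) A₂ A₂
  have h1 : (mfderiv (𝓡 2) (𝓡 2) (fun p ↦ (Ψ u p).1) p : Plane →L[ℝ] Plane) =
    mfderiv (𝓡 2) (𝓡 2) (fun p ↦ (Ψ 0 p).1) p := e1.mfderiv_eq
  have h2 : (mfderiv (𝓡 2) (𝓡 2) (fun p ↦ (Ψ u p).2) p : Plane →L[ℝ] Plane) =
    mfderiv (𝓡 2) (𝓡 2) (fun p ↦ (Ψ 0 p).2) p := e2.mfderiv_eq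
  change B (Ψ u p) (mfderiv (𝓡 2) (𝓡 2) (fun p ↦ (Ψ u p).1) p)
    (mfderiv (𝓡 2) (𝓡 2) (fun p ↦ (Ψ u p).2) p) = B (Ψ 0 p)
    (mfderiv (𝓡 2) (𝓡 2) (fun p ↦ (Ψ 0 p).1) p) (mfderiv (𝓡 2) (𝓡 2) (fun p ↦ (Ψ 0 p).2) p)
  rw [h1, h2, hΨK u hu p hp]

theorem secondDensity_of_constOff (hΨ : IsNormalFamily g₁ g₂ ε δ Ψ)
    (hP : HasProductCharts g₁ g₂ ε s (Ψ 0)) (hK : IsClosed K) (hΨK : IsConstOff δ Ψ K) {p : S}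
    (hp : p ∉ K) : secondDensity g₁ g₂ ε Ψ p = 0 := by
  have h0 : (0 : ℝ) ∈ Ioo (-δ) δ := ⟨by linarith [hΨ.pos], hΨ.pos⟩
  have e0 : ∀ u ∈ Ioo (-δ) δ, areaRatio g₁ g₂ ε Ψ u p = 1 := fun u hu ↦ by
    rw [← areaRatio_zero hΨ hP p, areaRatio, areaRatio, inducedForm_of_constOff hK hΨK hu hp]
  have e1 : ∀ u ∈ Ioo (-δ) δ, deriv (fun t ↦ areaRatio g₁ g₂ ε Ψ t p) u = 0 := fun u hu ↦ by
    have : (fun t ↦ areaRatio g₁ g₂ ε Ψ t p) =ᶠ[𝓝 u] fun _ ↦ 1 := by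
      filter_upwards [isOpen_Ioo.mem_nhds hu] with t ht using e0 t ht
    rw [this.deriv_eq, deriv_const]
  have e2 : deriv (fun u ↦ deriv (fun t ↦ areaRatio g₁ g₂ ε Ψ t p) u) 0 = 0 := by
    have : (fun u ↦ deriv (fun t ↦ areaRatio g₁ g₂ ε Ψ t p) u) =ᶠ[𝓝 0] fun _ ↦ 0 := by
      filter_upwards [isOpen_Ioo.mem_nhds h0] with t ht using e1 t ht
    rw [this.deriv_eq, deriv_const]
  rw [secondDensity, e1 0 h0, e2]; norm_num

theorem contMDiff_zero₁ (hΨ : IsNormalFamily g₁ g₂ ε δ Ψ) :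
    ContMDiff (𝓡 2) (𝓡 2) ∞ fun p ↦ (Ψ 0 p).1 :=
  contMDiff_of_family (h := fun u p ↦ (Ψ u p).1) hΨ.smooth₁ ⟨by linarith [hΨ.pos], hΨ.pos⟩

theorem contMDiff_zero₂ (hΨ : IsNormalFamily g₁ g₂ ε δ Ψ) :
    ContMDiff (𝓡 2) (𝓡 2) ∞ fun p ↦ (Ψ 0 p).2 :=
  contMDiff_of_family (h := fun u p ↦ (Ψ u p).2) hΨ.smooth₂ ⟨by linarith [hΨ.pos], hΨ.pos⟩

end AreaRatio

/-! ### The second derivative of the volume -/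

section SecondVariation

open MeasureTheory

variable {M₁ : Type*} [TopologicalSpace M₁] [ChartedSpace Plane M₁] [IsManifold (𝓡 2) ∞ M₁]
  {M₂ : Type*} [TopologicalSpace M₂] [ChartedSpace Plane M₂] [IsManifold (𝓡 2) ∞ M₂]
  {S : Type*} [TopologicalSpace S] [ChartedSpace Plane S] [IsManifold (𝓡 2) ∞ S]
  [MeasurableSpace S] [BorelSpace S] [SecondCountableTopology S] [Nonempty S]
  {g₁ : LorentzMetric M₁} {g₂ : LorentzMetric M₂} {ε δ s : ℝ} {Ψ : ℝ → S → M₁ × M₂} {K : Set S}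

theorem volumeOn_family (hΨ : IsNormalFamily g₁ g₂ ε δ Ψ)
    (hP : HasProductCharts g₁ g₂ ε s (Ψ 0)) (hK : MeasurableSet K) {u : ℝ}
    (hu : u ∈ Ioo (-δ) δ) :
    volumeOn g₁ g₂ ε (Ψ u) K =
      ∫ p in K, √|areaRatio g₁ g₂ ε Ψ u p| ∂(areaMeasure g₁ g₂ ε (Ψ 0)) := by
  have hcont : Continuous fun p ↦ √|areaRatio g₁ g₂ ε Ψ u p| :=
    ((isChartSmooth_areaRatio hΨ hP).continuous_slice hu).abs.sqrt
  have hu1 := contMDiff_of_family (h := fun u p ↦ (Ψ u p).1) hΨ.smooth₁ hu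
  have hu2 := contMDiff_of_family (h := fun u p ↦ (Ψ u p).2) hΨ.smooth₂ hu
  rw [volumeOn_eq g₁ g₂ ε hK, areaMeasure_eq_withDensity g₁ g₂ ε (contMDiff_zero₁ hΨ)
    (contMDiff_zero₂ hΨ) hcont ?_ hK, integral_eq_lintegral_of_nonneg_ae
      (ae_of_all _ fun p ↦ Real.sqrt_nonneg _) hcont.aestronglyMeasurable]
  intro n y hy
  have he := chartSeq_mem_maximalAtlas (S := S) n
  rw [det_inducedCoord_eq g₁ g₂ ε he hu1 hu2 hy,
    det_inducedCoord_eq g₁ g₂ ε he (contMDiff_zero₁ hΨ) (contMDiff_zero₂ hΨ) hy,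
    ← Real.sqrt_mul (abs_nonneg _), ← abs_mul, areaRatio, mul_assoc,
    mul_div_cancel₀ _ (gram_det_pos hΨ hP _).ne']

-- The ratio is continuous and equals 1 at parameter 0, so the tube lemma over the compact K gives a
-- uniform range of parameters. On it the absolute value disappears and the root is differentiable.
omit [MeasurableSpace S] [BorelSpace S] [SecondCountableTopology S] [Nonempty S] in
theorem exists_areaRatio_pos (hΨ : IsNormalFamily g₁ g₂ ε δ Ψ)
    (hP : HasProductCharts g₁ g₂ ε s (Ψ 0)) (hK : IsCompact K) :
    ∃ δ' > 0, δ' ≤ δ ∧ ∀ u ∈ Ioo (-δ') δ', ∀ p ∈ K, 0 < areaRatio g₁ g₂ ε Ψ u p := by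
  have hO := (isChartSmooth_areaRatio hΨ hP).continuousOn.isOpen_inter_preimage
    (isOpen_Ioo.prod isOpen_univ) (isOpen_Ioi (a := (0 : ℝ)))
  have hsub : ({0} : Set ℝ) ×ˢ K ⊆ (Ioo (-δ) δ ×ˢ univ) ∩
      (fun z : ℝ × S ↦ areaRatio g₁ g₂ ε Ψ z.1 z.2) ⁻¹' Ioi 0 := by
    rintro ⟨u, p⟩ ⟨hu, hp⟩
    obtain rfl : u = 0 := hu
    refine ⟨⟨⟨by linarith [hΨ.pos], hΨ.pos⟩, mem_univ _⟩, ?_⟩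
    simp [areaRatio_zero hΨ hP]
  obtain ⟨V, W, hV, -, h0V, hKW, hVW⟩ := generalized_tube_lemma isCompact_singleton hK hO hsub
  obtain ⟨r, hr, hrV⟩ := Metric.isOpen_iff.1 hV 0 (h0V rfl)
  refine ⟨min r δ, lt_min hr hΨ.pos, min_le_right _ _, fun u hu p hp ↦ ?_⟩
  have huV : u ∈ V := hrV (by
    rw [Metric.mem_ball, Real.dist_eq, sub_zero, abs_lt]
    exact ⟨by linarith [hu.1, min_le_left r δ], by linarith [hu.2, min_le_left r δ]⟩)
  exact (hVW (mk_mem_prod huV (hKW hp))).2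

/-- The volume of a family is twice continuously differentiable at `0`, with the expected second
derivative. -/
theorem contDiffAt_volumeOn_family (hΨ : IsNormalFamily g₁ g₂ ε δ Ψ)
    (hP : HasProductCharts g₁ g₂ ε s (Ψ 0)) (hK : IsCompact K) (hKm : MeasurableSet K) :
    ContDiffAt ℝ 2 (fun u ↦ volumeOn g₁ g₂ ε (Ψ u) K) 0 ∧
      iteratedDeriv 2 (fun u ↦ volumeOn g₁ g₂ ε (Ψ u) K) 0 =
        ∫ p in K, secondDensity g₁ g₂ ε Ψ p ∂(areaMeasure g₁ g₂ ε (Ψ 0)) := by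
  obtain ⟨δ', hδ', hle, hpos⟩ := exists_areaRatio_pos hΨ hP hK
  have hsub : Ioo (-δ') δ' ⊆ Ioo (-δ) δ := Ioo_subset_Ioo (by linarith) hle
  have hr := isChartSmooth_areaRatio hΨ hP
  set r := areaRatio g₁ g₂ ε Ψ with hrdef
  set r₁ : ℝ → S → ℝ := fun u p ↦ deriv (fun t ↦ r t p) u with hr₁
  set r₂ : ℝ → S → ℝ := fun u p ↦ deriv (fun t ↦ r₁ t p) u with hr₂
  have c0 : ContinuousOn (fun z : ℝ × S ↦ r z.1 z.2) (Ioo (-δ') δ' ×ˢ K) :=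
    hr.continuousOn.mono (prod_mono hsub (subset_univ _))
  have c1 : ContinuousOn (fun z : ℝ × S ↦ r₁ z.1 z.2) (Ioo (-δ') δ' ×ˢ K) :=
    hr.deriv.continuousOn.mono (prod_mono hsub (subset_univ _))
  have c2 : ContinuousOn (fun z : ℝ × S ↦ r₂ z.1 z.2) (Ioo (-δ') δ' ×ˢ K) :=
    hr.deriv.deriv.continuousOn.mono (prod_mono hsub (subset_univ _))
  have cs : ContinuousOn (fun z : ℝ × S ↦ √(r z.1 z.2)) (Ioo (-δ') δ' ×ˢ K) := c0.sqrt
  have hs0 : ∀ u ∈ Ioo (-δ') δ', ∀ p ∈ K, √(r u p) ≠ 0 := fun u hu p hp ↦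
    (Real.sqrt_pos.2 (hpos u hu p hp)).ne'
  have d0 : ∀ u ∈ Ioo (-δ') δ', ∀ p ∈ K,
      HasDerivAt (fun t ↦ √(r t p)) (r₁ u p / (2 * √(r u p))) u := fun u hu p hp ↦
    (hr.hasDerivAt (hsub hu) p).sqrt (hpos u hu p hp).ne'
  have d1 : ∀ u ∈ Ioo (-δ') δ', ∀ p ∈ K, HasDerivAt (fun t ↦ r₁ t p / (2 * √(r t p)))
      ((r₂ u p * (2 * √(r u p)) - r₁ u p * (2 * (r₁ u p / (2 * √(r u p))))) /
        (2 * √(r u p)) ^ 2) u := fun u hu p hp ↦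
    (hr.deriv.hasDerivAt (hsub hu) p).div ((d0 u hu p hp).const_mul 2)
      (mul_ne_zero two_ne_zero (hs0 u hu p hp))
  have hne : ∀ z ∈ Ioo (-δ') δ' ×ˢ K, 2 * √(r z.1 z.2) ≠ 0 := fun z hz ↦
    mul_ne_zero two_ne_zero (hs0 z.1 hz.1 z.2 hz.2)
  have cs2 : ContinuousOn (fun z : ℝ × S ↦ 2 * √(r z.1 z.2)) (Ioo (-δ') δ' ×ˢ K) :=
    continuousOn_const.mul cs
  have cf1 : ContinuousOn (fun z : ℝ × S ↦ r₁ z.1 z.2 / (2 * √(r z.1 z.2)))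
      (Ioo (-δ') δ' ×ˢ K) := c1.div cs2 hne
  have := isLocallyFiniteMeasure_areaMeasure g₁ g₂ ε (contMDiff_zero₁ hΨ) (contMDiff_zero₂ hΨ)
  obtain ⟨k1, k2⟩ := contDiffAt_two_setIntegral (μ := areaMeasure g₁ g₂ ε (Ψ 0)) hδ' hK hKm
    hK.measure_lt_top.ne cs cf1
    (((c2.mul cs2).sub (c1.mul (continuousOn_const.mul cf1))).div (cs2.pow 2)
      fun z hz ↦ pow_ne_zero _ (hne z hz)) d0 d1
  have hev : (fun u ↦ volumeOn g₁ g₂ ε (Ψ u) K) =ᶠ[𝓝 0]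
      fun u ↦ ∫ p in K, √(r u p) ∂(areaMeasure g₁ g₂ ε (Ψ 0)) := by
    filter_upwards [isOpen_Ioo.mem_nhds (show (0 : ℝ) ∈ Ioo (-δ') δ' from ⟨by linarith, hδ'⟩)]
      with u hu
    rw [volumeOn_family hΨ hP hKm (hsub hu)]
    exact setIntegral_congr_fun hKm fun p hp ↦ by
      simp only [← hrdef, abs_of_pos (hpos u hu p hp)]
  refine ⟨k1.congr_of_eventuallyEq hev, (hev.iteratedDeriv_eq 2).trans (k2.trans ?_)⟩
  refine setIntegral_congr_fun hKm fun p hp ↦ ?_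
  -- With r = 1 at parameter 0, the second derivative of √r becomes r₂ / 2 - r₁² / 4.
  have e0 : r 0 p = 1 := areaRatio_zero hΨ hP p
  have e2 : secondDensity g₁ g₂ ε Ψ p = r₂ 0 p / 2 - r₁ 0 p ^ 2 / 4 := rfl
  simp only [e0, e2, Real.sqrt_one]
  ring

end SecondVariation

/-! ### Differentials of functions on the surface -/

section SurfaceDerivative

variable {S : Type*} [TopologicalSpace S] [ChartedSpace Plane S]
  {c : OpenPartialHomeomorph S Plane} {y : Plane}

/-- The differential of a function on the surface. -/
def surfDeriv (V : S → ℝ) (p : S) : Plane →L[ℝ] ℝ := mfderiv (𝓡 2) 𝓘(ℝ, ℝ) V p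

/-- The differential of the inverse of a chart. -/
def chartFrame (c : OpenPartialHomeomorph S Plane) (y : Plane) : Plane →L[ℝ] Plane :=
  mfderiv (𝓡 2) (𝓡 2) c.symm y

theorem surfDeriv_chart (hc : c ∈ IsManifold.maximalAtlas (𝓡 2) ∞ S) (hy : y ∈ c.target)
    {V : S → ℝ} {G : Plane → ℝ} (hG : DifferentiableAt ℝ G y)
    (hVG : ∀ᶠ z in 𝓝 y, V (c.symm z) = G z) (w : Plane) :
    surfDeriv V (c.symm y) (chartFrame c y w) = dirDeriv w G y := by
  have hp : c.symm y ∈ c.source := c.map_target hy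
  have hcm := mdifferentiable_of_mem_maximalAtlas hc
  have hGm : MDifferentiableAt (𝓡 2) 𝓘(ℝ, ℝ) G (c (c.symm y)) := by
    rw [c.right_inv hy]; exact hG.mdifferentiableAt
  have hev : V =ᶠ[𝓝 (c.symm y)] G ∘ c := by
    have h1 : ∀ᶠ p in 𝓝 (c.symm y), V (c.symm (c p)) = G (c p) :=
      (c.continuousAt hp).eventually (by rwa [c.right_inv hy])
    filter_upwards [h1, c.open_source.mem_nhds hp] with p h h'
    rw [c.left_inv h'] at h; exact h
  have hV : MDifferentiableAt (𝓡 2) 𝓘(ℝ, ℝ) V (c.symm y) :=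
    (hGm.comp _ (hcm.mdifferentiableAt hp)).congr_of_eventuallyEq hev
  have h1 := mfderiv_comp (I := 𝓡 2) (I' := 𝓡 2) (I'' := 𝓘(ℝ, ℝ)) y (g := V) (f := c.symm) hV
    (hcm.mdifferentiableAt_symm hy)
  have h2 : V ∘ c.symm =ᶠ[𝓝 y] G := hVG
  have h3 : mfderiv (𝓡 2) 𝓘(ℝ, ℝ) (V ∘ c.symm) y = fderiv ℝ G y :=
    h2.mfderiv_eq.trans mfderiv_eq_fderiv
  exact (DFunLike.congr_fun h1 w).symm.trans (DFunLike.congr_fun h3 w)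

theorem chartFrame_surjective (hc : c ∈ IsManifold.maximalAtlas (𝓡 2) ∞ S) (hy : y ∈ c.target) :
    Function.Surjective (chartFrame c y) := fun v ↦ mfderiv_chart_symm_surjective hc hy v

end SurfaceDerivative

/-! ### The tangential acceleration as one-form and vector field -/

section Acceleration

theorem pullForm_snd_add {M : Type*} [TopologicalSpace M] [ChartedSpace Plane M]
    [IsManifold (𝓡 2) ∞ M] (g : LorentzMetric M) (f : ℝ × Plane → M) (ξ q : ℝ × Plane) (a b : ℝ)
    (v w : ℝ × Plane) :
    pullForm g f ξ (a • v + b • w) q = a * pullForm g f ξ v q + b * pullForm g f ξ w q := by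
  let A : ℝ × Plane →L[ℝ] Plane := mfderiv 𝓘(ℝ, ℝ × Plane) (𝓡 2) f q
  let B : Plane →L[ℝ] Plane →L[ℝ] ℝ := g.inner (f q)
  change B (A ξ) (A (a • v + b • w)) = a * B (A ξ) (A v) + b * B (A ξ) (A w)
  simp

variable {M₁ : Type*} [TopologicalSpace M₁] [ChartedSpace Plane M₁] [IsManifold (𝓡 2) ∞ M₁]
  {M₂ : Type*} [TopologicalSpace M₂] [ChartedSpace Plane M₂] [IsManifold (𝓡 2) ∞ M₂]
  {S : Type*} [TopologicalSpace S] [ChartedSpace Plane S]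
  (g₁ : LorentzMetric M₁) (g₂ : LorentzMetric M₂) (ε : ℝ)

/-- The tangential part of the acceleration of a family, as a one-form. -/
def accelForm (Ψ : ℝ → S → M₁ × M₂) (p : S) (v : Plane) : ℝ :=
  deriv (fun u ↦ velocityForm g₁ g₂ ε Ψ u p v) 0
    - 1 / 2 * surfDeriv (velocitySq g₁ g₂ ε Ψ 0) p v

open Classical in
/-- The tangential part of the acceleration of a family, as a vector field. -/
def accelVec (Ψ : ℝ → S → M₁ × M₂) (p : S) : Plane :=
  if h : ∃ w, ∀ v, inducedForm g₁ g₂ ε (Ψ 0) p w v = accelForm g₁ g₂ ε Ψ p v then h.choose else 0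

variable {g₁ g₂ ε} {δ s : ℝ} {Ψ : ℝ → S → M₁ × M₂} {c : OpenPartialHomeomorph S Plane} {y : Plane}
  {K : Set S}

theorem accelForm_chart (hΨ : IsNormalFamily g₁ g₂ ε δ Ψ)
    (hc : c ∈ IsManifold.maximalAtlas (𝓡 2) ∞ S) (hy : y ∈ c.target) (w : Plane) :
    accelForm g₁ g₂ ε Ψ (c.symm y) (chartFrame c y w) = accelChart g₁ g₂ ε Ψ c w (0, y) := by
  have ho := isOpen_famDomain δ c
  have hq := zero_mem_famDomain hΨ.pos hy
  have hT := smoothOn_totalForm g₁ g₂ ε hc hΨ.smooth₁ hΨ.smooth₂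
  have e1 : deriv (fun u ↦ velocityForm g₁ g₂ ε Ψ u (c.symm y) (chartFrame c y w)) 0 =
      dirDeriv (1, 0) (totalForm g₁ g₂ ε Ψ c (1, 0) (0, w)) (0, y) := by
    refine ((hasDerivAt_fst (diffAt_of_smoothOn ho (hT _ _) hq)).congr_of_eventuallyEq ?_).deriv
    filter_upwards [isOpen_Ioo.mem_nhds hq.1] with u hu using
      (totalForm_fst_snd g₁ g₂ ε hc hΨ.smooth₁ hΨ.smooth₂ hu hy w).symm
  have d2 := diffAt_of_smoothOn ho (hT (1, 0) (1, 0)) hq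
  have e2 : surfDeriv (velocitySq g₁ g₂ ε Ψ 0) (c.symm y) (chartFrame c y w) =
      dirDeriv (0, w) (totalForm g₁ g₂ ε Ψ c (1, 0) (1, 0)) (0, y) := by
    rw [← dirDeriv_snd d2]
    refine surfDeriv_chart hc hy (hasFDerivAt_snd d2).differentiableAt ?_ w
    filter_upwards [c.open_target.mem_nhds hy] with z hz using
      (totalForm_fst_fst g₁ g₂ ε hc hΨ.smooth₁ hΨ.smooth₂ hq.1 hz).symm
  rw [accelForm, e1, e2, accelChart]

omit [ChartedSpace Plane S] in
theorem totalForm_snd_add (ξ q : ℝ × Plane) (a b : ℝ) (v w : ℝ × Plane) :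
    totalForm g₁ g₂ ε Ψ c ξ (a • v + b • w) q =
      a * totalForm g₁ g₂ ε Ψ c ξ v q + b * totalForm g₁ g₂ ε Ψ c ξ w q := by
  simp only [totalForm, pullForm_snd_add]
  ring

theorem accelChart_eq_sum (hΨ : IsNormalFamily g₁ g₂ ε δ Ψ)
    (hc : c ∈ IsManifold.maximalAtlas (𝓡 2) ∞ S) (hy : y ∈ c.target) (w : Plane) :
    accelChart g₁ g₂ ε Ψ c w (0, y) = w 0 * accelChart g₁ g₂ ε Ψ c (basisVec 0) (0, y)
      + w 1 * accelChart g₁ g₂ ε Ψ c (basisVec 1) (0, y) := by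
  have ho := isOpen_famDomain δ c
  have hq := zero_mem_famDomain hΨ.pos hy
  have hT := smoothOn_totalForm g₁ g₂ ε hc hΨ.smooth₁ hΨ.smooth₂
  have hw : ((0, w) : ℝ × Plane) = w 0 • (0, basisVec 0) + w 1 • (0, basisVec 1) := by
    conv_lhs => rw [plane_sum_basis w, Fin.sum_univ_two]
    simp
  have e : totalForm g₁ g₂ ε Ψ c (1, 0) (0, w) = fun q ↦
      w 0 * totalForm g₁ g₂ ε Ψ c (1, 0) (0, basisVec 0) q
      + w 1 * totalForm g₁ g₂ ε Ψ c (1, 0) (0, basisVec 1) q := by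
    funext q; rw [hw, totalForm_snd_add]
  have d : ∀ a, DifferentiableAt ℝ (totalForm g₁ g₂ ε Ψ c (1, 0) (0, basisVec a)) (0, y) :=
    fun a ↦ diffAt_of_smoothOn ho (hT _ _) hq
  have e2 : ∀ f : ℝ × Plane → ℝ, dirDeriv (0, w) f (0, y) =
      w 0 * dirDeriv (0, basisVec 0) f (0, y) + w 1 * dirDeriv (0, basisVec 1) f (0, y) := by
    intro f
    simp only [dirDeriv]
    rw [hw, map_add, map_smul, map_smul]; rfl
  rw [accelChart, e, dirDeriv_add ((d 0).const_mul _) ((d 1).const_mul _),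
    dirDeriv_const_mul _ (d 0), dirDeriv_const_mul _ (d 1), e2, accelChart, accelChart]
  ring

/-- The components of the acceleration vector field in a product chart. -/
def accelComp (g₁ : LorentzMetric M₁) (g₂ : LorentzMetric M₂) (ε : ℝ) (Ψ : ℝ → S → M₁ × M₂)
    (c : OpenPartialHomeomorph S Plane) (a : Fin 2) (y : Plane) : ℝ :=
  accelChart g₁ g₂ ε Ψ c (basisVec a) (0, y) /
    totalForm g₁ g₂ ε Ψ c (0, basisVec a) (0, basisVec a) (0, y)

/-- The induced form is nondegenerate, so the vector representing a one-form is unique. The choice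
made in `accelVec` can therefore be identified by exhibiting any representing vector. -/
theorem accelVec_eq_of_forall (hΨ : IsNormalFamily g₁ g₂ ε δ Ψ)
    (hP : HasProductCharts g₁ g₂ ε s (Ψ 0)) {p : S} {w : Plane}
    (hw : ∀ v, inducedForm g₁ g₂ ε (Ψ 0) p w v = accelForm g₁ g₂ ε Ψ p v) :
    accelVec g₁ g₂ ε Ψ p = w := by
  have hex : ∃ w, ∀ v, inducedForm g₁ g₂ ε (Ψ 0) p w v = accelForm g₁ g₂ ε Ψ p v := ⟨w, hw⟩
  rw [accelVec, dif_pos hex]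
  set w' := hex.choose
  have hw' : ∀ v, inducedForm g₁ g₂ ε (Ψ 0) p w' v = accelForm g₁ g₂ ε Ψ p v := hex.choose_spec
  have h0 : ∀ v, inducedForm g₁ g₂ ε (Ψ 0) p (w' - w) v = 0 := fun v ↦ by
    rw [map_sub, sub_apply, hw, hw', sub_self]
  have hdet := (gram_det_pos hΨ hP p).ne'
  have hv : Matrix.vecMul (fun i ↦ (w' - w) i) (gram (inducedForm g₁ g₂ ε (Ψ 0) p)) = 0 := by
    funext j
    have := h0 (basisVec j)
    conv at this => lhs; rw [plane_sum_basis (w' - w)]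
    simpa [Matrix.vecMul, dotProduct, gram, Fin.sum_univ_two] using this
  have hz := Matrix.eq_zero_of_vecMul_eq_zero hdet hv
  exact sub_eq_zero.1 (by ext i; exact congrFun hz i)

/-- The metric is diagonal in a product chart, so raising the index is division by the diagonal
entries. -/
theorem accelVec_chart (hΨ : IsNormalFamily g₁ g₂ ε δ Ψ)
    (hP : HasProductCharts g₁ g₂ ε s (Ψ 0)) (hc : IsProductChart g₁ g₂ ε s (Ψ 0) c)
    (hy : y ∈ c.target) :
    accelVec g₁ g₂ ε Ψ (c.symm y) =
      chartFrame c y (∑ a, accelComp g₁ g₂ ε Ψ c a y • basisVec a) := by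
  refine accelVec_eq_of_forall hΨ hP fun v ↦ ?_
  obtain ⟨w, rfl⟩ := chartFrame_surjective hc.1 hy v
  have h0 : (0 : ℝ) ∈ Ioo (-δ) δ := ⟨by linarith [hΨ.pos], hΨ.pos⟩
  rw [accelForm_chart hΨ hc.1 hy, accelChart_eq_sum hΨ hc.1 hy]
  set B := inducedForm g₁ g₂ ε (Ψ 0) (c.symm y)
  have hB : ∀ a b, B (chartFrame c y (basisVec a)) (chartFrame c y (basisVec b)) =
      totalForm g₁ g₂ ε Ψ c (0, basisVec a) (0, basisVec b) (0, y) := fun a b ↦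
    (totalForm_snd_snd g₁ g₂ ε hc.1 hΨ.smooth₁ hΨ.smooth₂ h0 hy _ _).symm
  have h01 := totalForm_off_diag hc hΨ hy
  have h10 := h01
  rw [totalForm_symm] at h10
  have n0 : totalForm g₁ g₂ ε Ψ c (0, basisVec 0) (0, basisVec 0) (0, y) ≠ 0 := fun h ↦ by
    have := totalForm_diag_pos hc hΨ hy 0
    simp [h] at this
  have n1 : totalForm g₁ g₂ ε Ψ c (0, basisVec 1) (0, basisVec 1) (0, y) ≠ 0 := fun h ↦ by
    have := totalForm_diag_pos hc hΨ hy 1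
    simp [h] at this
  conv_lhs => rw [plane_sum_basis w]
  simp only [Fin.sum_univ_two, map_add, map_smul, add_apply, smul_apply, smul_eq_mul, hB, h01, h10,
    accelComp]
  field_simp
  ring

theorem smoothOn_accelComp (hΨ : IsNormalFamily g₁ g₂ ε δ Ψ)
    (hc : IsProductChart g₁ g₂ ε s (Ψ 0) c) (a : Fin 2) :
    ContDiffOn ℝ ∞ (accelComp g₁ g₂ ε Ψ c a) c.target := by
  have hi : ContDiffOn ℝ ∞ (fun y : Plane ↦ ((0 : ℝ), y)) c.target := by fun_prop
  have hm : MapsTo (fun y : Plane ↦ ((0 : ℝ), y)) c.target (Ioo (-δ) δ ×ˢ c.target) :=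
    fun y hy ↦ zero_mem_famDomain hΨ.pos hy
  refine ((smoothOn_accelChart hc.1 hΨ (basisVec a)).comp hi hm).div
    ((smoothOn_totalForm g₁ g₂ ε hc.1 hΨ.smooth₁ hΨ.smooth₂ _ _).comp hi hm) fun y hy h ↦ ?_
  have := totalForm_diag_pos hc hΨ hy a
  change totalForm g₁ g₂ ε Ψ c (0, basisVec a) (0, basisVec a) (0, y) = 0 at h
  simp [h] at this

/-- The complement of K is open, so the velocity vanishes at p for all small parameters and near p
at parameter 0. This kills both terms of the one-form, and the zero vector represents it. -/
theorem accelVec_of_constOff (hΨ : IsNormalFamily g₁ g₂ ε δ Ψ)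
    (hP : HasProductCharts g₁ g₂ ε s (Ψ 0)) (hK : IsClosed K) (hΨK : IsConstOff δ Ψ K) {p : S}
    (hp : p ∉ K) : accelVec g₁ g₂ ε Ψ p = 0 := by
  refine accelVec_eq_of_forall hΨ hP fun v ↦ ?_
  have hvel : ∀ u ∈ Ioo (-δ) δ, ∀ q ∉ K,
      (mfderiv 𝓘(ℝ, ℝ) (𝓡 2) (fun u ↦ (Ψ u q).1) u : ℝ →L[ℝ] Plane) = 0 ∧
      (mfderiv 𝓘(ℝ, ℝ) (𝓡 2) (fun u ↦ (Ψ u q).2) u : ℝ →L[ℝ] Plane) = 0 := by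
    intro u hu q hq
    have hev : ∀ᶠ t in 𝓝 u, Ψ t q = Ψ 0 q := by
      filter_upwards [isOpen_Ioo.mem_nhds hu] with t ht using hΨK t ht q hq
    have e1 : (fun t ↦ (Ψ t q).1) =ᶠ[𝓝 u] fun _ ↦ (Ψ 0 q).1 := hev.mono fun _ h ↦ by simp only [h]
    have e2 : (fun t ↦ (Ψ t q).2) =ᶠ[𝓝 u] fun _ ↦ (Ψ 0 q).2 := hev.mono fun _ h ↦ by simp only [h]
    exact ⟨e1.mfderiv_eq.trans mfderiv_const, e2.mfderiv_eq.trans mfderiv_const⟩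
  have h0 : (0 : ℝ) ∈ Ioo (-δ) δ := ⟨by linarith [hΨ.pos], hΨ.pos⟩
  have hpair : ∀ u ∈ Ioo (-δ) δ, ∀ q ∉ K, ∀ Y : ProdTangent (Ψ u q),
      prodMetric g₁ g₂ ε (Ψ u q) (mfderiv 𝓘(ℝ, ℝ) (𝓡 2) (fun u ↦ (Ψ u q).1) u (1 : ℝ),
        mfderiv 𝓘(ℝ, ℝ) (𝓡 2) (fun u ↦ (Ψ u q).2) u (1 : ℝ)) Y = 0 := by
    intro u hu q hq Y
    let B₁ : Plane →L[ℝ] Plane →L[ℝ] ℝ := g₁.inner (Ψ u q).1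
    let B₂ : Plane →L[ℝ] Plane →L[ℝ] ℝ := g₂.inner (Ψ u q).2
    have h1 := DFunLike.congr_fun (hvel u hu q hq).1 1
    have h2 := DFunLike.congr_fun (hvel u hu q hq).2 1
    let Y₁ : Plane := Y.1
    let Y₂ : Plane := Y.2
    refine (congrArg₂ (fun a b : Plane ↦ B₁ a Y₁ + ε * B₂ b Y₂) h1 h2).trans ?_
    change B₁ (0 : Plane) Y₁ + ε * B₂ (0 : Plane) Y₂ = 0
    simp
  have e1 : deriv (fun u ↦ velocityForm g₁ g₂ ε Ψ u p v) 0 = 0 := by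
    have : (fun u ↦ velocityForm g₁ g₂ ε Ψ u p v) =ᶠ[𝓝 0] fun _ ↦ 0 := by
      filter_upwards [isOpen_Ioo.mem_nhds h0] with u hu using hpair u hu p hp _
    rw [this.deriv_eq, deriv_const]
  have e2 : surfDeriv (velocitySq g₁ g₂ ε Ψ 0) p = 0 := by
    have : velocitySq g₁ g₂ ε Ψ 0 =ᶠ[𝓝 p] fun _ ↦ 0 := by
      filter_upwards [hK.isOpen_compl.mem_nhds hp] with q hq using hpair 0 h0 q hq _
    exact this.mfderiv_eq.trans mfderiv_const
  rw [accelForm, e1, e2]; simp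

/-- The derivative of a function along the acceleration vector field. -/
theorem surfDeriv_accelVec_chart (hΨ : IsNormalFamily g₁ g₂ ε δ Ψ)
    (hP : HasProductCharts g₁ g₂ ε s (Ψ 0)) (hc : IsProductChart g₁ g₂ ε s (Ψ 0) c)
    (hy : y ∈ c.target) {χ : S → ℝ} (hχ : DifferentiableAt ℝ (fun z ↦ χ (c.symm z)) y) :
    surfDeriv χ (c.symm y) (accelVec g₁ g₂ ε Ψ (c.symm y)) =
      ∑ a, accelComp g₁ g₂ ε Ψ c a y * dirDeriv (basisVec a) (fun z ↦ χ (c.symm z)) y := by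
  rw [accelVec_chart hΨ hP hc hy, surfDeriv_chart hc.1 hy hχ (Filter.Eventually.of_forall
    fun _ ↦ rfl), dirDeriv, map_sum]
  simp only [map_smul, smul_eq_mul, dirDeriv]

end Acceleration

/-! ### Integrals of derivatives of compactly supported functions -/

section Divergence

open MeasureTheory

/-- Integration by parts against the constant function 1. -/
theorem integral_dirDeriv_eq_zero {P : Plane → ℝ} (hP : ContDiff ℝ 1 P) (hc : HasCompactSupport P)
    (v : Plane) : ∫ y, dirDeriv v P y = 0 := by
  have hd : Continuous (dirDeriv v P) := (hP.continuous_fderiv one_ne_zero).clm_apply continuous_const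
  have hdc : HasCompactSupport (dirDeriv v P) := hc.fderiv_apply ℝ v
  have h := integral_bilinear_hasLineDerivAt_right_eq_neg_left_of_integrable (μ := volume)
    (f := fun _ : Plane ↦ (1 : ℝ)) (f' := fun _ ↦ 0) (g := P) (g' := dirDeriv v P) (v := v)
    (B := ContinuousLinearMap.mul ℝ ℝ) (by simp)
    (by simpa using hd.integrable_of_hasCompactSupport hdc)
    (by simpa using hP.continuous.integrable_of_hasCompactSupport hc)
    (fun x _ ↦ by simpa using (hasFDerivAt_const (1 : ℝ) x).hasLineDerivAt v)
    (fun x _ ↦ ((hP.differentiable one_ne_zero) x).hasFDerivAt.hasLineDerivAt v)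
  simpa using h

variable {U L : Set Plane} {P : Plane → ℝ}

theorem dirDeriv_eq_zero_off (hU : IsOpen U) (hL : IsClosed L) (hPL : ∀ y ∈ U \ L, P y = 0)
    {y : Plane} (hy : y ∈ U \ L) (v : Plane) : dirDeriv v P y = 0 := by
  rw [dirDeriv_congr (hU.sdiff hL) (h := fun _ ↦ 0) (fun z hz ↦ hPL z hz) hy]
  simp [dirDeriv]

/-- As P vanishes on U off the compact L, its extension by zero is C¹ on the whole plane with
compact support. -/
theorem setIntegral_dirDeriv_eq_zero (hU : IsOpen U) (hP : ContDiffOn ℝ ∞ P U) (hL : IsCompact L)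
    (hLU : L ⊆ U) (hPL : ∀ y ∈ U \ L, P y = 0) (v : Plane) : ∫ y in U, dirDeriv v P y = 0 := by
  have h0 : ∀ y ∉ L, U.indicator P y = 0 := fun y hy ↦ by
    by_cases hyU : y ∈ U
    · rw [indicator_of_mem hyU, hPL y ⟨hyU, hy⟩]
    · exact indicator_of_notMem hyU _
  have hev : ∀ y ∉ L, U.indicator P =ᶠ[𝓝 y] fun _ ↦ 0 := fun y hy ↦ by
    filter_upwards [hL.isClosed.isOpen_compl.mem_nhds hy] with z hz using h0 z hz
  have hevU : ∀ y ∈ U, U.indicator P =ᶠ[𝓝 y] P := fun y hy ↦ by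
    filter_upwards [hU.mem_nhds hy] with z hz using indicator_of_mem hz P
  have hsm : ContDiff ℝ 1 (U.indicator P) := by
    rw [contDiff_iff_contDiffAt]
    intro y
    by_cases hy : y ∈ L
    · exact ((hP.contDiffAt (hU.mem_nhds (hLU hy))).of_le (by simp)).congr_of_eventuallyEq
        (hevU y (hLU hy))
    · exact contDiffAt_const.congr_of_eventuallyEq (hev y hy)
  have hoff : ∀ y ∉ U, dirDeriv v (U.indicator P) y = 0 := fun y hy ↦ by
    rw [dirDeriv, (hev y fun h ↦ hy (hLU h)).fderiv_eq]
    simp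
  rw [← integral_dirDeriv_eq_zero hsm (HasCompactSupport.intro hL h0) v,
    ← setIntegral_eq_integral_of_forall_compl_eq_zero hoff]
  exact setIntegral_congr_fun hU.measurableSet fun y hy ↦ by
    simp only [dirDeriv, (hevU y hy).fderiv_eq]

theorem integrableOn_of_eq_zero_off {f : Plane → ℝ} (hU : IsOpen U) (hf : ContinuousOn f U)
    (hL : IsCompact L) (hLU : L ⊆ U) (hfL : ∀ y ∈ U \ L, f y = 0) : IntegrableOn f U :=
  ((hf.mono hLU).integrableOn_compact hL).of_forall_sdiff_eq_zero hU.measurableSet hfL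

end Divergence

/-! ### Integrating the pointwise inequality -/

section FirstVariation

open MeasureTheory

variable {M₁ : Type*} [TopologicalSpace M₁] [ChartedSpace Plane M₁] [IsManifold (𝓡 2) ∞ M₁]
  {M₂ : Type*} [TopologicalSpace M₂] [ChartedSpace Plane M₂] [IsManifold (𝓡 2) ∞ M₂]
  {S : Type*} [TopologicalSpace S] [ChartedSpace Plane S]
  {g₁ : LorentzMetric M₁} {g₂ : LorentzMetric M₂} {ε δ s : ℝ} {Ψ : ℝ → S → M₁ × M₂} {K : Set S}
  {c : OpenPartialHomeomorph S Plane} {y : Plane} {χ : S → ℝ}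

theorem smoothOn_comp_symm (hc : c ∈ IsManifold.maximalAtlas (𝓡 2) ∞ S)
    (hχ : ContMDiff (𝓡 2) 𝓘(ℝ, ℝ) ∞ χ) : ContDiffOn ℝ ∞ (fun z ↦ χ (c.symm z)) c.target :=
  contMDiffOn_iff_contDiffOn.1 (hχ.comp_contMDiffOn (contMDiffOn_symm_of_mem_maximalAtlas hc))

/-- At parameter 0 the metric coefficients have zero derivatives in a product chart. Hence so has
the area density, and the divergence there is a plain sum of partial derivatives. -/
theorem dirDeriv_slice_detChart (hΨ : IsNormalFamily g₁ g₂ ε δ Ψ)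
    (hc : IsProductChart g₁ g₂ ε s (Ψ 0) c) (hy : y ∈ c.target) (v : Plane) :
    dirDeriv v (fun z ↦ detChart g₁ g₂ ε Ψ c (0, z)) y = 0 := by
  have ho := isOpen_famDomain δ c
  have hq := zero_mem_famDomain hΨ.pos hy
  have hT : ∀ ξ η, DifferentiableAt ℝ (totalForm g₁ g₂ ε Ψ c ξ η) (0, y) := fun ξ η ↦
    diffAt_of_smoothOn ho (smoothOn_totalForm g₁ g₂ ε hc.1 hΨ.smooth₁ hΨ.smooth₂ ξ η) hq
  have e : detChart g₁ g₂ ε Ψ c = fun q ↦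
    totalForm g₁ g₂ ε Ψ c (0, basisVec 0) (0, basisVec 0) q *
      totalForm g₁ g₂ ε Ψ c (0, basisVec 1) (0, basisVec 1) q
    - totalForm g₁ g₂ ε Ψ c (0, basisVec 0) (0, basisVec 1) q *
      totalForm g₁ g₂ ε Ψ c (0, basisVec 0) (0, basisVec 1) q := rfl
  rw [dirDeriv_snd (diffAt_of_smoothOn ho (smoothOn_detChart hc.1 hΨ) hq), e,
    dirDeriv_sub ((hT _ _).fun_mul (hT _ _)) ((hT _ _).fun_mul (hT _ _)),
    dirDeriv_mul (hT _ _) (hT _ _), dirDeriv_mul (hT _ _) (hT _ _)]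
  simp only [dirDeriv_totalForm_eq_zero hc hΨ hy]
  ring

theorem smoothOn_slice_detChart (hΨ : IsNormalFamily g₁ g₂ ε δ Ψ)
    (hc : IsProductChart g₁ g₂ ε s (Ψ 0) c) :
    ContDiffOn ℝ ∞ (fun z ↦ detChart g₁ g₂ ε Ψ c (0, z)) c.target :=
  (smoothOn_detChart hc.1 hΨ).comp (f := fun z : Plane ↦ ((0 : ℝ), z)) (by fun_prop)
    fun _ hz ↦ zero_mem_famDomain hΨ.pos hz

/-- The area density in a product chart. -/
def slicedDensity (g₁ : LorentzMetric M₁) (g₂ : LorentzMetric M₂) (ε : ℝ)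
    (Ψ : ℝ → S → M₁ × M₂) (c : OpenPartialHomeomorph S Plane) (z : Plane) : ℝ :=
  √(detChart g₁ g₂ ε Ψ c (0, z))

theorem smoothOn_slicedDensity (hΨ : IsNormalFamily g₁ g₂ ε δ Ψ)
    (hc : IsProductChart g₁ g₂ ε s (Ψ 0) c) :
    ContDiffOn ℝ ∞ (slicedDensity g₁ g₂ ε Ψ c) c.target :=
  (smoothOn_slice_detChart hΨ hc).sqrt fun _ hz ↦ (detChart_zero_pos hΨ hc hz).ne'

theorem dirDeriv_slicedDensity (hΨ : IsNormalFamily g₁ g₂ ε δ Ψ)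
    (hc : IsProductChart g₁ g₂ ε s (Ψ 0) c) (hy : y ∈ c.target) (v : Plane) :
    dirDeriv v (slicedDensity g₁ g₂ ε Ψ c) y = 0 := by
  have hd := diffAt_of_smoothOn c.open_target (smoothOn_slice_detChart hΨ hc) hy
  have h := (hd.hasFDerivAt.sqrt (detChart_zero_pos hΨ hc hy).ne').fderiv
  have e := dirDeriv_slice_detChart hΨ hc hy v
  rw [dirDeriv] at e
  change fderiv ℝ (fun z ↦ √(detChart g₁ g₂ ε Ψ c (0, z))) y v = 0
  rw [h, smul_apply, e, smul_zero]

/-- Differentiate numerator = component · denominator; the denominator has zero derivative. The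
right side is the form in which the divergence appears in `second_variation_density_le`. -/
theorem dirDeriv_accelComp (hΨ : IsNormalFamily g₁ g₂ ε δ Ψ)
    (hc : IsProductChart g₁ g₂ ε s (Ψ 0) c) (hy : y ∈ c.target) (a : Fin 2) :
    dirDeriv (basisVec a) (accelComp g₁ g₂ ε Ψ c a) y =
      dirDeriv (0, basisVec a) (accelChart g₁ g₂ ε Ψ c (basisVec a)) (0, y) /
        totalForm g₁ g₂ ε Ψ c (0, basisVec a) (0, basisVec a) (0, y) := by
  have ho := isOpen_famDomain δ c
  have hq := zero_mem_famDomain hΨ.pos hy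
  have hTd := diffAt_of_smoothOn ho
    (smoothOn_totalForm g₁ g₂ ε hc.1 hΨ.smooth₁ hΨ.smooth₂ (0, basisVec a) (0, basisVec a)) hq
  have hA := diffAt_of_smoothOn ho (smoothOn_accelChart hc.1 hΨ (basisVec a)) hq
  have hX := diffAt_of_smoothOn c.open_target (smoothOn_accelComp hΨ hc a) hy
  have hne : ∀ z ∈ c.target, totalForm g₁ g₂ ε Ψ c (0, basisVec a) (0, basisVec a) (0, z) ≠ 0 :=
    fun z hz h ↦ by
      have := totalForm_diag_pos hc hΨ hz a
      simp [h] at this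
  have e : dirDeriv (basisVec a) (fun z ↦ accelChart g₁ g₂ ε Ψ c (basisVec a) (0, z)) y =
      dirDeriv (basisVec a) (fun z ↦ accelComp g₁ g₂ ε Ψ c a z *
        totalForm g₁ g₂ ε Ψ c (0, basisVec a) (0, basisVec a) (0, z)) y :=
    dirDeriv_congr c.open_target (fun z hz ↦ (div_mul_cancel₀ _ (hne z hz)).symm) hy
  rw [dirDeriv_mul hX (hasFDerivAt_snd hTd).differentiableAt, dirDeriv_snd hTd, dirDeriv_snd hA,
    dirDeriv_totalForm_eq_zero hc hΨ hy, mul_zero, add_zero] at e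
  rw [e, mul_div_cancel_right₀ _ (hne y hy)]

variable [IsManifold (𝓡 2) ∞ S]

omit [IsManifold (𝓡 2) ∞ S] in
theorem surfDeriv_eq_zero_of_notMem_tsupport {p : S} (hp : p ∉ tsupport χ) : surfDeriv χ p = 0 := by
  have : χ =ᶠ[𝓝 p] fun _ ↦ 0 := notMem_tsupport_iff_eventuallyEq.1 hp
  exact this.mfderiv_eq.trans mfderiv_const

-- The vector field is defined pointwise by choice; its regularity is read off its smooth components
-- in product charts.
omit [IsManifold (𝓡 2) ∞ S] in
theorem continuous_surfDeriv_accelVec (hΨ : IsNormalFamily g₁ g₂ ε δ Ψ)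
    (hP : HasProductCharts g₁ g₂ ε s (Ψ 0)) (hχ : ContMDiff (𝓡 2) 𝓘(ℝ, ℝ) ∞ χ) :
    Continuous fun p ↦ surfDeriv χ p (accelVec g₁ g₂ ε Ψ p) := by
  rw [continuous_iff_continuousAt]
  intro p
  obtain ⟨c, hc, hp⟩ := hP p
  have hs := smoothOn_comp_symm hc.1 hχ
  have hG : ContinuousOn (fun y ↦ ∑ a, accelComp g₁ g₂ ε Ψ c a y *
      dirDeriv (basisVec a) (fun z ↦ χ (c.symm z)) y) c.target :=
    continuousOn_finsetSum _ fun a _ ↦ (smoothOn_accelComp hΨ hc a).continuousOn.mul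
      (smoothOn_dirDeriv c.open_target hs).continuousOn
  have h1 := ContinuousAt.comp (f := c) (x := p)
    (hG.continuousAt (c.open_target.mem_nhds (c.map_source hp))) (c.continuousAt hp)
  refine h1.congr ?_
  filter_upwards [c.open_source.mem_nhds hp] with q hq
  have h2 := surfDeriv_accelVec_chart hΨ hP hc (c.map_source hq)
    (diffAt_of_smoothOn c.open_target hs (c.map_source hq))
  rw [c.left_inv hq] at h2
  exact h2.symm

variable [MeasurableSpace S] [BorelSpace S] [SecondCountableTopology S] [Nonempty S]

/-- The second variation of the area, localized by a cutoff function. -/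
theorem integral_mul_secondDensity_le (hΨ : IsNormalFamily g₁ g₂ ε δ Ψ)
    (hP : HasProductCharts g₁ g₂ ε s (Ψ 0)) (hc : IsProductChart g₁ g₂ ε s (Ψ 0) c)
    (hκ₁ : ∀ x, s * g₁.gaussCurvature x ≤ 0) (hκ₂ : ∀ x, s * ε * g₂.gaussCurvature x ≤ 0)
    (hχ : ContMDiff (𝓡 2) 𝓘(ℝ, ℝ) ∞ χ) (hχ0 : ∀ p, 0 ≤ χ p) (hχc : HasCompactSupport χ)
    (hχs : tsupport χ ⊆ c.source) :
    ∫ p, χ p * secondDensity g₁ g₂ ε Ψ p ∂(areaMeasure g₁ g₂ ε (Ψ 0)) ≤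
      - ∫ p, surfDeriv χ p (accelVec g₁ g₂ ε Ψ p) ∂(areaMeasure g₁ g₂ ε (Ψ 0)) := by
  have h0 : (0 : ℝ) ∈ Ioo (-δ) δ := ⟨by linarith [hΨ.pos], hΨ.pos⟩
  have hU := c.open_target
  have hoff : ∀ p ∉ c.source, p ∉ tsupport χ := fun p hp h ↦ hp (hχs h)
  have hXc := continuous_surfDeriv_accelVec hΨ hP hχ
  rw [integral_areaMeasure (f := fun p ↦ χ p * secondDensity g₁ g₂ ε Ψ p) g₁ g₂ ε hc.1
      (contMDiff_zero₁ hΨ) (contMDiff_zero₂ hΨ) (hχ.continuous.mul (continuous_secondDensity hΨ hP))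
      (fun p hp ↦ by rw [image_eq_zero_of_notMem_tsupport (hoff p hp), zero_mul]),
    integral_areaMeasure g₁ g₂ ε hc.1 (contMDiff_zero₁ hΨ) (contMDiff_zero₂ hΨ) hXc
      (fun p hp ↦ by rw [surfDeriv_eq_zero_of_notMem_tsupport (hoff p hp)]; rfl)]
  have hρ : ∀ y ∈ c.target, √|(inducedCoord g₁ g₂ ε (Ψ 0) c y).det| =
      slicedDensity g₁ g₂ ε Ψ c y := fun y hy ↦ by
    rw [det_inducedCoord_eq g₁ g₂ ε hc.1 (contMDiff_zero₁ hΨ) (contMDiff_zero₂ hΨ) hy,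
      ← detChart_eq hΨ hc.1 h0 hy, abs_of_pos (detChart_zero_pos hΨ hc hy), slicedDensity]
  set ρ := slicedDensity g₁ g₂ ε Ψ c with hρdef
  set X : Plane → ℝ := fun z ↦ χ (c.symm z) with hXdef
  set θ : Fin 2 → Plane → ℝ := fun a ↦ accelComp g₁ g₂ ε Ψ c a with hθdef
  -- All integrands below vanish off this compact subset of the chart's target, which settles
  -- integrability and removes boundary terms.
  set L : Set Plane := c '' tsupport χ with hLdef
  have hL : IsCompact L := hχc.isCompact.image_of_continuousOn (c.continuousOn.mono hχs)
  have hLU : L ⊆ c.target := by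
    rintro _ ⟨p, hp, rfl⟩; exact c.map_source (hχs hp)
  have hXL : ∀ y ∈ c.target \ L, X y = 0 := fun y hy ↦
    image_eq_zero_of_notMem_tsupport (f := χ) fun h ↦ hy.2 ⟨_, h, c.right_inv hy.1⟩
  have sX : ContDiffOn ℝ ∞ X c.target := smoothOn_comp_symm hc.1 hχ
  have sρ : ContDiffOn ℝ ∞ ρ c.target := smoothOn_slicedDensity hΨ hc
  have sθ : ∀ a, ContDiffOn ℝ ∞ (θ a) c.target := fun a ↦ smoothOn_accelComp hΨ hc a
  have sP : ∀ a, ContDiffOn ℝ ∞ (fun z ↦ ρ z * (X z * θ a z)) c.target := fun a ↦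
    sρ.mul (sX.mul (sθ a))
  have hPL : ∀ a, ∀ y ∈ c.target \ L, ρ y * (X y * θ a y) = 0 := fun a y hy ↦ by
    rw [hXL y hy]; ring
  have dP : ∀ a, ∀ y ∈ c.target, dirDeriv (basisVec a) (fun z ↦ ρ z * (X z * θ a z)) y =
      ρ y * (dirDeriv (basisVec a) X y * θ a y + X y * dirDeriv (basisVec a) (θ a) y) := by
    intro a y hy
    have d1 := diffAt_of_smoothOn hU sρ hy
    have d2 := diffAt_of_smoothOn hU sX hy
    have d3 := diffAt_of_smoothOn hU (sθ a) hy
    rw [dirDeriv_mul d1 (d2.fun_mul d3), dirDeriv_mul d2 d3, dirDeriv_slicedDensity hΨ hc hy,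
      zero_mul, zero_add]
  have hacc : ∀ y ∈ c.target, surfDeriv χ (c.symm y) (accelVec g₁ g₂ ε Ψ (c.symm y)) =
      ∑ a, θ a y * dirDeriv (basisVec a) X y := fun y hy ↦
    surfDeriv_accelVec_chart hΨ hP hc hy (diffAt_of_smoothOn hU sX hy)
  -- The pointwise inequality times ρ χ ≥ 0, with χ · div θ written as div(χ θ) - dχ(θ). The factor
  -- ρ passes under the derivatives because its own derivative is zero.
  have hpt : ∀ y ∈ c.target, ρ y * (X y * secondDensity g₁ g₂ ε Ψ (c.symm y)) ≤
      ∑ a, dirDeriv (basisVec a) (fun z ↦ ρ z * (X z * θ a z)) y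
        - ρ y * ∑ a, θ a y * dirDeriv (basisVec a) X y := by
    intro y hy
    have k := second_variation_density_le hc hΨ hy hκ₁ hκ₂
    rw [← secondDensity_chart hΨ hc.1 hy] at k
    simp only [← dirDeriv_accelComp hΨ hc hy] at k
    have k2 := mul_le_mul_of_nonneg_left k
      (mul_nonneg (Real.sqrt_nonneg (detChart g₁ g₂ ε Ψ c (0, y))) (hχ0 (c.symm y)))
    rw [mul_assoc] at k2
    refine k2.trans (le_of_eq ?_)
    simp only [dP _ y hy, Fin.sum_univ_two]
    simp only [hρdef, hXdef, hθdef, slicedDensity]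
    ring
  have i1 : IntegrableOn (fun y ↦ ρ y * (X y * secondDensity g₁ g₂ ε Ψ (c.symm y))) c.target := by
    refine integrableOn_of_eq_zero_off hU ?_ hL hLU fun y hy ↦ by rw [hXL y hy]; ring
    exact sρ.continuousOn.mul (sX.continuousOn.mul
      ((continuous_secondDensity hΨ hP).comp_continuousOn c.continuousOn_symm))
  have i2 : ∀ a, IntegrableOn (dirDeriv (basisVec a) fun z ↦ ρ z * (X z * θ a z)) c.target :=
    fun a ↦ integrableOn_of_eq_zero_off hU (smoothOn_dirDeriv hU (sP a)).continuousOn hL hLU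
      fun y hy ↦ dirDeriv_eq_zero_off hU hL.isClosed (hPL a) hy _
  have i3 : IntegrableOn (fun y ↦ ρ y * ∑ a, θ a y * dirDeriv (basisVec a) X y) c.target := by
    refine integrableOn_of_eq_zero_off hU (sρ.continuousOn.mul (continuousOn_finsetSum _ fun a _ ↦
      (sθ a).continuousOn.mul (smoothOn_dirDeriv hU sX).continuousOn)) hL hLU fun y hy ↦ ?_
    simp only [dirDeriv_eq_zero_off hU hL.isClosed hXL hy, mul_zero, Finset.sum_const_zero]
  have i4 : IntegrableOn (fun y ↦ ∑ a, dirDeriv (basisVec a) (fun z ↦ ρ z * (X z * θ a z)) y)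
      c.target := integrable_finsetSum _ fun a _ ↦ i2 a
  have e1 : ∫ y in c.target, √|(inducedCoord g₁ g₂ ε (Ψ 0) c y).det| *
      (χ (c.symm y) * secondDensity g₁ g₂ ε Ψ (c.symm y)) =
      ∫ y in c.target, ρ y * (X y * secondDensity g₁ g₂ ε Ψ (c.symm y)) :=
    setIntegral_congr_fun hU.measurableSet fun y hy ↦ by simp only [hρ y hy, hXdef]
  have e2 : ∫ y in c.target, √|(inducedCoord g₁ g₂ ε (Ψ 0) c y).det| *
      surfDeriv χ (c.symm y) (accelVec g₁ g₂ ε Ψ (c.symm y)) =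
      ∫ y in c.target, ρ y * ∑ a, θ a y * dirDeriv (basisVec a) X y :=
    setIntegral_congr_fun hU.measurableSet fun y hy ↦ by simp only [hρ y hy, hacc y hy]
  rw [e1, e2]
  refine (setIntegral_mono_on i1 (i4.sub i3) hU.measurableSet hpt).trans (le_of_eq ?_)
  have e3 := integral_sub (μ := volume.restrict c.target) i4 i3
  refine e3.trans ?_
  rw [integral_finsetSum _ fun a _ ↦ i2 a, Finset.sum_eq_zero fun a _ ↦
    setIntegral_dirDeriv_eq_zero hU (sP a) hL hLU (hPL a) _, zero_sub]

-- Near p the sum is constant, and differentials are local; the sum of differentials is computed in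
-- a chart.
omit [MeasurableSpace S] [BorelSpace S] [SecondCountableTopology S] [Nonempty S] in
theorem sum_surfDeriv_eq_zero {ι : Type*} [Fintype ι] {f : ι → S → ℝ}
    (hf : ∀ i, ContMDiff (𝓡 2) 𝓘(ℝ, ℝ) ∞ (f i)) {p : S} (hp : ∀ᶠ q in 𝓝 p, ∑ i, f i q = 1)
    (v : Plane) : ∑ i, surfDeriv (f i) p v = 0 := by
  obtain ⟨c, hc, y, hyt, rfl⟩ : ∃ c ∈ IsManifold.maximalAtlas (𝓡 2) ∞ S, ∃ y ∈ c.target,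
      c.symm y = p :=
    ⟨chartAt Plane p, IsManifold.chart_mem_maximalAtlas _, _, mem_chart_target Plane p,
      (chartAt Plane p).left_inv (mem_chart_source _ p)⟩
  obtain ⟨w, rfl⟩ := chartFrame_surjective hc hyt v
  have hd : ∀ i, DifferentiableAt ℝ (fun z ↦ f i (c.symm z)) y := fun i ↦
    diffAt_of_smoothOn c.open_target (smoothOn_comp_symm hc (hf i)) hyt
  have h1 : ∀ i, surfDeriv (f i) (c.symm y) (chartFrame c y w) =
      dirDeriv w (fun z ↦ f i (c.symm z)) y := fun i ↦
    surfDeriv_chart hc hyt (hd i) (Filter.Eventually.of_forall fun _ ↦ rfl) w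
  simp only [h1]
  rw [← dirDeriv_sum _ fun i _ ↦ hd i]
  have h2 : (fun z ↦ ∑ i, f i (c.symm z)) =ᶠ[𝓝 y] fun _ ↦ 1 :=
    (c.continuousAt_symm hyt).eventually hp
  rw [dirDeriv, h2.fderiv_eq]; simp

/-- The bound by a divergence is available in product charts only, so it is localized by cutoffs.
The error terms -∫ dχ_i(X) cancel in the sum: on K the differentials of the cutoffs add up to zero,
and off K the field X is zero. -/
theorem integral_secondDensity_nonpos [T2Space S] (hΨ : IsNormalFamily g₁ g₂ ε δ Ψ)
    (hP : HasProductCharts g₁ g₂ ε s (Ψ 0)) (hκ₁ : ∀ x, s * g₁.gaussCurvature x ≤ 0)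
    (hκ₂ : ∀ x, s * ε * g₂.gaussCurvature x ≤ 0) (hK : IsCompact K) (hΨK : IsConstOff δ Ψ K) :
    ∫ p in K, secondDensity g₁ g₂ ε Ψ p ∂(areaMeasure g₁ g₂ ε (Ψ 0)) ≤ 0 := by
  have : LocallyCompactSpace S := ChartedSpace.locallyCompactSpace Plane S
  have := isLocallyFiniteMeasure_areaMeasure g₁ g₂ ε (contMDiff_zero₁ hΨ) (contMDiff_zero₂ hΨ)
  -- The partition of unity lives on a larger compact set, so that its sum is 1 on a neighbourhood
  -- of each point of K and not merely on K.
  obtain ⟨K', hK', hKK'⟩ := exists_compact_superset hK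
  choose c hc hpc using id hP
  -- Compact neighbourhoods inside product charts: subordination to their interiors gives the
  -- cutoffs compact support.
  choose N hN hNc hpN using fun p ↦ exists_compact_subset (c p).open_source (hpc p)
  obtain ⟨t, ht⟩ := hK'.elim_finite_subcover (fun p ↦ interior (N p)) (fun p ↦ isOpen_interior)
    fun p _ ↦ mem_iUnion_of_mem p (hNc p)
  obtain ⟨f, hf⟩ := SmoothPartitionOfUnity.exists_isSubordinate (𝓡 2) hK'.isClosed
    (fun i : t ↦ interior (N i)) (fun i ↦ isOpen_interior) (by simpa [iUnion_subtype] using ht)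
  have hfN : ∀ i, tsupport (f i) ⊆ N i := fun i ↦ (hf i).trans interior_subset
  have hfc : ∀ i, HasCompactSupport (f i) := fun i ↦
    (hN i).of_isClosed_subset (isClosed_tsupport _) (hfN i)
  have hsum : ∀ p ∈ K', ∑ i, f i p = 1 := fun p hp ↦ by
    rw [← finsum_eq_sum_of_fintype]; exact f.sum_eq_one hp
  have hz : ∀ p ∉ K, secondDensity g₁ g₂ ε Ψ p = 0 := fun p hp ↦
    secondDensity_of_constOff hΨ hP hK.isClosed hΨK hp
  rw [setIntegral_eq_integral_of_forall_compl_eq_zero hz]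
  have e1 : ∀ p, secondDensity g₁ g₂ ε Ψ p = ∑ i, f i p * secondDensity g₁ g₂ ε Ψ p := fun p ↦ by
    rw [← Finset.sum_mul]
    by_cases hp : p ∈ K
    · rw [hsum p (interior_subset (hKK' hp)), one_mul]
    · rw [hz p hp, mul_zero]
  have e2 : ∀ p, ∑ i, surfDeriv (f i) p (accelVec g₁ g₂ ε Ψ p) = 0 := fun p ↦ by
    by_cases hp : p ∈ K
    · refine sum_surfDeriv_eq_zero (fun i ↦ (f i).contMDiff) ?_ _
      filter_upwards [isOpen_interior.mem_nhds (hKK' hp)] with q hq using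
        hsum q (interior_subset hq)
    · simp [accelVec_of_constOff hΨ hP hK.isClosed hΨK hp]
  have hint : ∀ i, Integrable (fun p ↦ f i p * secondDensity g₁ g₂ ε Ψ p)
      (areaMeasure g₁ g₂ ε (Ψ 0)) := fun i ↦
    ((f i).contMDiff.continuous.mul
      (continuous_secondDensity hΨ hP)).integrable_of_hasCompactSupport (hfc i).mul_right
  rw [integral_congr_ae (ae_of_all _ e1), integral_finsetSum _ fun i _ ↦ hint i]
  refine (Finset.sum_le_sum fun (i : t) _ ↦ integral_mul_secondDensity_le hΨ hP (hc i) hκ₁ hκ₂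
    (f i).contMDiff (f.nonneg i) (hfc i) ((hfN i).trans (hpN i))).trans ?_
  rw [Finset.sum_neg_distrib, ← integral_finsetSum]
  · rw [integral_congr_ae (ae_of_all _ e2), integral_zero, neg_zero]
  · refine fun i _ ↦ (continuous_surfDeriv_accelVec hΨ hP
      (f i).contMDiff).integrable_of_hasCompactSupport (HasCompactSupport.intro (hfc i) ?_)
    intro p hp
    rw [surfDeriv_eq_zero_of_notMem_tsupport hp]; rfl

end FirstVariation

/-! ### From product charts to stability -/

section Stability

variable {M₁ : Type*} [TopologicalSpace M₁] [ChartedSpace Plane M₁] [IsManifold (𝓡 2) ∞ M₁]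
  {M₂ : Type*} [TopologicalSpace M₂] [ChartedSpace Plane M₂] [IsManifold (𝓡 2) ∞ M₂]
  {S : Type*} [TopologicalSpace S] [ChartedSpace Plane S] [IsManifold (𝓡 2) ∞ S]
  {g₁ : LorentzMetric M₁} {g₂ : LorentzMetric M₂} {ε s : ℝ} {Φ : S → M₁ × M₂}

theorem hasProductCharts_of_isLocalProductOf {P₁ : (ℝ → M₁) → Set ℝ → Prop}
    {P₂ : (ℝ → M₂) → Set ℝ → Prop}
    (h₁ : ∀ γ I, P₁ γ I → g₁.IsGeodesicOn γ I ∧ ∀ r ∈ I,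
      0 < s * g₁.inner (γ r) (LorentzMetric.velocity γ r) (LorentzMetric.velocity γ r))
    (h₂ : ∀ γ I, P₂ γ I → g₂.IsGeodesicOn γ I ∧ ∀ r ∈ I,
      0 < s * ε * g₂.inner (γ r) (LorentzMetric.velocity γ r) (LorentzMetric.velocity γ r))
    (hΦ : IsLocalProductOf P₁ P₂ Φ) : HasProductCharts g₁ g₂ ε s Φ := by
  intro p
  obtain ⟨c, hc, hp, I, J, hI, -, hJ, -, ht, φ, ψ, hφ, hψ, he⟩ := hΦ p
  have hm : ∀ y ∈ c.target, y 0 ∈ I ∧ y 1 ∈ J := fun y hy ↦ by rw [ht] at hy; exact hy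
  refine ⟨c, ⟨hc, ⟨I, φ, hI, (h₁ φ I hφ).1, (h₁ φ I hφ).2, fun y hy ↦ ⟨(hm y hy).1, ?_⟩⟩,
    ⟨J, ψ, hJ, (h₂ ψ J hψ).1, (h₂ ψ J hψ).2, fun y hy ↦ ⟨(hm y hy).2, ?_⟩⟩⟩, hp⟩
  · simp only [he y hy]
  · simp only [he y hy]

omit [IsManifold (𝓡 2) ∞ S] in
theorem NormalVariation.isNormalFamily [SecondCountableTopology S] [Nonempty S]
    (F : NormalVariation g₁ g₂ ε Φ) : IsNormalFamily g₁ g₂ ε F.δ F.map where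
  pos := F.δ_pos
  smooth₁ := contMDiff_fst.comp_contMDiffOn F.smooth
  smooth₂ := contMDiff_snd.comp_contMDiffOn F.smooth
  normal p v := by
    -- Normality is given along Φ but needed along the map at parameter 0. The types depend on this
    -- map, so the equation is substituted instead of rewritten.
    obtain ⟨δ, hδ, map, hs, h0, K, hK, he, hn⟩ := F
    subst h0
    exact hn p v

omit [IsManifold (𝓡 2) ∞ S] in
theorem NormalVariation.isConstOff [SecondCountableTopology S] [Nonempty S]
    (F : NormalVariation g₁ g₂ ε Φ) : IsConstOff F.δ F.map F.K := fun u hu p hp ↦ by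
  rw [F.eq_off u hu p hp, F.map_zero]

theorem isStable_of_hasProductCharts [T2Space S] [SecondCountableTopology S] [Nonempty S]
    (hP : HasProductCharts g₁ g₂ ε s Φ) (hκ₁ : ∀ x, s * g₁.gaussCurvature x ≤ 0)
    (hκ₂ : ∀ x, s * ε * g₂.gaussCurvature x ≤ 0) : IsStable g₁ g₂ ε Φ := by
  let _ : MeasurableSpace S := borel S
  have : BorelSpace S := ⟨rfl⟩
  -- Whatever the sign s, it is the alternative ≤ 0 that holds.
  refine Or.inl fun F ↦ ?_
  have hP0 : HasProductCharts g₁ g₂ ε s (F.map 0) := by rwa [F.map_zero]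
  have h := contDiffAt_volumeOn_family F.isNormalFamily hP0 F.isCompact F.isCompact.measurableSet
  refine ⟨h.1, ?_⟩
  exact h.2.trans_le (integral_secondDensity_nonpos F.isNormalFamily hP0 hκ₁ hκ₂ F.isCompact
    F.isConstOff)

end Stability

end ParaKahlerProduct
end

/-! ### The theorem -/

open ParaKahlerProduct in
theorem theorem4
    {M₁ : Type*} [TopologicalSpace M₁] [T2Space M₁] [SecondCountableTopology M₁]
    [ConnectedSpace M₁] [ChartedSpace Plane M₁] [IsManifold (𝓡 2) ∞ M₁]
    {M₂ : Type*} [TopologicalSpace M₂] [T2Space M₂] [SecondCountableTopology M₂]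
    [ConnectedSpace M₂] [ChartedSpace Plane M₂] [IsManifold (𝓡 2) ∞ M₂]
    (g₁ : LorentzMetric M₁) (j₁ : ParaComplexStructure g₁)
    (g₂ : LorentzMetric M₂) (j₂ : ParaComplexStructure g₂)
    {S : Type*} [TopologicalSpace S] [T2Space S] [SecondCountableTopology S] [Nonempty S]
    [ChartedSpace Plane S] [IsManifold (𝓡 2) ∞ S]
    (Φ : S → M₁ × M₂) (hΦ : IsSmoothImmersion Φ) :
    -- (i), spacelike geodesics
    ((∀ x, g₁.gaussCurvature x ≤ 0) → (∀ y, g₂.gaussCurvature y ≤ 0) →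
      IsLagrangian j₁ j₂ 1 Φ → IsMinimal g₁ g₂ 1 Φ →
      IsLocalProductOf g₁.IsSpacelikeGeodesicOn g₂.IsSpacelikeGeodesicOn Φ →
      IsStable g₁ g₂ 1 Φ) ∧
    -- (i), timelike geodesics
    ((∀ x, 0 ≤ g₁.gaussCurvature x) → (∀ y, 0 ≤ g₂.gaussCurvature y) →
      IsLagrangian j₁ j₂ 1 Φ → IsMinimal g₁ g₂ 1 Φ →
      IsLocalProductOf g₁.IsTimelikeGeodesicOn g₂.IsTimelikeGeodesicOn Φ →
      IsStable g₁ g₂ 1 Φ) ∧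
    -- (ii)
    ((∀ x, g₁.gaussCurvature x ≤ 0) → (∀ y, 0 ≤ g₂.gaussCurvature y) →
      IsLagrangian j₁ j₂ (-1) Φ → IsMinimal g₁ g₂ (-1) Φ →
      IsLocalProductOf g₁.IsSpacelikeGeodesicOn g₂.IsTimelikeGeodesicOn Φ →
      IsStable g₁ g₂ (-1) Φ) := by
  -- The value of s is the common sign of g₁(φ', φ') and ε g₂(ψ', ψ'). In (ii) the timelike ψ has
  -- positive square for -g₂, so s = 1 while s * ε = -1. The conditions s κ₁ ≤ 0 and s ε κ₂ ≤ 0 are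
  -- then the assumed curvature signs.
  refine ⟨fun h₁ h₂ _ _ hp ↦ isStable_of_hasProductCharts (s := 1)
      (hasProductCharts_of_isLocalProductOf (fun γ I h ↦ ⟨h.1, fun r hr ↦ ?_⟩)
        (fun γ I h ↦ ⟨h.1, fun r hr ↦ ?_⟩) hp) (fun x ↦ ?_) (fun y ↦ ?_),
    fun h₁ h₂ _ _ hp ↦ isStable_of_hasProductCharts (s := -1)
      (hasProductCharts_of_isLocalProductOf (fun γ I h ↦ ⟨h.1, fun r hr ↦ ?_⟩)
        (fun γ I h ↦ ⟨h.1, fun r hr ↦ ?_⟩) hp) (fun x ↦ ?_) (fun y ↦ ?_),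
    fun h₁ h₂ _ _ hp ↦ isStable_of_hasProductCharts (s := 1)
      (hasProductCharts_of_isLocalProductOf (fun γ I h ↦ ⟨h.1, fun r hr ↦ ?_⟩)
        (fun γ I h ↦ ⟨h.1, fun r hr ↦ ?_⟩) hp) (fun x ↦ ?_) (fun y ↦ ?_)⟩
  · linarith [h.2 r hr]
  · linarith [h.2 r hr]
  · linarith [h₁ x]
  · linarith [h₂ y]
  · linarith [h.2 r hr]
  · linarith [h.2 r hr]
  · linarith [h₁ x]
  · linarith [h₂ y]
  · linarith [h.2 r hr]
  · linarith [h.2 r hr]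
  · linarith [h₁ x]
  · linarith [h₂ y]
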